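/- Let $p$ be a prime and let $S$ be a finite $p$-group. An $(S,S)$-biset is a set with commuting left and right $S$-actions. It is left-free (resp. bifree) if the left action is free (resp. both actions are free). For finite groups $G,H$ let $A(G,H)$ be the Grothendieck group of isomorphism classes of finite left-free bisets with a right $G$-action and a left $H$-action, and put $A(G,H)_{(p)}=\mathbb Z_{(p)}\otimes A(G,H)$, with composition $[X]\circ[Y]=[X\times_H Y]$ and cartesian product $[X]\times[Y]=[X\times Y]$ extended bilinearly. For $P\le G$ and a homomorphism $\varphi\colon P\to H$, let $[P,\varphi]=[P,\varphi]_G^H$ be the class of $(H\times G)/\big((x,ky)\sim(x\varphi(k),y),\,k\in P\big)$; these elements form the standard basis, indexed by the $(H\times G)$-conjugacy classes of the graphs $\Delta(P,\varphi)=\{(\varphi(k),k) : k\in P\}$. For $X\in A(S,S)_{(p)}$, let $c_{\langle P,\varphi\rangle}(X)$ be the coefficient of $X$ at $[P,\varphi]$, let $\Phi_{\langle P,\varphi\rangle}$ be the linear extension of $[X]\mapsto|\{x\in X : xk=\varphi(k)x\ \forall k\in P\}|$, and let the augmentation $\varepsilon$ be the linear extension of $[X]\mapsto|S\backslash X|$.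 An element is bifree if it lies in the submodule of $A(S,S)_{(p)}$ generated by the classes of bifree bisets. Given $X\in A(S,S)_{(p)}$, define sets of injective homomorphisms $\varphi\colon P\to Q$ for $P,Q\le S$: the pre-fixed-point system $\mathrm{PreFix}(X)=\{\varphi : \Phi_{\langle P,\varphi\rangle}(X)\neq0\}$; the pre-orbit-type system $\mathrm{PreOrb}(X)=\{\varphi : c_{\langle P,\varphi\rangle}(X)\ne 0\}$; and the right-stabilizer fusion system $\mathrm{RStab}(X)=\{\varphi : X\circ[P,\varphi]_P^S=X\circ[P,\mathrm{incl}]_P^S\}$. The fixed-point fusion system $\mathrm{Fix}(X)$ and the orbit-type fusion system $\mathrm{Orb}(X)$ are the smallest fusion systems on $S$ containing $\mathrm{PreFix}(X)$ and $\mathrm{PreOrb}(X)$, respectively. The element $X$ is right-characteristic for a fusion system $\mathcal F$ on $S$ if (a) $X$ lies in the submodule generated by the $[T,\varphi]$ with $T\le S$, $\varphi\in\mathrm{Hom}_{\mathcal F}(T,S)$; (b) $X\circ[P,\varphi]_P^S=X\circ[P,\mathrm{incl}]_P^S$ for all $P\le S$ and $\varphi\in\mathrm{Hom}_{\mathcal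 F}(P,S)$; (c) $\varepsilon(X)$ is not divisible by $p$ in $\mathbb Z_{(p)}$. It satisfies Frobenius reciprocity if $$(X\times X)\circ[S,\Delta]=(X\times 1)\circ[S,\Delta]\circ X\quad\text{in }A(S,S\times S)_{(p)},$$ where $\Delta\colon S\to S\times S$ is the diagonal and $1=[S,\mathrm{id}]$. Theorem. Let $X$ be a bifree element of $A(S,S)_{(p)}$ whose augmentation is not divisible by $p$. Then $X$ is a right-characteristic element for some saturated fusion system on $S$ if and only if $X$ satisfies Frobenius reciprocity. In that case $$\mathrm{PreFix}(X)=\mathrm{Fix}(X)=\mathrm{Orb}(X)=\mathrm{RStab}(X),$$ and $\mathrm{RStab}(X)$ is saturated (in the sense of Broto--Levi--Oliver) with right-characteristic element $X$. -/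

import Mathlib

open scoped TensorProduct

universe u

namespace BurnsideFusion

/-! ### Bisets -/

/-- A finite left-free `(G,H)`-biset: a finite set with a right `G`-action and a free left
`H`-action which commute. -/
structure Biset (G H : Type u) [Group G] [Group H] where
  carrier : Type u
  finite : Finite carrier
  lact : H → carrier → carrier
  ract : carrier → G → carrier
  one_lact : ∀ x, lact 1 x = x
  mul_lact : ∀ a b x, lact (a * b) x = lact a (lact b x)
  ract_one : ∀ x, ract x 1 = x
  ract_mul : ∀ x a b, ract x (a * b) = ract (ract x a) b
  lact_ract : ∀ h x g, ract (lact h x) g = lact h (ract x g)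
  free : ∀ h x, lact h x = x → h = 1

namespace Biset

section
variable {G H : Type u} [Group G] [Group H]

/-- A (left-free) biset is bifree if the right action is free as well. -/
def IsBifree (X : Biset G H) : Prop := ∀ x g, X.ract x g = x → g = 1

/-- The left `H`-set underlying a biset. -/
instance leftAction (X : Biset G H) : MulAction H X.carrier where
  smul := X.lact
  one_smul := X.one_lact
  mul_smul := X.mul_lact

/-- The `(H × G)`-set corresponding to a `(G,H)`-biset: `(h, g) x = h x g⁻¹`. -/
instance hatAction (X : Biset G H) : MulAction (H × G) X.carrier where
  smul a x := X.ract (X.lact a.1 x) a.2⁻¹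
  one_smul x := by
    change X.ract (X.lact 1 x) (1 : G)⁻¹ = x
    rw [inv_one, X.one_lact, X.ract_one]
  mul_smul a b x := by
    change X.ract (X.lact (a.1 * b.1) x) (a.2 * b.2)⁻¹
      = X.ract (X.lact a.1 (X.ract (X.lact b.1 x) b.2⁻¹)) a.2⁻¹
    rw [mul_inv_rev, X.mul_lact, X.ract_mul, X.lact_ract (a.1)]

/-- An isomorphism of bisets. -/
structure Iso (X Y : Biset G H) where
  toEquiv : X.carrier ≃ Y.carrier
  map_lact : ∀ h x, toEquiv (X.lact h x) = Y.lact h (toEquiv x)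
  map_ract : ∀ x g, toEquiv (X.ract x g) = Y.ract (toEquiv x) g

namespace Iso

def refl (X : Biset G H) : Iso X X := ⟨Equiv.refl _, fun _ _ => rfl, fun _ _ => rfl⟩

def symm {X Y : Biset G H} (e : Iso X Y) : Iso Y X :=
  ⟨e.toEquiv.symm,
    fun h y => by rw [Equiv.symm_apply_eq, e.map_lact, Equiv.apply_symm_apply],
    fun y g => by rw [Equiv.symm_apply_eq, e.map_ract, Equiv.apply_symm_apply]⟩

def trans {X Y Z : Biset G H} (e : Iso X Y) (f : Iso Y Z) : Iso X Z :=
  ⟨e.toEquiv.trans f.toEquiv,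
    fun h x => by simp only [Equiv.trans_apply, e.map_lact, f.map_lact],
    fun x g => by simp only [Equiv.trans_apply, e.map_ract, f.map_ract]⟩

noncomputable def ofBijective {X Y : Biset G H} (f : X.carrier → Y.carrier)
    (hf : Function.Bijective f) (hl : ∀ h x, f (X.lact h x) = Y.lact h (f x))
    (hr : ∀ x g, f (X.ract x g) = Y.ract (f x) g) : Iso X Y :=
  ⟨Equiv.ofBijective f hf, hl, hr⟩

end Iso

/-- Isomorphism of bisets, as an equivalence relation. -/
instance isoSetoid (G H : Type u) [Group G] [Group H] : Setoid (Biset G H) where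
  r X Y := Nonempty (Iso X Y)
  iseqv := ⟨fun X => ⟨Iso.refl X⟩, fun ⟨e⟩ => ⟨e.symm⟩, fun ⟨e⟩ ⟨f⟩ => ⟨e.trans f⟩⟩

/-- The empty biset. -/
def empty (G H : Type u) [Group G] [Group H] : Biset G H where
  carrier := PEmpty
  finite := inferInstance
  lact _ x := x
  ract x _ := x
  one_lact _ := rfl
  mul_lact _ _ _ := rfl
  ract_one _ := rfl
  ract_mul _ _ _ := rfl
  lact_ract _ _ _ := rfl
  free _ x := x.elim

/-- The disjoint union of two bisets. -/
def sum (X Y : Biset G H) : Biset G H where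
  carrier := X.carrier ⊕ Y.carrier
  finite := by have := X.finite; have := Y.finite; infer_instance
  lact h := Sum.map (X.lact h) (Y.lact h)
  ract z g := Sum.map (X.ract · g) (Y.ract · g) z
  one_lact := by rintro (x | x) <;> simp [X.one_lact, Y.one_lact]
  mul_lact := by rintro a b (x | x) <;> simp [X.mul_lact, Y.mul_lact]
  ract_one := by rintro (x | x) <;> simp [X.ract_one, Y.ract_one]
  ract_mul := by rintro (x | x) a b <;> simp [X.ract_mul, Y.ract_mul]
  lact_ract := by rintro h (x | x) g <;> simp [X.lact_ract, Y.lact_ract]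
  free := by
    rintro h (x | x) e
    · exact X.free h x (by simpa using e)
    · exact Y.free h x (by simpa using e)

/-- The equivalence relation `(x, k y) ∼ (x φ(k), y)`, `k ∈ K`, on `H × G`, for a `(G,H)`-pair
`(K, φ)`. -/
def stdSetoid (K : Subgroup G) (φ : K →* H) : Setoid (H × G) where
  r a b := ∃ k : K, a.2 = k * b.2 ∧ b.1 = a.1 * φ k
  iseqv := by
    refine ⟨fun a => ⟨1, by simp, by simp⟩, ?_, ?_⟩
    · rintro a b ⟨k, h1, h2⟩
      exact ⟨k⁻¹, by simp [h1], by simp [h2]⟩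
    · rintro a b c ⟨k, h1, h2⟩ ⟨l, h3, h4⟩
      exact ⟨k * l, by simp [h1, h3, mul_assoc], by simp [h2, h4, mul_assoc]⟩

/-- The `(G,H)`-biset `H ×_{(K,φ)} G = (H × G)/∼`, where `(x, k y) ∼ (x φ(k), y)` for `k ∈ K`,
of a `(G,H)`-pair `(K, φ)`. -/
def std [Finite G] [Finite H] (K : Subgroup G) (φ : K →* H) : Biset G H where
  carrier := Quotient (stdSetoid K φ)
  finite := inferInstance
  lact h := Quotient.map (sa := stdSetoid K φ) (sb := stdSetoid K φ) (fun a => (h * a.1, a.2))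
    (fun a b ⟨k, h1, h2⟩ => ⟨k, h1, by simp [h2, mul_assoc]⟩)
  ract z g := Quotient.map (sa := stdSetoid K φ) (sb := stdSetoid K φ) (fun a => (a.1, a.2 * g))
    (fun a b ⟨k, h1, h2⟩ => ⟨k, by simp [h1, mul_assoc], h2⟩) z
  one_lact := by rintro ⟨a⟩; exact congrArg (Quotient.mk (stdSetoid K φ)) (Prod.ext (one_mul _) rfl)
  mul_lact := by
    rintro x y ⟨a⟩
    exact congrArg (Quotient.mk (stdSetoid K φ)) (Prod.ext (mul_assoc _ _ _) rfl)
  ract_one := by rintro ⟨a⟩; exact congrArg (Quotient.mk (stdSetoid K φ)) (Prod.ext rfl (mul_one _))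
  ract_mul := by
    rintro ⟨a⟩ x y
    exact congrArg (Quotient.mk (stdSetoid K φ)) (Prod.ext rfl (mul_assoc _ _ _).symm)
  lact_ract := by rintro x ⟨a⟩ y; rfl
  free := by
    rintro h ⟨a⟩ e
    obtain ⟨k, h1, h2⟩ := Quotient.exact e
    have hk : (k : G) = 1 := by simpa using h1
    have hk' : k = 1 := Subtype.ext hk
    subst hk'
    simpa using h2

/-- The `(G,H)`-biset `[G, φ]` of a homomorphism `φ : G → H` defined on all of `G`. -/
def ofHom [Finite G] [Finite H] (φ : G →* H) : Biset G H :=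
  std ⊤ (φ.comp (⊤ : Subgroup G).subtype)

end

section
variable {G H K : Type u} [Group G] [Group H] [Group K]

/-- The equivalence relation on `X × Y` consisting of the pairs `(x h, y) ∼ (x, h y)`. -/
def compSetoid (X : Biset H K) (Y : Biset G H) : Setoid (X.carrier × Y.carrier) where
  r a b := ∃ h : H, a.1 = X.ract b.1 h ∧ Y.lact h a.2 = b.2
  iseqv := by
    refine ⟨fun a => ⟨1, by simp [X.ract_one], by simp [Y.one_lact]⟩, ?_, ?_⟩
    · rintro a b ⟨h, h1, h2⟩
      exact ⟨h⁻¹, by simp [h1, ← X.ract_mul, X.ract_one],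
        by simp [← h2, ← Y.mul_lact, Y.one_lact]⟩
    · rintro a b c ⟨h, h1, h2⟩ ⟨h', h3, h4⟩
      exact ⟨h' * h, by rw [h1, h3, X.ract_mul], by rw [Y.mul_lact, h2, h4]⟩

/-- The composite biset `X ∘ Y = X ×_H Y`. -/
def comp (X : Biset H K) (Y : Biset G H) : Biset G K where
  carrier := Quotient (compSetoid X Y)
  finite := by have := X.finite; have := Y.finite; infer_instance
  lact k := Quotient.map (sa := compSetoid X Y) (sb := compSetoid X Y) (fun a => (X.lact k a.1, a.2))
    (fun a b ⟨h, h1, h2⟩ => ⟨h, by simp [h1, X.lact_ract], h2⟩)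
  ract z g := Quotient.map (sa := compSetoid X Y) (sb := compSetoid X Y) (fun a => (a.1, Y.ract a.2 g))
    (fun a b ⟨h, h1, h2⟩ => ⟨h, h1, by simp [← h2, Y.lact_ract]⟩) z
  one_lact := by rintro ⟨a⟩; exact congrArg (Quotient.mk (compSetoid X Y)) (Prod.ext (X.one_lact _) rfl)
  mul_lact := by
    rintro x y ⟨a⟩
    exact congrArg (Quotient.mk (compSetoid X Y)) (Prod.ext (X.mul_lact _ _ _) rfl)
  ract_one := by rintro ⟨a⟩; exact congrArg (Quotient.mk (compSetoid X Y)) (Prod.ext rfl (Y.ract_one _))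
  ract_mul := by
    rintro ⟨a⟩ x y
    exact congrArg (Quotient.mk (compSetoid X Y)) (Prod.ext rfl (Y.ract_mul _ _ _))
  lact_ract := by rintro x ⟨a⟩ y; rfl
  free := by
    rintro k ⟨a⟩ e
    obtain ⟨h, h1, h2⟩ := Quotient.exact e
    have hh : h = 1 := Y.free h _ h2
    subst hh
    exact X.free k _ (by simpa [X.ract_one] using h1)

/-- The class of `(x, y)` in `X ×_H Y`. -/
def compMk (X : Biset H K) (Y : Biset G H) (x : X.carrier) (y : Y.carrier) :
    (comp X Y).carrier :=
  Quotient.mk (compSetoid X Y) (x, y)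

theorem compMk_eq {X : Biset H K} {Y : Biset G H} {x x' : X.carrier} {y y' : Y.carrier} :
    compMk X Y x y = compMk X Y x' y' ↔ ∃ h : H, x = X.ract x' h ∧ Y.lact h y = y' :=
  Quotient.eq (r := compSetoid X Y)

theorem compMk_ract {X : Biset H K} {Y : Biset G H} (x : X.carrier) (h : H) (y : Y.carrier) :
    compMk X Y (X.ract x h) y = compMk X Y x (Y.lact h y) :=
  compMk_eq.2 ⟨h, rfl, rfl⟩

theorem comp_ind {X : Biset H K} {Y : Biset G H} {P : (comp X Y).carrier → Prop}
    (h : ∀ x y, P (compMk X Y x y)) (z : (comp X Y).carrier) : P z :=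
  Quotient.inductionOn z fun a => h a.1 a.2

theorem lact_compMk {X : Biset H K} {Y : Biset G H} (k : K) (x : X.carrier) (y : Y.carrier) :
    (comp X Y).lact k (compMk X Y x y) = compMk X Y (X.lact k x) y := rfl

theorem ract_compMk {X : Biset H K} {Y : Biset G H} (x : X.carrier) (y : Y.carrier) (g : G) :
    (comp X Y).ract (compMk X Y x y) g = compMk X Y x (Y.ract y g) := rfl

/-- Maps out of `X ×_H Y`. -/
def compLift {X : Biset H K} {Y : Biset G H} {α : Sort*} (f : X.carrier → Y.carrier → α)
    (hf : ∀ x h y, f (X.ract x h) y = f x (Y.lact h y)) (z : (comp X Y).carrier) : α :=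
  Quotient.lift (s := compSetoid X Y) (fun a => f a.1 a.2)
    (by
      rintro ⟨x, y⟩ ⟨x', y'⟩ ⟨h, h1, h2⟩
      change x = X.ract x' h at h1
      change Y.lact h y = y' at h2
      subst h1 h2
      exact hf _ _ _) z

theorem compLift_mk {X : Biset H K} {Y : Biset G H} {α : Sort*} (f : X.carrier → Y.carrier → α)
    (hf : ∀ x h y, f (X.ract x h) y = f x (Y.lact h y)) (x : X.carrier) (y : Y.carrier) :
    compLift f hf (compMk X Y x y) = f x y := rfl

/-- Composition respects isomorphisms. -/
noncomputable def compCongr {X X' : Biset H K} {Y Y' : Biset G H} (e : Iso X X') (f : Iso Y Y') :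
    Iso (comp X Y) (comp X' Y') :=
  Iso.ofBijective
    (compLift (fun x y => compMk X' Y' (e.toEquiv x) (f.toEquiv y))
      (fun x h y => by rw [e.map_ract, f.map_lact, compMk_ract]))
    (by
      constructor
      · refine comp_ind fun x y => comp_ind fun x' y' => ?_
        rw [compLift_mk, compLift_mk, compMk_eq, compMk_eq]
        rintro ⟨h, h1, h2⟩
        refine ⟨h, e.toEquiv.injective ?_, f.toEquiv.injective ?_⟩
        · rw [h1, e.map_ract]
        · rw [← h2, f.map_lact]
      · refine comp_ind fun x y => ⟨compMk X Y (e.toEquiv.symm x) (f.toEquiv.symm y), ?_⟩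
        rw [compLift_mk, Equiv.apply_symm_apply, Equiv.apply_symm_apply])
    (fun k => comp_ind fun x y => by
      rw [lact_compMk, compLift_mk, compLift_mk, lact_compMk, e.map_lact])
    (fun z g => by
      induction z using comp_ind with
      | h x y => rw [ract_compMk, compLift_mk, compLift_mk, ract_compMk, f.map_ract])

/-- Composition distributes over disjoint unions in the first variable. -/
noncomputable def sumComp (X X' : Biset H K) (Y : Biset G H) :
    Iso (sum (comp X Y) (comp X' Y)) (comp (sum X X') Y) :=
  Iso.ofBijective
    (Sum.elim
      (compLift (fun x y => compMk (sum X X') Y (Sum.inl x) y)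
        (fun x h y => compMk_ract (X := sum X X') (Sum.inl x) h y))
      (compLift (fun x y => compMk (sum X X') Y (Sum.inr x) y)
        (fun x h y => compMk_ract (X := sum X X') (Sum.inr x) h y)))
    (by
      constructor
      · rintro (z | z) (w | w) <;> induction z using comp_ind with | h x y => ?_ <;>
          induction w using comp_ind with | h x' y' => ?_ <;> intro e <;>
          obtain ⟨h, h1, h2⟩ := compMk_eq.1 e
        · exact congrArg Sum.inl (compMk_eq.2 ⟨h, Sum.inl_injective h1, h2⟩)
        · cases h1
        · cases h1
        · exact congrArg Sum.inr (compMk_eq.2 ⟨h, Sum.inr_injective h1, h2⟩)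
      · refine comp_ind ?_
        rintro (x | x) y
        · exact ⟨Sum.inl (compMk X Y x y), rfl⟩
        · exact ⟨Sum.inr (compMk X' Y x y), rfl⟩)
    (by
      rintro k (z | z) <;> induction z using comp_ind with | h x y => ?_ <;> rfl)
    (by
      rintro (z | z) g <;> induction z using comp_ind with | h x y => ?_ <;> rfl)

/-- Composition distributes over disjoint unions in the second variable. -/
noncomputable def compSum (X : Biset H K) (Y Y' : Biset G H) :
    Iso (sum (comp X Y) (comp X Y')) (comp X (sum Y Y')) :=
  Iso.ofBijective
    (Sum.elim
      (compLift (fun x y => compMk X (sum Y Y') x (Sum.inl y))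
        (fun x h y => compMk_ract (Y := sum Y Y') x h (Sum.inl y)))
      (compLift (fun x y => compMk X (sum Y Y') x (Sum.inr y))
        (fun x h y => compMk_ract (Y := sum Y Y') x h (Sum.inr y))))
    (by
      constructor
      · rintro (z | z) (w | w) <;> induction z using comp_ind with | h x y => ?_ <;>
          induction w using comp_ind with | h x' y' => ?_ <;> intro e <;>
          obtain ⟨h, h1, h2⟩ := compMk_eq.1 e
        · exact congrArg Sum.inl (compMk_eq.2 ⟨h, h1, Sum.inl_injective h2⟩)
        · cases h2
        · cases h2
        · exact congrArg Sum.inr (compMk_eq.2 ⟨h, h1, Sum.inr_injective h2⟩)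
      · refine comp_ind ?_
        rintro x (y | y)
        · exact ⟨Sum.inl (compMk X Y x y), rfl⟩
        · exact ⟨Sum.inr (compMk X Y' x y), rfl⟩)
    (by
      rintro k (z | z) <;> induction z using comp_ind with | h x y => ?_ <;> rfl)
    (by
      rintro (z | z) g <;> induction z using comp_ind with | h x y => ?_ <;> rfl)

/-- Composition is associative up to isomorphism. -/
noncomputable def compAssoc {L : Type u} [Group L]
    (X : Biset H K) (Y : Biset G H) (Z : Biset L G) :
    Iso (comp (comp X Y) Z) (comp X (comp Y Z)) :=
  Iso.ofBijective
    (compLift (fun w z => compLift (fun x y => compMk X (comp Y Z) x (compMk Y Z y z))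
        (fun x h y => by rw [compMk_ract, lact_compMk]) w)
      (fun w g z => by
        induction w using comp_ind with
        | h x y => rw [ract_compMk, compLift_mk, compLift_mk, compMk_ract]))
    (by
      constructor
      · refine comp_ind fun w z => comp_ind fun w' z' => ?_
        induction w using comp_ind with | h x y => ?_
        induction w' using comp_ind with | h x' y' => ?_
        rw [compLift_mk, compLift_mk, compLift_mk, compLift_mk, compMk_eq]
        rintro ⟨h, h1, h2⟩
        rw [lact_compMk, compMk_eq] at h2
        obtain ⟨g, h3, h4⟩ := h2
        rw [compMk_eq]
        refine ⟨g, ?_, h4⟩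
        rw [ract_compMk, ← h3, h1, compMk_ract]
      · refine comp_ind fun x w => ?_
        induction w using comp_ind with | h y z => ?_
        exact ⟨compMk (comp X Y) Z (compMk X Y x y) z, rfl⟩)
    (by
      intro k w
      induction w using comp_ind with | h w z => ?_
      induction w using comp_ind with | h x y => ?_
      rfl)
    (by
      intro w g
      induction w using comp_ind with | h w z => ?_
      induction w using comp_ind with | h x y => ?_
      rfl)

end

section
variable {G H G' H' : Type u} [Group G] [Group H] [Group G'] [Group H']

/-- The cartesian product of a `(G,H)`-biset and a `(G',H')`-biset. -/
def prod (X : Biset G H) (Y : Biset G' H') : Biset (G × G') (H × H') where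
  carrier := X.carrier × Y.carrier
  finite := by have := X.finite; have := Y.finite; infer_instance
  lact h a := (X.lact h.1 a.1, Y.lact h.2 a.2)
  ract a g := (X.ract a.1 g.1, Y.ract a.2 g.2)
  one_lact a := Prod.ext (X.one_lact _) (Y.one_lact _)
  mul_lact _ _ _ := Prod.ext (X.mul_lact _ _ _) (Y.mul_lact _ _ _)
  ract_one _ := Prod.ext (X.ract_one _) (Y.ract_one _)
  ract_mul _ _ _ := Prod.ext (X.ract_mul _ _ _) (Y.ract_mul _ _ _)
  lact_ract _ _ _ := Prod.ext (X.lact_ract _ _ _) (Y.lact_ract _ _ _)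
  free h a e := Prod.ext (X.free _ _ (congrArg Prod.fst e)) (Y.free _ _ (congrArg Prod.snd e))

def prodCongr {X X' : Biset G H} {Y Y' : Biset G' H'} (e : Iso X X') (f : Iso Y Y') :
    Iso (prod X Y) (prod X' Y') where
  toEquiv := Equiv.prodCongr e.toEquiv f.toEquiv
  map_lact _ _ := Prod.ext (e.map_lact _ _) (f.map_lact _ _)
  map_ract _ _ := Prod.ext (e.map_ract _ _) (f.map_ract _ _)

def sumProd (X X' : Biset G H) (Y : Biset G' H') :
    Iso (prod (sum X X') Y) (sum (prod X Y) (prod X' Y)) where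
  toEquiv := Equiv.sumProdDistrib _ _ _
  map_lact := by rintro h ⟨x | x, y⟩ <;> rfl
  map_ract := by rintro ⟨x | x, y⟩ h <;> rfl

def prodSum (X : Biset G H) (Y Y' : Biset G' H') :
    Iso (prod X (sum Y Y')) (sum (prod X Y) (prod X Y')) where
  toEquiv := Equiv.prodSumDistrib _ _ _
  map_lact := by rintro h ⟨x, y | y⟩ <;> rfl
  map_ract := by rintro ⟨x, y | y⟩ h <;> rfl

end

section
variable {G H : Type u} [Group G] [Group H]

def sumCongr {X X' Y Y' : Biset G H} (e : Iso X X') (f : Iso Y Y') :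
    Iso (sum X Y) (sum X' Y') where
  toEquiv := Equiv.sumCongr e.toEquiv f.toEquiv
  map_lact := by
    rintro h (x | x)
    · exact congrArg Sum.inl (e.map_lact _ _)
    · exact congrArg Sum.inr (f.map_lact _ _)
  map_ract := by
    rintro (x | x) h
    · exact congrArg Sum.inl (e.map_ract _ _)
    · exact congrArg Sum.inr (f.map_ract _ _)

def sumComm (X Y : Biset G H) : Iso (sum X Y) (sum Y X) where
  toEquiv := Equiv.sumComm _ _
  map_lact := by rintro h (x | x) <;> rfl
  map_ract := by rintro (x | x) h <;> rfl

def sumAssoc (X Y Z : Biset G H) : Iso (sum (sum X Y) Z) (sum X (sum Y Z)) where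
  toEquiv := Equiv.sumAssoc _ _ _
  map_lact := by rintro h ((x | x) | x) <;> rfl
  map_ract := by rintro ((x | x) | x) h <;> rfl

def emptySum (X : Biset G H) : Iso (sum (empty G H) X) X where
  toEquiv := Equiv.emptySum PEmpty _
  map_lact := by rintro h (x | x); exacts [x.elim, rfl]
  map_ract := by rintro (x | x) h; exacts [x.elim, rfl]

/-! #### Numerical invariants of bisets -/

/-- The number `|H \ X|` of orbits of the left action. -/
noncomputable def numLeftOrbits (X : Biset G H) : ℕ :=
  (Set.range fun x : X.carrier => MulAction.orbit H x).ncard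

/-- The twisted diagonal `Δ(K,φ) = {(φ(k), k) | k ∈ K}` in `H × G`. -/
def graph (K : Subgroup G) (φ : K →* H) : Subgroup (H × G) :=
  (φ.prod K.subtype).range

/-- The number of those `(H × G)`-orbits of `X` which are isomorphic to `(H × G)/Δ(K,φ)`,
i.e. contain a point with stabilizer `Δ(K,φ)`. -/
noncomputable def numOrbitsOfType (K : Subgroup G) (φ : K →* H) (X : Biset G H) : ℕ :=
  {O : Set X.carrier | ∃ x, MulAction.stabilizer (H × G) x = graph K φ ∧
    O = MulAction.orbit (H × G) x}.ncard

/-- The number of elements of `X^{(K,φ)} = {x | x k = φ(k) x for all k ∈ K}`. -/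
noncomputable def numFixed (K : Subgroup G) (φ : K →* H) (X : Biset G H) : ℕ :=
  {x : X.carrier | ∀ k : K, X.ract x k = X.lact (φ k) x}.ncard

theorem ncard_orbits_sum {Γ Z X Y : Type*} [Group Γ] [MulAction Γ X] [MulAction Γ Y]
    [MulAction Γ Z] [Finite X] [Finite Y] (i : X → Z) (j : Y → Z)
    (hi : ∀ (γ : Γ) x, i (γ • x) = γ • i x) (hj : ∀ (γ : Γ) y, j (γ • y) = γ • j y)
    (ii : Function.Injective i) (jj : Function.Injective j) (hd : ∀ x y, i x ≠ j y)
    (hc : ∀ z, (∃ x, i x = z) ∨ ∃ y, j y = z)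
    (P : X → Prop) (Q : Y → Prop) (R : Z → Prop) (hP : ∀ x, R (i x) ↔ P x)
    (hQ : ∀ y, R (j y) ↔ Q y) :
    {O : Set Z | ∃ z, R z ∧ O = MulAction.orbit Γ z}.ncard =
      {O : Set X | ∃ z, P z ∧ O = MulAction.orbit Γ z}.ncard +
      {O : Set Y | ∃ z, Q z ∧ O = MulAction.orbit Γ z}.ncard := by
  have oi : ∀ x, MulAction.orbit Γ (i x) = i '' MulAction.orbit Γ x := by
    intro x; ext z; constructor
    · rintro ⟨γ, rfl⟩; exact ⟨γ • x, ⟨γ, rfl⟩, hi _ _⟩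
    · rintro ⟨_, ⟨γ, rfl⟩, rfl⟩; exact ⟨γ, (hi _ _).symm⟩
  have oj : ∀ x, MulAction.orbit Γ (j x) = j '' MulAction.orbit Γ x := by
    intro x; ext z; constructor
    · rintro ⟨γ, rfl⟩; exact ⟨γ • x, ⟨γ, rfl⟩, hj _ _⟩
    · rintro ⟨_, ⟨γ, rfl⟩, rfl⟩; exact ⟨γ, (hj _ _).symm⟩
  rw [← Set.ncard_image_of_injective _ ii.image_injective,
    ← Set.ncard_image_of_injective _ jj.image_injective, ← Set.ncard_union_eq]
  · congr 1
    ext O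
    constructor
    · rintro ⟨z, hz, rfl⟩
      rcases hc z with ⟨x, rfl⟩ | ⟨y, rfl⟩
      · exact Or.inl ⟨_, ⟨x, (hP x).1 hz, rfl⟩, (oi x).symm⟩
      · exact Or.inr ⟨_, ⟨y, (hQ y).1 hz, rfl⟩, (oj y).symm⟩
    · rintro (⟨_, ⟨x, hx, rfl⟩, rfl⟩ | ⟨_, ⟨x, hx, rfl⟩, rfl⟩)
      · exact ⟨i x, (hP x).2 hx, (oi x).symm⟩
      · exact ⟨j x, (hQ x).2 hx, (oj x).symm⟩
  · rw [Set.disjoint_left]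
    rintro _ ⟨_, ⟨x, hx, rfl⟩, rfl⟩ ⟨_, ⟨y, hy, rfl⟩, e⟩
    have : i x ∈ j '' MulAction.orbit Γ y := by
      rw [e]; exact ⟨x, MulAction.mem_orbit_self x, rfl⟩
    obtain ⟨y', -, h⟩ := this
    exact hd _ _ h.symm

theorem stabilizer_eq_of_injective {Γ Z X : Type*} [Group Γ] [MulAction Γ X] [MulAction Γ Z]
    (i : X → Z) (hi : ∀ (γ : Γ) x, i (γ • x) = γ • i x) (ii : Function.Injective i) (x : X) :
    MulAction.stabilizer Γ (i x) = MulAction.stabilizer Γ x := by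
  ext γ
  rw [MulAction.mem_stabilizer_iff, MulAction.mem_stabilizer_iff, ← hi, ii.eq_iff]

theorem numOrbitsOfType_sum (K : Subgroup G) (φ : K →* H) (X Y : Biset G H) :
    numOrbitsOfType K φ (sum X Y) = numOrbitsOfType K φ X + numOrbitsOfType K φ Y := by
  have := X.finite
  have := Y.finite
  have hi : ∀ (γ : H × G) (x : X.carrier),
    (Sum.inl (γ • x) : (sum X Y).carrier) = γ • (Sum.inl x : (sum X Y).carrier) :=
      fun _ _ => rfl
  have hj : ∀ (γ : H × G) (x : Y.carrier),
    (Sum.inr (γ • x) : (sum X Y).carrier) = γ • (Sum.inr x : (sum X Y).carrier) :=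
      fun _ _ => rfl
  refine ncard_orbits_sum (Γ := H × G) (Z := (sum X Y).carrier) (X := X.carrier)
    (Y := Y.carrier) Sum.inl Sum.inr hi hj Sum.inl_injective
    Sum.inr_injective (fun _ _ => Sum.inl_ne_inr) ?_ _ _ _ ?_ ?_
  · rintro (x | y)
    · exact Or.inl ⟨x, rfl⟩
    · exact Or.inr ⟨y, rfl⟩
  · intro x
    rw [stabilizer_eq_of_injective (Z := (sum X Y).carrier) _ hi Sum.inl_injective]
  · intro x
    rw [stabilizer_eq_of_injective (Z := (sum X Y).carrier) _ hj Sum.inr_injective]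

theorem numLeftOrbits_sum (X Y : Biset G H) :
    numLeftOrbits (sum X Y) = numLeftOrbits X + numLeftOrbits Y := by
  have := X.finite
  have := Y.finite
  have key : ∀ Z : Biset G H, numLeftOrbits Z =
      {O : Set Z.carrier | ∃ z, True ∧ O = MulAction.orbit H z}.ncard := by
    intro Z
    unfold numLeftOrbits
    congr 1
    ext O
    simp [eq_comm]
  rw [key, key, key]
  refine ncard_orbits_sum (Γ := H) (Z := (sum X Y).carrier) (X := X.carrier)
    (Y := Y.carrier) Sum.inl Sum.inr (fun _ _ => rfl) (fun _ _ => rfl) Sum.inl_injective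
    Sum.inr_injective (fun _ _ => Sum.inl_ne_inr) ?_ _ _ _ (fun _ => Iff.rfl) (fun _ => Iff.rfl)
  rintro (x | y)
  · exact Or.inl ⟨x, rfl⟩
  · exact Or.inr ⟨y, rfl⟩

theorem numFixed_sum (K : Subgroup G) (φ : K →* H) (X Y : Biset G H) :
    numFixed K φ (sum X Y) = numFixed K φ X + numFixed K φ Y := by
  have := X.finite
  have := Y.finite
  unfold numFixed
  have hX := Set.ncard_image_of_injective
    {x : X.carrier | ∀ k : K, X.ract x k = X.lact (φ k) x} (Sum.inl_injective (β := Y.carrier))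
  have hY := Set.ncard_image_of_injective
    {x : Y.carrier | ∀ k : K, Y.ract x k = Y.lact (φ k) x} (Sum.inr_injective (α := X.carrier))
  rw [← hX, ← hY, ← Set.ncard_union_eq _ (Set.toFinite _) (Set.toFinite _)]
  · congr 1
    ext z
    constructor
    · intro hz
      rcases z with x | y
      · exact Or.inl ⟨x, fun k => Sum.inl_injective (hz k), rfl⟩
      · exact Or.inr ⟨y, fun k => Sum.inr_injective (hz k), rfl⟩
    · rintro (⟨x, hx, rfl⟩ | ⟨y, hy, rfl⟩) k
      · exact congrArg Sum.inl (hx k)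
      · exact congrArg Sum.inr (hy k)
  · rw [Set.disjoint_left]
    rintro _ ⟨x, hx, rfl⟩ ⟨y, hy, e⟩
    cases e

theorem numOrbitsOfType_congr (K : Subgroup G) (φ : K →* H) {X Y : Biset G H} (e : Iso X Y) :
    numOrbitsOfType K φ X = numOrbitsOfType K φ Y := by
  have := X.finite
  have := (empty G H).finite
  have hi : ∀ (γ : H × G) (x : X.carrier), e.toEquiv (γ • x) = γ • e.toEquiv x := by
    intro γ x
    change e.toEquiv (X.ract (X.lact γ.1 x) γ.2⁻¹) = Y.ract (Y.lact γ.1 (e.toEquiv x)) γ.2⁻¹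
    rw [e.map_ract, e.map_lact]
  have h := ncard_orbits_sum (Γ := H × G) (Z := Y.carrier) (X := X.carrier)
    (Y := (empty G H).carrier) e.toEquiv PEmpty.elim hi (fun _ y => PEmpty.elim y)
    e.toEquiv.injective (fun y => PEmpty.elim y) (fun _ y => PEmpty.elim y)
    (fun z => Or.inl ⟨e.toEquiv.symm z, e.toEquiv.apply_symm_apply z⟩)
    (fun x => MulAction.stabilizer (H × G) x = graph K φ) (fun _ => False)
    (fun x => MulAction.stabilizer (H × G) x = graph K φ)
    (fun x => by rw [stabilizer_eq_of_injective _ hi e.toEquiv.injective])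
    (fun y => PEmpty.elim y)
  unfold numOrbitsOfType
  rw [h]
  simp

theorem numLeftOrbits_congr {X Y : Biset G H} (e : Iso X Y) :
    numLeftOrbits X = numLeftOrbits Y := by
  unfold numLeftOrbits
  rw [← Set.ncard_image_of_injective _ e.toEquiv.injective.image_injective, ← Set.range_comp,
    ← e.toEquiv.surjective.range_comp]
  congr 2
  ext x y
  constructor
  · rintro ⟨_, ⟨h, rfl⟩, rfl⟩
    exact ⟨h, (e.map_lact h x).symm⟩
  · rintro ⟨h, rfl⟩
    exact ⟨_, ⟨h, rfl⟩, e.map_lact h x⟩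

theorem numFixed_congr (K : Subgroup G) (φ : K →* H) {X Y : Biset G H} (e : Iso X Y) :
    numFixed K φ X = numFixed K φ Y := by
  unfold numFixed
  rw [← Set.ncard_image_of_injective _ e.toEquiv.injective]
  congr 1
  ext y
  constructor
  · rintro ⟨x, hx, rfl⟩ k
    rw [← e.map_ract, hx k, e.map_lact]
  · intro hy
    refine ⟨e.toEquiv.symm y, fun k => ?_, e.toEquiv.apply_symm_apply y⟩
    apply e.toEquiv.injective
    rw [e.map_ract, e.map_lact, e.toEquiv.apply_symm_apply, hy k]

/-! #### Homomorphisms as bisets -/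

/-- The set `H` with `H` acting by left multiplication and `G` acting from the right through
`φ : G → H`. -/
def twist [Finite H] (φ : G →* H) : Biset G H where
  carrier := H
  finite := inferInstance
  lact h x := h * x
  ract x g := x * φ g
  one_lact := one_mul
  mul_lact := mul_assoc
  ract_one x := by simp
  ract_mul x a b := by simp [mul_assoc]
  lact_ract h x g := mul_assoc _ _ _
  free h x e := by simpa using e

noncomputable def ofHomIsoTwist [Finite G] [Finite H] (φ : G →* H) : Iso (ofHom φ) (twist φ) :=
  Iso.ofBijective (X := ofHom φ) (Y := twist φ)
    (Quotient.lift (s := stdSetoid ⊤ (φ.comp (⊤ : Subgroup G).subtype))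
      (fun a : H × G => a.1 * φ a.2)
      (by
        rintro ⟨x, y⟩ ⟨x', y'⟩ ⟨k, h1, h2⟩
        change y = k * y' at h1
        change x' = x * φ k at h2
        subst h1 h2
        rw [map_mul, mul_assoc]))
    (by
      constructor
      · rintro ⟨x, y⟩ ⟨x', y'⟩ e
        change x * φ y = x' * φ y' at e
        refine Quotient.sound (s := stdSetoid ⊤ (φ.comp (⊤ : Subgroup G).subtype))
          ⟨⟨y * y'⁻¹, trivial⟩, ?_, ?_⟩
        · simp
        · simp [← mul_assoc, e]
      · intro (x : H)
        exact ⟨Quotient.mk (stdSetoid ⊤ (φ.comp (⊤ : Subgroup G).subtype)) (x, 1),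
          (congrArg (fun h : H => (x * h : H)) φ.map_one).trans (mul_one (x : H))⟩)
    (by
      rintro h ⟨x, y⟩
      exact mul_assoc h x (φ y))
    (by
      rintro ⟨x, y⟩ g
      change x * φ (y * g) = x * φ y * φ g
      rw [map_mul, mul_assoc])

noncomputable def twistComp {K : Type u} [Group K] [Finite H] [Finite K]
    (ψ : H →* K) (φ : G →* H) : Iso (comp (twist ψ) (twist φ)) (twist (ψ.comp φ)) :=
  Iso.ofBijective (X := comp (twist ψ) (twist φ)) (Y := twist (ψ.comp φ))
    (compLift (X := twist ψ) (Y := twist φ) (fun (x : K) (y : H) => (x * ψ y : K))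
      (fun (x : K) (h : H) (y : H) => by
        change x * ψ h * ψ y = x * ψ (h * y)
        rw [map_mul, mul_assoc]))
    (by
      constructor
      · refine comp_ind fun (x : K) (y : H) => comp_ind fun (x' : K) (y' : H) => ?_
        intro e
        change x * ψ y = x' * ψ y' at e
        refine compMk_eq.2 ⟨y' * y⁻¹, ?_, ?_⟩
        · change x = x' * ψ (y' * y⁻¹)
          rw [map_mul, ← mul_assoc, ← e, map_inv, mul_inv_cancel_right]
        · exact inv_mul_cancel_right y' y
      · intro (x : K)
        refine ⟨compMk (twist ψ) (twist φ) x (1 : H), ?_⟩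
        change x * ψ 1 = x
        simp)
    (by
      intro k w
      revert w
      exact comp_ind fun (x : K) (y : H) => mul_assoc k x (ψ y))
    (by
      intro w g
      revert w
      refine comp_ind fun (x : K) (y : H) => ?_
      change (x * ψ (y * φ g) : K) = x * ψ y * ψ (φ g)
      rw [map_mul, mul_assoc])

/-- `[H, ψ] ∘ [G, φ] = [G, ψ ∘ φ]`. -/
noncomputable def ofHomComp {K : Type u} [Group K] [Finite G] [Finite H] [Finite K]
    (ψ : H →* K) (φ : G →* H) : Iso (comp (ofHom ψ) (ofHom φ)) (ofHom (ψ.comp φ)) :=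
  (compCongr (ofHomIsoTwist ψ) (ofHomIsoTwist φ)).trans
    ((twistComp ψ φ).trans (ofHomIsoTwist _).symm)

/-- `[G, c_h ∘ φ] = [G, φ]`. -/
noncomputable def ofHomConj [Finite G] [Finite H] (φ ψ : G →* H) (h : H)
    (e : ∀ g, φ g = h * ψ g * h⁻¹) : Iso (ofHom φ) (ofHom ψ) :=
  (ofHomIsoTwist φ).trans <| Iso.trans
    (Iso.ofBijective (X := twist φ) (Y := twist ψ) (fun x : H => (x * h : H))
      (Equiv.mulRight h).bijective (fun (k x : H) => mul_assoc k x h)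
      (fun (x : H) g => by
        change x * φ g * h = x * h * ψ g
        rw [e]
        group))
    (ofHomIsoTwist ψ).symm

end
end Biset

/-! ### The `p`-localized double Burnside module -/

section Burnside

/-- Isomorphism classes of finite left-free `(G,H)`-bisets. -/
def BisetClass (G H : Type u) [Group G] [Group H] : Type (u + 1) :=
  Quotient (Biset.isoSetoid G H)

/-- The isomorphism class of a biset. -/
def BisetClass.mk {G H : Type u} [Group G] [Group H] (X : Biset G H) : BisetClass G H :=
  Quotient.mk _ X

/-- Isomorphism classes form a commutative monoid under disjoint union. -/
instance (G H : Type u) [Group G] [Group H] : AddCommMonoid (BisetClass G H) where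
  add := Quotient.map₂ (sa := Biset.isoSetoid G H) (sb := Biset.isoSetoid G H)
    (sc := Biset.isoSetoid G H) Biset.sum
    (fun _ _ ⟨e⟩ _ _ ⟨f⟩ => ⟨Biset.sumCongr e f⟩)
  zero := BisetClass.mk (Biset.empty G H)
  add_assoc := by
    rintro ⟨X⟩ ⟨Y⟩ ⟨Z⟩
    exact Quotient.sound ⟨Biset.sumAssoc X Y Z⟩
  zero_add := by
    rintro ⟨X⟩
    exact Quotient.sound ⟨Biset.emptySum X⟩
  add_zero := by
    rintro ⟨X⟩
    exact Quotient.sound ⟨(Biset.sumComm _ _).trans (Biset.emptySum X)⟩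
  add_comm := by
    rintro ⟨X⟩ ⟨Y⟩
    exact Quotient.sound ⟨Biset.sumComm X Y⟩
  nsmul := @nsmulRec _ ⟨BisetClass.mk (Biset.empty G H)⟩
    ⟨Quotient.map₂ (sa := Biset.isoSetoid G H) (sb := Biset.isoSetoid G H)
      (sc := Biset.isoSetoid G H) Biset.sum
      (fun _ _ ⟨e⟩ _ _ ⟨f⟩ => ⟨Biset.sumCongr e f⟩)⟩

theorem BisetClass.mk_sum {G H : Type u} [Group G] [Group H] (X Y : Biset G H) :
    BisetClass.mk (X.sum Y) = BisetClass.mk X + BisetClass.mk Y := rfl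

/-- The Burnside module `A(G,H)`: the Grothendieck group of isomorphism classes of finite
left-free `(G,H)`-bisets. -/
abbrev BurnsideModule (G H : Type u) [Group G] [Group H] : Type (u + 1) :=
  Algebra.GrothendieckAddGroup (BisetClass G H)

variable (p : ℕ) [hp : Fact p.Prime]

instance isPrime_span : (Ideal.span {(p : ℤ)}).IsPrime :=
  (Ideal.span_singleton_prime (by exact_mod_cast hp.out.ne_zero)).2
    (Nat.prime_iff_prime_int.1 hp.out)

/-- The ring `ℤ_(p)` of integers localized at the prime `p`. -/
def ZLoc : Type := Localization.AtPrime (Ideal.span {(p : ℤ)})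

noncomputable instance instCommRingZLoc : CommRing (ZLoc p) :=
  inferInstanceAs (CommRing (Localization.AtPrime (Ideal.span {(p : ℤ)})))

/-- `ZLoc p` is the localization of `ℤ` at `(p)`, also for the canonical `ℤ`-algebra structure
of a ring. -/
instance isLocalization_ZLoc : IsLocalization.AtPrime (ZLoc p) (Ideal.span {(p : ℤ)}) := by
  have key : ∀ a b : Algebra ℤ (ZLoc p),
      @IsLocalization.AtPrime ℤ _ (ZLoc p) _ a (Ideal.span {(p : ℤ)}) _ →
      @IsLocalization.AtPrime ℤ _ (ZLoc p) _ b (Ideal.span {(p : ℤ)}) _ := by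
    intro a b h
    rwa [Subsingleton.elim b a]
  exact key (inferInstanceAs (Algebra ℤ (Localization.AtPrime (Ideal.span {(p : ℤ)})))) _
    (inferInstanceAs (IsLocalization.AtPrime (Localization.AtPrime (Ideal.span {(p : ℤ)})) _))

/-- The `p`-localization `A(G,H)_(p) = ℤ_(p) ⊗ A(G,H)` of the Burnside module. -/
abbrev BurnsideLoc (G H : Type u) [Group G] [Group H] : Type (u + 1) :=
  ZLoc p ⊗[ℤ] BurnsideModule G H

namespace BurnsideLoc

section
variable {G H : Type u} [Group G] [Group H]

/-- The class `[X]` of a biset in `A(G,H)_(p)`. -/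
noncomputable def cl (X : Biset G H) : BurnsideLoc p G H :=
  1 ⊗ₜ Algebra.GrothendieckAddGroup.of (BisetClass.mk X)

variable {p}

theorem cl_congr {X Y : Biset G H} (e : Biset.Iso X Y) : cl p X = cl p Y := by
  unfold cl
  rw [show BisetClass.mk X = BisetClass.mk Y from Quotient.sound ⟨e⟩]

theorem cl_sum (X Y : Biset G H) : cl p (X.sum Y) = cl p X + cl p Y := by
  unfold cl
  rw [BisetClass.mk_sum, map_add, TensorProduct.tmul_add]

/-- An additive isomorphism invariant of bisets extends linearly to `A(G,H)_(p)`. -/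
noncomputable def lift {Q : Type*} [AddCommGroup Q] [Module (ZLoc p) Q] (f : Biset G H → Q)
    (hc : ∀ X Y : Biset G H, Biset.Iso X Y → f X = f Y)
    (hs : ∀ X Y : Biset G H, f (X.sum Y) = f X + f Y) :
    BurnsideLoc p G H →ₗ[ZLoc p] Q :=
  LinearMap.liftBaseChange (ZLoc p) <| AddMonoidHom.toIntLinearMap <|
    Algebra.GrothendieckAddGroup.lift (M := BisetClass G H)
      { toFun := Quotient.lift (s := Biset.isoSetoid G H) f fun _ _ ⟨e⟩ => hc _ _ e
        map_zero' := by
          have h := hs (Biset.empty G H) (Biset.empty G H)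
          rw [hc _ _ (Biset.emptySum _)] at h
          exact left_eq_add.1 h
        map_add' := by
          rintro ⟨X⟩ ⟨Y⟩
          exact hs X Y }

theorem lift_cl {Q : Type*} [AddCommGroup Q] [Module (ZLoc p) Q] (f : Biset G H → Q)
    (hc : ∀ X Y : Biset G H, Biset.Iso X Y → f X = f Y)
    (hs : ∀ X Y : Biset G H, f (X.sum Y) = f X + f Y) (X : Biset G H) :
    lift (p := p) f hc hs (cl p X) = f X := by
  unfold lift cl
  rw [LinearMap.liftBaseChange_tmul, one_smul]
  exact DFunLike.congr_fun (Algebra.GrothendieckAddGroup.lift.symm_apply_apply _)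
    (BisetClass.mk X)

/-- `A(G,H)_(p)` is spanned by the classes of bisets. -/
theorem ext {Q : Type*} [AddCommGroup Q] [Module (ZLoc p) Q]
    {f g : BurnsideLoc p G H →ₗ[ZLoc p] Q} (h : ∀ X, f (cl p X) = g (cl p X)) : f = g := by
  refine TensorProduct.AlgebraTensorModule.curry_injective ?_
  ext a
  revert a
  refine DFunLike.congr_fun (f := ((TensorProduct.AlgebraTensorModule.curry f) 1).toAddMonoidHom)
    (g := ((TensorProduct.AlgebraTensorModule.curry g) 1).toAddMonoidHom) ?_
  refine Algebra.GrothendieckAddGroup.lift.symm.injective ?_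
  ext X
  obtain ⟨X⟩ := X
  exact h X

/-- The composition pairing `A(H,K)_(p) × A(G,H)_(p) → A(G,K)_(p)`, the bilinear extension of
`[X] ∘ [Y] = [X ×_H Y]`. -/
noncomputable def comp {K : Type u} [Group K] :
    BurnsideLoc p H K →ₗ[ZLoc p] BurnsideLoc p G H →ₗ[ZLoc p] BurnsideLoc p G K :=
  lift (fun X => lift (fun Y => cl p (X.comp Y))
      (fun _ _ e => cl_congr (Biset.compCongr (Biset.Iso.refl X) e))
      (fun Y Y' => by rw [← cl_congr (Biset.compSum X Y Y'), cl_sum]))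
    (fun _ _ e => ext fun Y => by
      rw [lift_cl, lift_cl]
      exact cl_congr (Biset.compCongr e (Biset.Iso.refl Y)))
    (fun X X' => ext fun Y => by
      rw [LinearMap.add_apply, lift_cl, lift_cl, lift_cl, ← cl_sum]
      exact (cl_congr (Biset.sumComp X X' Y)).symm)

theorem comp_cl {K : Type u} [Group K] (X : Biset H K) (Y : Biset G H) :
    comp (cl p X) (cl p Y) = cl p (X.comp Y) := by
  rw [comp, lift_cl, lift_cl]

/-- The cartesian product pairing
`A(G,H)_(p) × A(G',H')_(p) → A(G × G', H × H')_(p)`, the bilinear extension of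
`([X], [Y]) ↦ [X × Y]`. -/
noncomputable def prod {G' H' : Type u} [Group G'] [Group H'] :
    BurnsideLoc p G H →ₗ[ZLoc p] BurnsideLoc p G' H' →ₗ[ZLoc p]
      BurnsideLoc p (G × G') (H × H') :=
  lift (fun X => lift (fun Y => cl p (X.prod Y))
      (fun _ _ e => cl_congr (Biset.prodCongr (Biset.Iso.refl X) e))
      (fun Y Y' => by rw [cl_congr (Biset.prodSum X Y Y'), cl_sum]))
    (fun _ _ e => ext fun Y => by
      rw [lift_cl, lift_cl]
      exact cl_congr (Biset.prodCongr e (Biset.Iso.refl Y)))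
    (fun X X' => ext fun Y => by
      rw [LinearMap.add_apply, lift_cl, lift_cl, lift_cl, ← cl_sum]
      exact cl_congr (Biset.sumProd X X' Y))

theorem prod_cl {G' H' : Type u} [Group G'] [Group H'] (X : Biset G H) (Y : Biset G' H') :
    prod (cl p X) (cl p Y) = cl p (X.prod Y) := by
  rw [prod, lift_cl, lift_cl]

/-- The basis element `[K, φ]` of `A(G,H)_(p)`. -/
noncomputable def basisElt (p : ℕ) [Fact p.Prime] [Finite G] [Finite H] (K : Subgroup G)
    (φ : K →* H) : BurnsideLoc p G H :=
  cl p (Biset.std K φ)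

/-- The element `[G, φ]` of `A(G,H)_(p)`, for a homomorphism `φ : G → H`. -/
noncomputable def ofHom (p : ℕ) [Fact p.Prime] [Finite G] [Finite H] (φ : G →* H) :
    BurnsideLoc p G H :=
  basisElt p ⊤ (φ.comp (⊤ : Subgroup G).subtype)

theorem comp_ofHom {K : Type u} [Group K] [Finite G] [Finite H] [Finite K]
    (ψ : H →* K) (φ : G →* H) : comp (ofHom p ψ) (ofHom p φ) = ofHom p (ψ.comp φ) :=
  (comp_cl _ _).trans (cl_congr (Biset.ofHomComp ψ φ))

theorem comp_comp_ofHom {K L : Type u} [Group K] [Group L] [Finite G] [Finite H] [Finite K]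
    (X : BurnsideLoc p K L) (ψ : H →* K) (φ : G →* H) :
    comp (comp X (ofHom p ψ)) (ofHom p φ) = comp X (ofHom p (ψ.comp φ)) := by
  rw [← comp_ofHom]
  have : (comp (K := L).flip (ofHom p φ)) ∘ₗ (comp (K := L).flip (ofHom p ψ)) =
      comp.flip (comp (ofHom p ψ) (ofHom p φ)) := by
    refine ext fun X => ?_
    simp only [LinearMap.comp_apply, LinearMap.flip_apply, ofHom, basisElt, comp_cl]
    exact cl_congr (Biset.compAssoc _ _ _)
  exact LinearMap.congr_fun this X

/-- The augmentation `ε : A(G,H)_(p) → ℤ_(p)`, `[X] ↦ |H \ X|`. -/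
noncomputable def augmentation : BurnsideLoc p G H →ₗ[ZLoc p] ZLoc p :=
  lift (fun X => (X.numLeftOrbits : ZLoc p))
    (fun _ _ e => by rw [Biset.numLeftOrbits_congr e])
    (fun X Y => by rw [Biset.numLeftOrbits_sum, Nat.cast_add])

/-- The fixed-point homomorphism `Φ_{⟨K,φ⟩} : A(G,H)_(p) → ℤ_(p)`, `[X] ↦ |X^{(K,φ)}|`. -/
noncomputable def fixedPoints (K : Subgroup G) (φ : K →* H) :
    BurnsideLoc p G H →ₗ[ZLoc p] ZLoc p :=
  lift (fun X => (X.numFixed K φ : ZLoc p))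
    (fun _ _ e => by rw [Biset.numFixed_congr K φ e])
    (fun X Y => by rw [Biset.numFixed_sum, Nat.cast_add])

/-- The coefficient homomorphism `c_{⟨K,φ⟩} : A(G,H)_(p) → ℤ_(p)`, giving the coefficient at
`[K, φ]` in the standard basis.  On the class of a biset `X` this is the number of orbits of `X`
which are isomorphic to the basis element `[K, φ]`, since `X` is the disjoint union of its
orbits. -/
noncomputable def coeff (K : Subgroup G) (φ : K →* H) : BurnsideLoc p G H →ₗ[ZLoc p] ZLoc p :=
  lift (fun X => (X.numOrbitsOfType K φ : ZLoc p))
    (fun _ _ e => by rw [Biset.numOrbitsOfType_congr K φ e])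
    (fun X Y => by rw [Biset.numOrbitsOfType_sum, Nat.cast_add])

variable (p G H) in
/-- The free Burnside module `A_fr(G,H)_(p)`, generated by the classes of bifree bisets. -/
noncomputable def free : Submodule (ZLoc p) (BurnsideLoc p G H) :=
  Submodule.span (ZLoc p) {x | ∃ X : Biset G H, X.IsBifree ∧ x = cl p X}

end

section
variable {p} {S : Type u} [Group S] [Finite S]

/-- Frobenius reciprocity: `(X × X) ∘ [S, Δ] = (X × 1) ∘ [S, Δ] ∘ X` in `A(S, S × S)_(p)`, where
`Δ : S → S × S` is the diagonal and `1 = [S, id]`. -/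
def FrobeniusReciprocity (X : BurnsideLoc p S S) : Prop :=
  comp (prod X X) (ofHom p ((MonoidHom.id S).prod (MonoidHom.id S))) =
    comp (prod X (ofHom p (MonoidHom.id S)))
      (comp (ofHom p ((MonoidHom.id S).prod (MonoidHom.id S))) X)

end

end BurnsideLoc
end Burnside

/-! ### Fusion systems -/

/-- A pre-fusion system on `S`: sets `Hom(P,Q)` of injective homomorphisms for `P, Q ≤ S`, such
that for `φ ∈ Hom(P,Q)` and `φ(P) ≤ R` the homomorphism `φ`, regarded as a map `P → R`, is in
`Hom(P,R)`. -/
@[ext]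
structure PreFusionSystem (S : Type u) [Group S] where
  Hom : ∀ P Q : Subgroup S, Set (P →* Q)
  injective : ∀ {P Q : Subgroup S} {φ : P →* Q}, φ ∈ Hom P Q → Function.Injective φ
  codRestrict : ∀ {P Q R : Subgroup S} {φ : P →* Q}, φ ∈ Hom P Q →
    ∀ h : ∀ x, (Q.subtype.comp φ) x ∈ R, (Q.subtype.comp φ).codRestrict R h ∈ Hom P R

/-- A fusion system on `S`: a pre-fusion system which contains the homomorphisms induced by
conjugation in `S`, and is closed under composition and under inverses of isomorphisms. -/
@[ext]
structure FusionSystem (S : Type u) [Group S] extends PreFusionSystem S where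
  conj_mem : ∀ {P Q : Subgroup S} (φ : P →* Q) (g : S),
    (∀ x : P, (φ x : S) = g * x * g⁻¹) → φ ∈ Hom P Q
  symm_mem : ∀ {P Q : Subgroup S} (e : P ≃* Q), e.toMonoidHom ∈ Hom P Q →
    e.symm.toMonoidHom ∈ Hom Q P
  comp_mem : ∀ {P Q R : Subgroup S} {φ : P →* Q} {ψ : Q →* R}, φ ∈ Hom P Q → ψ ∈ Hom Q R →
    ψ.comp φ ∈ Hom P R

namespace PreFusionSystem

variable {S : Type u} [Group S]

theorem injective_codRestrict {P Q R : Subgroup S} {φ : P →* Q} (hi : Function.Injective φ)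
    (h : ∀ x, (Q.subtype.comp φ) x ∈ R) :
    Function.Injective ((Q.subtype.comp φ).codRestrict R h) := by
  intro x y e
  refine hi (Subtype.ext ?_)
  exact congrArg (fun z : R => (z : S)) e

/-- Inclusion of pre-fusion systems. -/
instance : LE (PreFusionSystem S) := ⟨fun F F' => ∀ P Q, F.Hom P Q ⊆ F'.Hom P Q⟩

/-- The closure of a pre-fusion system: the smallest fusion system containing it, i.e. the
intersection of all fusion systems containing it.  (The largest fusion system on `S`, consisting
of all injective homomorphisms, is always one of them; this is why injectivity may be imposed
separately.) -/
def closure (F : PreFusionSystem S) : FusionSystem S where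
  Hom P Q := {φ | Function.Injective φ ∧
    ∀ E : FusionSystem S, F ≤ E.toPreFusionSystem → φ ∈ E.Hom P Q}
  injective h := h.1
  codRestrict := by
    rintro P Q R φ ⟨hi, h⟩ hR
    exact ⟨injective_codRestrict hi hR, fun E hE => E.codRestrict (h E hE) hR⟩
  conj_mem := by
    intro P Q φ g h
    refine ⟨fun x y e => ?_, fun E _ => E.conj_mem φ g h⟩
    have := h x
    rw [e, h y] at this
    exact Subtype.ext (by simpa using this.symm)
  symm_mem := by
    rintro P Q e ⟨_, h⟩
    exact ⟨e.symm.injective, fun E hE => E.symm_mem e (h E hE)⟩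
  comp_mem := by
    rintro P Q R φ ψ ⟨i, h⟩ ⟨j, k⟩
    exact ⟨j.comp i, fun E hE => E.comp_mem (h E hE) (k E hE)⟩

theorem le_closure (F : PreFusionSystem S) : F ≤ F.closure.toPreFusionSystem :=
  fun _ _ _ h => ⟨F.injective h, fun _ hE => hE _ _ h⟩

theorem closure_le (F : PreFusionSystem S) (E : FusionSystem S) (h : F ≤ E.toPreFusionSystem) :
    F.closure.toPreFusionSystem ≤ E.toPreFusionSystem :=
  fun _ _ _ hφ => hφ.2 E h

end PreFusionSystem

namespace FusionSystem

variable {S : Type u} [Group S] (F : FusionSystem S)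

/-- `P` and `Q` are `F`-conjugate. -/
def IsConj (P Q : Subgroup S) : Prop := ∃ e : P ≃* Q, e.toMonoidHom ∈ F.Hom P Q

/-- `P` is fully `F`-centralized. -/
def FullyCentralized (P : Subgroup S) : Prop :=
  ∀ Q, F.IsConj P Q →
    Nat.card (Subgroup.centralizer (Q : Set S)) ≤ Nat.card (Subgroup.centralizer (P : Set S))

/-- `P` is fully `F`-normalized. -/
def FullyNormalized (P : Subgroup S) : Prop :=
  ∀ Q, F.IsConj P Q →
    Nat.card (Subgroup.normalizer (Q : Set S)) ≤ Nat.card (Subgroup.normalizer (P : Set S))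

/-- The automorphism group `Aut_F(P)`. -/
def aut (P : Subgroup S) : Subgroup (MulAut P) where
  carrier := {e | e.toMonoidHom ∈ F.Hom P P}
  one_mem' := F.conj_mem _ 1 (fun x => by simp)
  mul_mem' {a b} ha hb := F.comp_mem (φ := b.toMonoidHom) (ψ := a.toMonoidHom) hb ha
  inv_mem' {a} ha := F.symm_mem a ha

/-- The group `Aut_S(P)` of automorphisms of `P` induced by conjugation by elements of
`N_S(P)`. -/
def autInner (P : Subgroup S) : Subgroup (MulAut P) :=
  P.normalizerMonoidHom.range

/-- The subgroup `N_φ = {x ∈ N_S(P) | ∃ y ∈ N_S(φ(P)), ∀ u ∈ P, φ(x u x⁻¹) = y φ(u) y⁻¹}`. -/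
def extender {P : Subgroup S} (φ : P →* S) : Subgroup S where
  carrier := {x | x ∈ Subgroup.normalizer (P : Set S) ∧
    ∃ y ∈ Subgroup.normalizer (φ.range : Set S),
      ∀ u v : P, (v : S) = x * u * x⁻¹ → φ v = y * φ u * y⁻¹}
  one_mem' := ⟨one_mem _, 1, one_mem _, fun u v h => by
    have : v = u := Subtype.ext (by simpa using h)
    simp [this]⟩
  mul_mem' := by
    rintro x x' ⟨hx, y, hy, h⟩ ⟨hx', y', hy', h'⟩
    refine ⟨mul_mem hx hx', y * y', mul_mem hy hy', fun u v e => ?_⟩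
    have hw := (Subgroup.mem_normalizer_iff.1 hx' u).1 u.2
    rw [h ⟨_, hw⟩ v (by rw [e]; group), h' u ⟨_, hw⟩ rfl]
    group
  inv_mem' := by
    rintro x ⟨hx, y, hy, h⟩
    refine ⟨inv_mem hx, y⁻¹, inv_mem hy, fun u v e => ?_⟩
    rw [h v u (by rw [e]; group)]
    group

/-- Saturation of a fusion system (at the prime `p`), in the form of Broto, Levi and Oliver. -/
structure IsSaturated (p : ℕ) (F : FusionSystem S) : Prop where
  /-- If `P` is fully normalized, then `P` is fully centralized and `Aut_S(P)` is a Sylow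
  `p`-subgroup of `Aut_F(P)`. -/
  sylow : ∀ P : Subgroup S, F.FullyNormalized P →
    F.FullyCentralized P ∧
      ∃ T : Sylow p (F.aut P), (T : Subgroup (F.aut P)).map (F.aut P).subtype = autInner P
  /-- If `φ(P)` is fully centralized, then `φ` extends to a morphism `N_φ → S` of `F`. -/
  extension : ∀ (P : Subgroup S) (φ : P →* (⊤ : Subgroup S)), φ ∈ F.Hom P ⊤ →
    F.FullyCentralized ((⊤ : Subgroup S).subtype.comp φ).range →
      ∃ ψ ∈ F.Hom (extender ((⊤ : Subgroup S).subtype.comp φ)) ⊤,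
        ∀ (u : P) (v : extender ((⊤ : Subgroup S).subtype.comp φ)), (v : S) = u → ψ v = φ u

end FusionSystem

/-! ### Characteristic elements and the fusion systems induced by an element -/

section Characteristic

open BurnsideLoc

variable {S : Type u} [Group S] [Finite S] {p : ℕ} [Fact p.Prime]

/-- `X` is `F`-generated: it lies in the submodule generated by the `[T, φ]` with `φ` in `F`. -/
def IsGenerated (F : FusionSystem S) (X : BurnsideLoc p S S) : Prop :=
  X ∈ Submodule.span (ZLoc p) {x | ∃ (T : Subgroup S) (φ : T →* (⊤ : Subgroup S)),
    φ ∈ F.Hom T ⊤ ∧ x = basisElt p T ((⊤ : Subgroup S).subtype.comp φ)}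

/-- `X` is right `F`-stable: `X ∘ [P,φ]_P^S = X ∘ [P,incl]_P^S` in `A(P,S)_(p)` for all `P ≤ S`
and all `φ ∈ Hom_F(P,S)`. -/
def IsRightStable (F : FusionSystem S) (X : BurnsideLoc p S S) : Prop :=
  ∀ (P : Subgroup S) (φ : P →* (⊤ : Subgroup S)), φ ∈ F.Hom P ⊤ →
    comp X (ofHom p ((⊤ : Subgroup S).subtype.comp φ)) = comp X (ofHom p P.subtype)

/-- `X` is a right characteristic element for `F`. -/
structure IsRightCharacteristic (F : FusionSystem S) (X : BurnsideLoc p S S) : Prop where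
  generated : IsGenerated F X
  stable : IsRightStable F X
  augmentation : ¬ (p : ZLoc p) ∣ augmentation X

/-- The orbit-type pre-fusion system of `X`. -/
def preOrb (X : BurnsideLoc p S S) : PreFusionSystem S where
  Hom P Q := {φ | Function.Injective φ ∧ coeff P (Q.subtype.comp φ) X ≠ 0}
  injective h := h.1
  codRestrict := by
    rintro P Q R φ ⟨hi, h⟩ hR
    exact ⟨PreFusionSystem.injective_codRestrict hi hR, h⟩

/-- The fixed-point pre-fusion system of `X`. -/
def preFix (X : BurnsideLoc p S S) : PreFusionSystem S where
  Hom P Q := {φ | Function.Injective φ ∧ fixedPoints P (Q.subtype.comp φ) X ≠ 0}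
  injective h := h.1
  codRestrict := by
    rintro P Q R φ ⟨hi, h⟩ hR
    exact ⟨PreFusionSystem.injective_codRestrict hi hR, h⟩

/-- The orbit-type fusion system of `X`. -/
def orbFusion (X : BurnsideLoc p S S) : FusionSystem S := (preOrb X).closure

/-- The fixed-point fusion system of `X`. -/
def fixFusion (X : BurnsideLoc p S S) : FusionSystem S := (preFix X).closure

/-- The right stabilizer fusion system of `X`. -/
def rStab (X : BurnsideLoc p S S) : FusionSystem S where
  Hom P Q := {φ | Function.Injective φ ∧
    comp X (ofHom p (Q.subtype.comp φ)) = comp X (ofHom p P.subtype)}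
  injective h := h.1
  codRestrict := by
    rintro P Q R φ ⟨hi, h⟩ hR
    exact ⟨PreFusionSystem.injective_codRestrict hi hR, h⟩
  conj_mem := by
    intro P Q φ g h
    constructor
    · intro x y e
      have := h x
      rw [e, h y] at this
      exact Subtype.ext (by simpa using this.symm)
    · congr 1
      exact cl_congr (Biset.ofHomConj _ _ g h)
  symm_mem := by
    rintro P Q e ⟨_, h⟩
    refine ⟨e.symm.injective, ?_⟩
    have h' := congrArg (fun Y => comp Y (ofHom p e.symm.toMonoidHom)) h
    simp only [comp_comp_ofHom] at h'
    rw [← h']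
    congr 2
    ext x
    simp
  comp_mem := by
    rintro P Q R φ ψ ⟨i, h⟩ ⟨j, k⟩
    refine ⟨j.comp i, ?_⟩
    rw [← h, ← comp_comp_ofHom X Q.subtype φ, ← k, comp_comp_ofHom]
    rfl

end Characteristic

end BurnsideFusion

open BurnsideFusion

/-!
The proof works with the numbers `Φ(φ, ψ)` of elements `x` of a biset with `x ψ(k) = φ(k) x` for all
`k ∈ K`, where `φ, ψ : K → S` are arbitrary homomorphisms (`BurnsideLoc.marks`).  For `ψ` an
inclusion these are the fixed-point numbers `Φ_⟨K,φ⟩`, which determine an element of the Burnside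
module since the table of marks is triangular (`BurnsideLoc.eq_of_fixedPoints_eq`).  As
`(X × 1) ∘ [S, Δ] ∘ X` is the biset `X × X` with actions `(a, b) (x, y) k = (a x b⁻¹, b y k)`,
Frobenius reciprocity becomes the identity `Φ(φ, ψ) Φ(φ', ψ) = Φ(φ, φ') Φ(φ', ψ)`, and right
stability under `θ` becomes `Φ(φ, θ ψ) = Φ(φ, ψ)`.  So a right characteristic element satisfies
Frobenius reciprocity: if `Φ(φ', ψ) ≠ 0`, then `φ'` and `ψ` differ by a morphism of the fusion
system (`BurnsideLoc.frobeniusReciprocity_of_isRightCharacteristic`).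

Conversely, let `X` satisfy Frobenius reciprocity, and call `φ` and `ψ` related if `Φ(φ, ψ) ≠ 0`.
Counting the points of `X` whose orbit under a suitable `p`-group is as small as possible gives
congruences in `ℤ_(p)` (`BurnsideLoc.dvd_marks_sub_sum_extensions`,
`BurnsideLoc.dvd_augmentation_sub_sum_right`).  Since `ε(X)` is a unit they imply `Φ(φ, φ) ≠ 0`, so
being related is an equivalence relation and `Φ(φ, ψ) = Φ(φ, φ)` for related `φ` and `ψ`.  They also
provide in each class a `χ` such that `Φ(χ, χ) / |C_S(χ(K))|` is a unit and `Aut_S(χ(K))` has index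
prime to `p` in the automorphism group of the class (`BurnsideLoc.IsReciprocal.exists_optimal`).  By the Sylow
argument for automorphisms and the congruences for extensions, related homomorphisms have related
restrictions (`BurnsideLoc.IsReciprocal.related_comp`); for virtual bisets this is not automatic.  Hence the
homomorphisms related to an inclusion are exactly the morphisms of `RStab(X)`, that is
`PreFix(X) = RStab(X)`, and triangularity of the table of marks yields `Orb(X) = RStab(X)`.
Finally, the optimal `χ` are fully normalized and fully centralized, which gives the Sylow axiom, and
the congruence for the extensions of `φ` to `N_φ` gives the extension axiom.
-/

namespace BurnsideFusion

/-! ### The ring `ℤ_(p)` -/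

namespace ZLoc
variable (p : ℕ) [Fact p.Prime]

instance isDomain : IsDomain (ZLoc p) :=
  IsLocalization.isDomain_of_le_nonZeroDivisors (M := (Ideal.span {(p : ℤ)}).primeCompl) (R := ℤ)
    (ZLoc p) (Ideal.primeCompl_le_nonZeroDivisors _)

instance isLocalRing : IsLocalRing (ZLoc p) :=
  IsLocalization.AtPrime.isLocalRing (ZLoc p) (Ideal.span {(p : ℤ)})

instance charZero : CharZero (ZLoc p) :=
  charZero_of_injective_algebraMap (R := ℤ)
    (IsLocalization.injective (ZLoc p) (Ideal.primeCompl_le_nonZeroDivisors (Ideal.span {(p : ℤ)})))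

theorem maximalIdeal_eq : IsLocalRing.maximalIdeal (ZLoc p) = Ideal.span {(p : ZLoc p)} := by
  rw [← IsLocalization.AtPrime.map_eq_maximalIdeal (Ideal.span {(p : ℤ)}) (ZLoc p),
    Ideal.map_span, Set.image_singleton]
  simp

variable {p}

theorem isUnit_iff {x : ZLoc p} : IsUnit x ↔ ¬ (p : ZLoc p) ∣ x := by
  rw [← Ideal.mem_span_singleton, ← maximalIdeal_eq, IsLocalRing.mem_maximalIdeal, mem_nonunits_iff,
    not_not]

end ZLoc

/-! ### Marks of bisets and their behaviour under products and composition -/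

namespace Biset
variable {G H K : Type u} [Group G] [Group H] [Group K]

/-- The number of elements `x` of a biset which intertwine two homomorphisms `φ : K → H` and
`ψ : K → G`, i.e. satisfy `x ψ(k) = φ(k) x` for all `k ∈ K`. -/
noncomputable def numIntertwined (φ : K →* H) (ψ : K →* G) (X : Biset G H) : ℕ :=
  {x : X.carrier | ∀ k, X.ract x (ψ k) = X.lact (φ k) x}.ncard

theorem numIntertwined_sum (φ : K →* H) (ψ : K →* G) (X Y : Biset G H) :
    numIntertwined φ ψ (sum X Y) = numIntertwined φ ψ X + numIntertwined φ ψ Y := by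
  have := X.finite
  have := Y.finite
  unfold numIntertwined
  have hX := Set.ncard_image_of_injective
    {x : X.carrier | ∀ k, X.ract x (ψ k) = X.lact (φ k) x} (Sum.inl_injective (β := Y.carrier))
  have hY := Set.ncard_image_of_injective
    {x : Y.carrier | ∀ k, Y.ract x (ψ k) = Y.lact (φ k) x} (Sum.inr_injective (α := X.carrier))
  rw [← hX, ← hY, ← Set.ncard_union_eq _ (Set.toFinite _) (Set.toFinite _)]
  · congr 1
    ext z
    constructor
    · intro hz
      rcases z with x | y
      · exact Or.inl ⟨x, fun k => Sum.inl_injective (hz k), rfl⟩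
      · exact Or.inr ⟨y, fun k => Sum.inr_injective (hz k), rfl⟩
    · rintro (⟨x, hx, rfl⟩ | ⟨y, hy, rfl⟩) k
      · exact congrArg Sum.inl (hx k)
      · exact congrArg Sum.inr (hy k)
  · rw [Set.disjoint_left]
    rintro _ ⟨x, hx, rfl⟩ ⟨y, hy, e⟩
    cases e

theorem numIntertwined_congr (φ : K →* H) (ψ : K →* G) {X Y : Biset G H} (e : Iso X Y) :
    numIntertwined φ ψ X = numIntertwined φ ψ Y := by
  unfold numIntertwined
  rw [← Set.ncard_image_of_injective _ e.toEquiv.injective]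
  congr 1
  ext y
  constructor
  · rintro ⟨x, hx, rfl⟩ k
    rw [← e.map_ract, hx k, e.map_lact]
  · intro hy
    refine ⟨e.toEquiv.symm y, fun k => ?_, e.toEquiv.apply_symm_apply y⟩
    apply e.toEquiv.injective
    rw [e.map_ract, e.map_lact, e.toEquiv.apply_symm_apply, hy k]

/-- Restriction of the right action of a biset along a homomorphism. -/
def restrict (X : Biset G H) (θ : K →* G) : Biset K H where
  carrier := X.carrier
  finite := X.finite
  lact := X.lact
  ract x k := X.ract x (θ k)
  one_lact := X.one_lact
  mul_lact := X.mul_lact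
  ract_one x := by rw [map_one, X.ract_one]
  ract_mul x a b := by rw [map_mul, X.ract_mul]
  lact_ract h x k := X.lact_ract h x _
  free := X.free

/-- Restriction along a homomorphism respects isomorphisms. -/
def restrictCongr {X Y : Biset G H} (e : Iso X Y) (θ : K →* G) :
    Iso (restrict X θ) (restrict Y θ) :=
  ⟨e.toEquiv, e.map_lact, fun x k => e.map_ract x (θ k)⟩

/-- `X ∘ [K, θ]` is the restriction of `X` along `θ`. -/
noncomputable def compOfHom [Finite K] [Finite G] (X : Biset G H) (θ : K →* G) :
    Iso (comp X (ofHom θ)) (restrict X θ) :=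
  (compCongr (Iso.refl X) (ofHomIsoTwist θ)).trans <|
    Iso.ofBijective (X := comp X (twist θ)) (Y := restrict X θ)
      (compLift (X := X) (Y := twist θ) (fun x (g : G) => X.ract x g)
        (fun x g (g' : G) => (X.ract_mul x g g').symm))
      (by
        constructor
        · refine comp_ind fun x (g : G) => comp_ind fun x' (g' : G) => ?_
          intro e
          change X.ract x g = X.ract x' g' at e
          refine compMk_eq.2 ⟨g' * g⁻¹, ?_, inv_mul_cancel_right g' g⟩
          rw [X.ract_mul, ← e, ← X.ract_mul, mul_inv_cancel, X.ract_one]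
        · intro x
          exact ⟨compMk X (twist θ) x (1 : G), X.ract_one x⟩)
      (by
        intro h w
        revert w
        exact comp_ind fun x (g : G) => X.lact_ract h x g)
      (by
        intro w k
        revert w
        exact comp_ind fun x (g : G) => X.ract_mul x g (θ k))

/-- For bisets `X` and `Y`, the `(K, H × G)`-biset `X × Y` with actions
`(a, b) (x, y) k = (a x b⁻¹, b y k)`. -/
def balanced (X : Biset G H) (Y : Biset K G) : Biset K (H × G) where
  carrier := X.carrier × Y.carrier
  finite := by have := X.finite; have := Y.finite; infer_instance
  lact a z := (X.ract (X.lact a.1 z.1) a.2⁻¹, Y.lact a.2 z.2)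
  ract z k := (z.1, Y.ract z.2 k)
  one_lact z := Prod.ext (by simp [X.one_lact, X.ract_one]) (Y.one_lact _)
  mul_lact a b z := Prod.ext
    (by simp [X.mul_lact, X.ract_mul, X.lact_ract])
    (Y.mul_lact _ _ _)
  ract_one z := Prod.ext rfl (Y.ract_one _)
  ract_mul z a b := Prod.ext rfl (Y.ract_mul _ _ _)
  lact_ract a z k := Prod.ext rfl (Y.lact_ract _ _ _)
  free a z e := by
    obtain ⟨a, b⟩ := a
    have hb : b = 1 := Y.free b _ (congrArg Prod.snd e)
    subst hb
    have ha : X.ract (X.lact a z.1) (1 : G)⁻¹ = z.1 := congrArg Prod.fst e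
    rw [inv_one, X.ract_one] at ha
    exact Prod.ext (X.free a _ ha) rfl

/-- `(X × 1) ∘ [G, Δ] ∘ Y` is the biset `X × Y` with actions `(a, b) (x, y) k = (a x b⁻¹, b y k)`:
every element of it has a unique representative of the form `((x, 1), y)`. -/
noncomputable def prodDiagComp [Finite G] (X : Biset G H) (Y : Biset K G) :
    Iso (comp (prod X (ofHom (MonoidHom.id G)))
      (comp (ofHom ((MonoidHom.id G).prod (MonoidHom.id G))) Y)) (balanced X Y) :=
  (compAssoc _ _ _).symm.trans <|
  (compCongr ((compOfHom _ _).trans (restrictCongr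
    (prodCongr (Iso.refl X) (ofHomIsoTwist (MonoidHom.id G))) _))
    (Iso.refl Y)).trans <|
  Iso.ofBijective (X := comp (restrict (prod X (twist (MonoidHom.id G)))
      ((MonoidHom.id G).prod (MonoidHom.id G))) Y) (Y := balanced X Y)
    (compLift (X := restrict (prod X (twist (MonoidHom.id G)))
      ((MonoidHom.id G).prod (MonoidHom.id G))) (Y := Y)
      (fun (z : X.carrier × G) y => (X.ract z.1 z.2⁻¹, Y.lact z.2 y))
      (fun (z : X.carrier × G) g y => by
        change (X.ract (X.ract z.1 g) (z.2 * g)⁻¹, Y.lact (z.2 * g) y) =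
          (X.ract z.1 z.2⁻¹, Y.lact z.2 (Y.lact g y))
        rw [← X.ract_mul, ← Y.mul_lact]
        simp))
    (by
      constructor
      · refine comp_ind fun (z : X.carrier × G) y => comp_ind fun (z' : X.carrier × G) y' => ?_
        intro e
        have e1 : X.ract z.1 z.2⁻¹ = X.ract z'.1 z'.2⁻¹ := congrArg Prod.fst e
        have e2 : Y.lact z.2 y = Y.lact z'.2 y' := congrArg Prod.snd e
        refine compMk_eq.2 ⟨z'.2⁻¹ * z.2, Prod.ext ?_ ?_, ?_⟩
        · change z.1 = X.ract z'.1 (z'.2⁻¹ * z.2)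
          rw [X.ract_mul, ← e1, ← X.ract_mul, inv_mul_cancel, X.ract_one]
        · change z.2 = z'.2 * (z'.2⁻¹ * z.2)
          simp
        · rw [Y.mul_lact, e2, ← Y.mul_lact, inv_mul_cancel, Y.one_lact]
      · rintro ⟨x, y⟩
        refine ⟨compMk (restrict (prod X (twist (MonoidHom.id G)))
          ((MonoidHom.id G).prod (MonoidHom.id G))) Y ((x, 1) : X.carrier × G) y, ?_⟩
        change (X.ract x (1 : G)⁻¹, Y.lact 1 y) = (x, y)
        rw [inv_one, X.ract_one, Y.one_lact])
    (by
      intro a w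
      revert w
      refine comp_ind fun (z : X.carrier × G) y => ?_
      change (X.ract (X.lact a.1 z.1) (a.2 * z.2)⁻¹, Y.lact (a.2 * z.2) y) =
        (X.ract (X.lact a.1 (X.ract z.1 z.2⁻¹)) a.2⁻¹, Y.lact a.2 (Y.lact z.2 y))
      rw [mul_inv_rev, X.ract_mul, X.lact_ract, Y.mul_lact])
    (by
      intro w k
      revert w
      refine comp_ind fun (z : X.carrier × G) y => ?_
      change (X.ract z.1 z.2⁻¹, Y.lact z.2 (Y.ract y k)) =
        (X.ract z.1 z.2⁻¹, Y.ract (Y.lact z.2 y) k)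
      rw [Y.lact_ract])

theorem numIntertwined_prod {G' H' : Type u} [Group G'] [Group H'] (φ : K →* H) (ψ : K →* G)
    (φ' : K →* H') (ψ' : K →* G') (X : Biset G H) (Y : Biset G' H') :
    numIntertwined (φ.prod φ') (ψ.prod ψ') (prod X Y) =
      numIntertwined φ ψ X * numIntertwined φ' ψ' Y := by
  unfold numIntertwined
  rw [← Set.ncard_prod]
  congr 1
  ext ⟨x, y⟩
  exact ⟨fun h => ⟨fun k => congrArg Prod.fst (h k), fun k => congrArg Prod.snd (h k)⟩,
    fun h k => Prod.ext (h.1 k) (h.2 k)⟩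

theorem numIntertwined_balanced {L : Type u} [Group L] (φ : L →* H) (φ' : L →* G) (ψ : L →* K)
    (X : Biset G H) (Y : Biset K G) :
    numIntertwined (φ.prod φ') ψ (balanced X Y) =
      numIntertwined φ φ' X * numIntertwined φ' ψ Y := by
  unfold numIntertwined
  rw [← Set.ncard_prod]
  congr 1
  ext ⟨x, y⟩
  have key : ∀ k, x = X.ract (X.lact (φ k) x) (φ' k)⁻¹ ↔ X.ract x (φ' k) = X.lact (φ k) x := by
    intro k
    constructor
    · intro h
      conv_lhs => rw [h]
      rw [← X.ract_mul, inv_mul_cancel, X.ract_one]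
    · intro h
      rw [← h, ← X.ract_mul, mul_inv_cancel, X.ract_one]
  exact ⟨fun h => ⟨fun k => (key k).1 (congrArg Prod.fst (h k)), fun k => congrArg Prod.snd (h k)⟩,
    fun h k => Prod.ext ((key k).2 (h.1 k)) (h.2 k)⟩

end Biset

namespace BurnsideLoc
variable {p : ℕ} [Fact p.Prime] {G H K : Type u} [Group G] [Group H] [Group K]

theorem span_range_cl : Submodule.span (ZLoc p) (Set.range (cl p (G := G) (H := H))) = ⊤ := by
  have h : (Submodule.span (ZLoc p) (Set.range (cl p (G := G) (H := H)))).mkQ = 0 :=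
    ext fun X => by
      rw [LinearMap.zero_apply, Submodule.mkQ_apply, Submodule.Quotient.mk_eq_zero]
      exact Submodule.subset_span ⟨X, rfl⟩
  rw [← Submodule.ker_mkQ (Submodule.span _ _), h, LinearMap.ker_zero]

/-- The linear extension of the number of elements intertwining `φ : K → H` and `ψ : K → G`.
For `K ≤ G` and `ψ` the inclusion this is the fixed-point homomorphism `Φ_{⟨K,φ⟩}`; allowing an
arbitrary `ψ` makes the behaviour under composition symmetric. -/
noncomputable def marks (φ : K →* H) (ψ : K →* G) : BurnsideLoc p G H →ₗ[ZLoc p] ZLoc p :=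
  lift (fun X => (X.numIntertwined φ ψ : ZLoc p))
    (fun _ _ e => by rw [Biset.numIntertwined_congr φ ψ e])
    (fun X Y => by rw [Biset.numIntertwined_sum, Nat.cast_add])

theorem marks_cl (φ : K →* H) (ψ : K →* G) (X : Biset G H) :
    marks φ ψ (cl p X) = (X.numIntertwined φ ψ : ZLoc p) :=
  lift_cl _ _ _ X

theorem fixedPoints_cl (K : Subgroup G) (φ : K →* H) (X : Biset G H) :
    fixedPoints K φ (cl p X) = (X.numFixed K φ : ZLoc p) :=
  lift_cl _ _ _ X

theorem coeff_cl (K : Subgroup G) (φ : K →* H) (X : Biset G H) :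
    coeff K φ (cl p X) = (X.numOrbitsOfType K φ : ZLoc p) :=
  lift_cl _ _ _ X

theorem augmentation_cl (X : Biset G H) :
    augmentation (cl p X) = (X.numLeftOrbits : ZLoc p) :=
  lift_cl _ _ _ X

theorem fixedPoints_eq_marks (K : Subgroup G) (φ : K →* H) :
    fixedPoints (p := p) K φ = marks φ K.subtype :=
  ext fun X => by rw [fixedPoints_cl, marks_cl]; rfl

theorem ofHom_eq_cl [Finite G] [Finite H] (φ : G →* H) : ofHom p φ = cl p (Biset.ofHom φ) := rfl

theorem marks_comp_ofHom {L : Type u} [Group L] [Finite K] [Finite G] (φ : L →* H) (ψ : L →* K)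
    (θ : K →* G) (X : BurnsideLoc p G H) :
    marks φ ψ (comp X (ofHom p θ)) = marks φ (θ.comp ψ) X := by
  have : marks φ ψ ∘ₗ comp.flip (ofHom p θ) = marks (p := p) φ (θ.comp ψ) := ext fun X => by
    change marks φ ψ (comp (cl p X) (ofHom p θ)) = _
    rw [ofHom_eq_cl, comp_cl, cl_congr (Biset.compOfHom X θ), marks_cl, marks_cl]
    rfl
  exact LinearMap.congr_fun this X

theorem marks_prod {G' H' : Type u} [Group G'] [Group H'] (φ : K →* H) (ψ : K →* G)
    (φ' : K →* H') (ψ' : K →* G') (X : BurnsideLoc p G H) (Y : BurnsideLoc p G' H') :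
    marks (φ.prod φ') (ψ.prod ψ') (prod X Y) = marks φ ψ X * marks φ' ψ' Y := by
  have : prod.compr₂ (marks (p := p) (φ.prod φ') (ψ.prod ψ')) =
      (LinearMap.mul (ZLoc p) (ZLoc p)).compl₁₂ (marks φ ψ) (marks φ' ψ') :=
    ext fun X => ext fun Y => by
      simp only [LinearMap.compr₂_apply, LinearMap.compl₁₂_apply, LinearMap.mul_apply',
        prod_cl, marks_cl, Biset.numIntertwined_prod, Nat.cast_mul]
  exact LinearMap.congr_fun₂ this X Y

theorem marks_prod_diag_comp {L : Type u} [Group L] [Finite G] (φ : L →* H) (φ' : L →* G)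
    (ψ : L →* K) (X : BurnsideLoc p G H) (Y : BurnsideLoc p K G) :
    marks (φ.prod φ') ψ (comp (prod X (ofHom p (MonoidHom.id G)))
      (comp (ofHom p ((MonoidHom.id G).prod (MonoidHom.id G))) Y)) =
      marks φ φ' X * marks φ' ψ Y := by
  have : (comp.compl₁₂ (prod.flip (ofHom p (MonoidHom.id G)))
      (comp (ofHom p ((MonoidHom.id G).prod (MonoidHom.id G))))).compr₂
        (marks (p := p) (φ.prod φ') ψ) =
      (LinearMap.mul (ZLoc p) (ZLoc p)).compl₁₂ (marks φ φ') (marks φ' ψ) :=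
    ext fun X => ext fun Y => by
      simp only [LinearMap.compr₂_apply, LinearMap.compl₁₂_apply, LinearMap.mul_apply',
        LinearMap.flip_apply]
      rw [ofHom_eq_cl, ofHom_eq_cl, prod_cl, comp_cl, comp_cl,
        cl_congr (Biset.prodDiagComp X Y), marks_cl, marks_cl, marks_cl,
        Biset.numIntertwined_balanced, Nat.cast_mul]
  exact LinearMap.congr_fun₂ this X Y

/-- Frobenius reciprocity, seen by the marks. -/
theorem FrobeniusReciprocity.marks_mul [Finite G] {X : BurnsideLoc p G G}
    (hX : FrobeniusReciprocity X) (φ φ' ψ : K →* G) :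
    marks φ ψ X * marks φ' ψ X = marks φ φ' X * marks φ' ψ X := by
  have h := congrArg (marks (φ.prod φ') ψ) hX
  rw [marks_prod_diag_comp, marks_comp_ofHom] at h
  rw [← h, ← marks_prod]
  rfl

theorem marks_comp_of_surjective {L : Type u} [Group L] (φ : K →* H) (ψ : K →* G) (e : L →* K)
    (he : Function.Surjective e) :
    marks (p := p) (φ.comp e) (ψ.comp e) = marks φ ψ :=
  ext fun X => by
    rw [marks_cl, marks_cl]
    refine congrArg (fun s : Set X.carrier => (s.ncard : ZLoc p)) (Set.ext fun x => ?_)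
    exact (he.forall (p := fun k => X.ract x (ψ k) = X.lact (φ k) x)).symm

theorem marks_conj_left (φ φ' : K →* H) (ψ : K →* G) (h : H) (e : ∀ k, φ' k = h * φ k * h⁻¹) :
    marks (p := p) φ' ψ = marks φ ψ :=
  ext fun X => by
    have hi : Function.Injective (X.lact h) := (MulAction.injective h : Function.Injective
      fun x : X.carrier => h • x)
    rw [marks_cl, marks_cl, Biset.numIntertwined, Biset.numIntertwined,
      ← Set.ncard_image_of_injective {x : X.carrier | ∀ k, X.ract x (ψ k) = X.lact (φ k) x} hi]
    congr 2
    ext x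
    constructor
    · intro hx
      refine ⟨X.lact h⁻¹ x, fun k => hi ?_, ?_⟩
      · rw [← X.lact_ract, ← X.mul_lact, ← X.mul_lact, ← X.mul_lact, mul_inv_cancel, X.one_lact,
          hx k, e]
      · rw [← X.mul_lact, mul_inv_cancel, X.one_lact]
    · rintro ⟨y, hy, rfl⟩ k
      rw [X.lact_ract, hy k, ← X.mul_lact, ← X.mul_lact, e]
      simp

/-- Divisibility of the values of a linear functional on bifree elements may be checked on bifree
bisets. -/
theorem dvd_of_forall_isBifree {f : BurnsideLoc p G H →ₗ[ZLoc p] ZLoc p} {a : ZLoc p}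
    (h : ∀ X : Biset G H, X.IsBifree → a ∣ f (cl p X)) {X : BurnsideLoc p G H}
    (hX : X ∈ free p G H) : a ∣ f X := by
  have : free p G H ≤ Submodule.comap f (Ideal.span {a}) := by
    rw [free, Submodule.span_le]
    rintro _ ⟨Y, hY, rfl⟩
    exact Ideal.mem_span_singleton.2 (h Y hY)
  exact Ideal.mem_span_singleton.1 (this hX)

theorem dvd_of_forall_cl {f : BurnsideLoc p G H →ₗ[ZLoc p] ZLoc p} {a : ZLoc p}
    (h : ∀ X : Biset G H, a ∣ f (cl p X)) (X : BurnsideLoc p G H) : a ∣ f X := by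
  have : Submodule.span (ZLoc p) (Set.range (cl p (G := G) (H := H))) ≤
      Submodule.comap f (Ideal.span {a}) := by
    rw [Submodule.span_le]
    rintro _ ⟨Y, rfl⟩
    exact Ideal.mem_span_singleton.2 (h Y)
  rw [span_range_cl] at this
  exact Ideal.mem_span_singleton.1 (this (Submodule.mem_top (x := X)))

/-- On a bifree element, the marks at `φ` and `ψ` vanish when `φ(k) = 1` but `ψ(k) ≠ 1`. -/
theorem marks_eq_zero_of_left (φ : K →* H) (ψ : K →* G) (k : K) (hφ : φ k = 1) (hψ : ψ k ≠ 1)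
    {X : BurnsideLoc p G H} (hX : X ∈ free p G H) : marks φ ψ X = 0 := by
  refine zero_dvd_iff.1 (dvd_of_forall_isBifree (f := marks φ ψ) (fun X hX => ?_) hX)
  rw [zero_dvd_iff, marks_cl, Nat.cast_eq_zero, Biset.numIntertwined]
  refine (congrArg Set.ncard (Set.eq_empty_iff_forall_notMem.2 fun x hx => ?_)).trans
    (Set.ncard_empty _)
  have := hx k
  rw [hφ, X.one_lact] at this
  exact hψ (hX _ _ this)

end BurnsideLoc

/-! ### Counting orbits of `p`-groups, and congruences between marks -/

theorem finite_monoidHom (K H : Type*) [Group K] [Group H] [Finite K] [Finite H] :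
    Finite (K →* H) := DFunLike.finite _

theorem isPGroup_prod {p : ℕ} [Fact p.Prime] {H G : Type*} [Group H] [Group G] [Finite H]
    [Finite G] (hH : IsPGroup p H) (hG : IsPGroup p G) : IsPGroup p (H × G) := by
  obtain ⟨m, hm⟩ := IsPGroup.iff_card.1 hH
  obtain ⟨n, hn⟩ := IsPGroup.iff_card.1 hG
  exact IsPGroup.iff_card.2 ⟨m + n, by rw [Nat.card_prod, hm, hn, pow_add]⟩

/-- If `a` divides `|ω| f(ω)` for every orbit `ω` on which the invariant function `f` is
evaluated, then `a` divides the sum of the values of `f`. -/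
theorem dvd_sum_of_invariant {Γ Z A : Type*} [Group Γ] [MulAction Γ Z] [Fintype Z]
    [CommSemiring A] (f : Z → A) (hf : ∀ (γ : Γ) z, f (γ • z) = f z) (a : A)
    (h : ∀ z, a ∣ ((MulAction.orbit Γ z).ncard : A) * f z) : a ∣ ∑ z, f z := by
  classical
  rw [← Finset.sum_fiberwise Finset.univ
    (fun z => (Quotient.mk (MulAction.orbitRel Γ Z) z)) f]
  refine Finset.dvd_sum fun ω _ => ?_
  induction ω using Quotient.inductionOn with | h z => ?_
  have hmem : ∀ w, Quotient.mk (MulAction.orbitRel Γ Z) w = Quotient.mk _ z ↔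
      w ∈ MulAction.orbit Γ z := fun w => Quotient.eq
  rw [Finset.sum_congr rfl (g := fun _ => f z), Finset.sum_const, nsmul_eq_mul]
  · convert h z using 3
    rw [← Set.ncard_coe_finset]
    congr 1
    ext w
    simp [hmem]
  · intro w hw
    obtain ⟨γ, rfl⟩ := (hmem w).1 (Finset.mem_filter.1 hw).2
    exact hf γ z

theorem dvd_ncard_of_invariant {Γ Z : Type*} [Group Γ] [MulAction Γ Z] [Finite Z]
    (B : Set Z) (hB : ∀ (γ : Γ), ∀ z ∈ B, γ • z ∈ B) (n : ℕ)
    (h : ∀ z ∈ B, n ∣ (MulAction.orbit Γ z).ncard) : n ∣ B.ncard := by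
  classical
  have := Fintype.ofFinite Z
  have hB' : ∀ (γ : Γ) z, γ • z ∈ B ↔ z ∈ B := fun γ z =>
    ⟨fun hz => by simpa using hB γ⁻¹ _ hz, hB γ z⟩
  have := dvd_sum_of_invariant (Γ := Γ) (fun z => if z ∈ B then 1 else 0)
    (fun γ z => by simp only [hB']) n (fun z => by
      by_cases hz : z ∈ B
      · simpa [hz] using h z hz
      · simp [hz])
  rw [Finset.sum_boole] at this
  rw [← Set.ncard_coe_finset] at this
  simpa using this

theorem ncard_orbit_of_free {A Z : Type*} [Group A] [MulAction A Z] (C : Subgroup A) (z : Z)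
    (hC : ∀ c ∈ C, c • z = z → c = 1) : (MulAction.orbit C z).ncard = Nat.card C := by
  rw [← MulAction.index_stabilizer]
  convert Subgroup.index_bot
  rw [Subgroup.eq_bot_iff_forall]
  intro c hc
  exact Subtype.ext (hC c c.2 hc)

/-- Let a finite `p`-group `Γ` act on a finite set `Z`, and let `C ≤ Γ` act freely.  The number of
points of a `Γ`-invariant subset whose `Γ`-orbit is larger than their `C`-orbit is divisible by
`p |C|`: the size of such a `Γ`-orbit is a power of `p` which exceeds `|C|`. -/
theorem dvd_ncard_orbit_not_subset {A Z : Type*} {p : ℕ} [Fact p.Prime] [Group A] [Finite A]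
    [MulAction A Z] [Finite Z] (Γ C : Subgroup A) (hCΓ : C ≤ Γ) (hΓ : IsPGroup p Γ)
    (hC : ∀ c ∈ C, ∀ z : Z, c • z = z → c = 1) (F : Set Z) (hF : ∀ γ ∈ Γ, ∀ z ∈ F, γ • z ∈ F) :
    p * Nat.card C ∣
      {z | z ∈ F ∧ ¬ MulAction.orbit Γ z ⊆ MulAction.orbit C z}.ncard := by
  have hsub : ∀ z : Z, MulAction.orbit C z ⊆ MulAction.orbit Γ z := by
    rintro z _ ⟨c, rfl⟩
    exact ⟨⟨c, hCΓ c.2⟩, rfl⟩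
  refine dvd_ncard_of_invariant (Γ := Γ) _ ?_ _ ?_
  · rintro γ z ⟨hz, hn⟩
    refine ⟨hF γ γ.2 z hz, fun h => hn ?_⟩
    have e1 : MulAction.orbit Γ (γ • z) = MulAction.orbit Γ z := MulAction.orbit_eq_iff.2 ⟨γ, rfl⟩
    rw [e1] at h
    have e2 : MulAction.orbit C z = MulAction.orbit C (γ • z) :=
      MulAction.orbit_eq_iff.2 (h (MulAction.mem_orbit_self z))
    rwa [e2]
  · rintro z ⟨-, hn⟩
    have hlt : (MulAction.orbit C z).ncard < (MulAction.orbit Γ z).ncard :=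
      Set.ncard_lt_ncard (lt_of_le_not_ge (hsub z) hn) (Set.toFinite _)
    rw [ncard_orbit_of_free C z fun c hc => hC c hc z] at hlt
    obtain ⟨n, hn⟩ := hΓ.index (MulAction.stabilizer Γ z)
    rw [MulAction.index_stabilizer] at hn
    obtain ⟨m, hm⟩ := (IsPGroup.iff_card (p := p) (G := C)).1 (hΓ.to_le hCΓ)
    rw [hn, hm] at hlt ⊢
    rw [← pow_succ']
    exact pow_dvd_pow p ((Nat.pow_lt_pow_iff_right (Fact.out : p.Prime).one_lt).1 hlt)

theorem ncard_eq_sum_ncard {Z ι : Type*} [Finite Z] [Fintype ι] (U : Set Z) (A : ι → Set Z)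
    (hU : ∀ z, z ∈ U ↔ ∃ i, z ∈ A i) (hd : ∀ i j z, z ∈ A i → z ∈ A j → i = j) :
    U.ncard = ∑ i, (A i).ncard := by
  simp only [← Nat.card_coe_set_eq]
  rw [← Nat.card_sigma]
  refine (Nat.card_congr (Equiv.ofBijective
    (fun a : Σ i, A i => (⟨a.2.1, (hU _).2 ⟨a.1, a.2.2⟩⟩ : U)) ⟨?_, ?_⟩)).symm
  · rintro ⟨i, z, hz⟩ ⟨j, w, hw⟩ e
    have : z = w := congrArg Subtype.val e
    subst this
    have := hd i j z hz hw
    subst this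
    rfl
  · rintro ⟨z, hz⟩
    obtain ⟨i, hi⟩ := (hU z).1 hz
    exact ⟨⟨i, z, hi⟩, rfl⟩

namespace Biset
variable {G H K : Type u} [Group G] [Group H] [Group K]

theorem lact_injective (X : Biset G H) (x : X.carrier) {a b : H} (h : X.lact a x = X.lact b x) :
    a = b := by
  have : X.lact (b⁻¹ * a) x = x := by
    rw [X.mul_lact, h, ← X.mul_lact, inv_mul_cancel, X.one_lact]
  exact (inv_mul_eq_one.1 (X.free _ _ this)).symm

theorem IsBifree.ract_injective {X : Biset G H} (hX : X.IsBifree) (x : X.carrier) {a b : G}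
    (h : X.ract x a = X.ract x b) : a = b := by
  have : X.ract x (a * b⁻¹) = x := by
    rw [X.ract_mul, h, ← X.ract_mul, mul_inv_cancel, X.ract_one]
  exact mul_inv_eq_one.1 (hX _ _ this)

/-- If `x G ⊆ H x`, then there is a homomorphism `χ : G → H` with `x g = χ(g) x`. -/
theorem exists_hom (X : Biset G H) (x : X.carrier) (h : ∀ g, ∃ a, X.ract x g = X.lact a x) :
    ∃ χ : G →* H, ∀ g, X.ract x g = X.lact (χ g) x := by
  choose f hf using h
  refine ⟨MonoidHom.mk' f fun a b => X.lact_injective x ?_, hf⟩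
  rw [← hf, X.ract_mul, hf a, X.lact_ract, hf b, ← X.mul_lact]

/-- If `φ(K) x ⊆ x G` in a bifree biset, then there is a homomorphism `θ : K → G` with
`x θ(k) = φ(k) x`. -/
theorem IsBifree.exists_hom {X : Biset G H} (hX : X.IsBifree) (φ : K →* H) (x : X.carrier)
    (h : ∀ k, ∃ g, X.ract x g = X.lact (φ k) x) :
    ∃ θ : K →* G, ∀ k, X.ract x (θ k) = X.lact (φ k) x := by
  choose f hf using h
  refine ⟨MonoidHom.mk' f fun a b => hX.ract_injective x ?_, hf⟩
  rw [hf, X.ract_mul, hf a, X.lact_ract, hf b, ← X.mul_lact, map_mul]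

theorem hat_smul (X : Biset G H) (a : H × G) (x : X.carrier) :
    a • x = X.ract (X.lact a.1 x) a.2⁻¹ := rfl

theorem hat_smul_eq_iff (X : Biset G H) (a : H × G) (x y : X.carrier) :
    a • x = y ↔ X.lact a.1 x = X.ract y a.2 := by
  rw [hat_smul]
  constructor
  · rintro rfl
    rw [← X.ract_mul, inv_mul_cancel, X.ract_one]
  · intro h
    rw [h, ← X.ract_mul, mul_inv_cancel, X.ract_one]

/-- The pairs `(s, u)` such that conjugation by `u` on the domain of `φ` corresponds to conjugation
by `s` on its image: the normalizer of the graph of `φ`, when `φ` is defined on a normal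
subgroup. -/
def graphNormalizer (L : Subgroup G) [L.Normal] (φ : L →* H) : Subgroup (H × G) where
  carrier := {a | ∀ l : L, φ (MulAut.conjNormal a.2 l) = a.1 * φ l * a.1⁻¹}
  one_mem' l := by simp
  mul_mem' {a b} ha hb l := by
    change φ (MulAut.conjNormal (a.2 * b.2) l) = a.1 * b.1 * φ l * (a.1 * b.1)⁻¹
    rw [map_mul, MulAut.mul_apply, ha, hb]
    group
  inv_mem' {a} ha l := by
    have := ha (MulAut.conjNormal a.2⁻¹ l)
    change φ (MulAut.conjNormal a.2⁻¹ l) = a.1⁻¹ * φ l * a.1⁻¹⁻¹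
    rw [← MulAut.mul_apply, ← map_mul, mul_inv_cancel, map_one, MulAut.one_apply] at this
    rw [this]
    group

/-- The elements intertwining `φ : L → H` with the inclusion of a normal subgroup `L` are, modulo
`p |C_H(φ(L))|`, counted by the elements intertwining the extensions of `φ` to `G`, provided that
`G` acts on `L` through elements of `H`. -/
theorem dvd_numIntertwined_sub {p : ℕ} [Fact p.Prime] [Finite G] [Finite H] (hG : IsPGroup p G)
    (hH : IsPGroup p H) (L : Subgroup G) [L.Normal] (φ : L →* H)
    (hφ : ∀ u : G, ∃ s, ∀ l : L, φ (MulAut.conjNormal u l) = s * φ l * s⁻¹)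
    [Fintype {χ : G →* H // χ.comp L.subtype = φ}] (X : Biset G H) :
    ∃ n, numIntertwined φ L.subtype X = p * Nat.card (Subgroup.centralizer (φ.range : Set H)) * n +
      ∑ χ : {χ : G →* H // χ.comp L.subtype = φ},
        numIntertwined χ.1 (MonoidHom.id G) X := by
  have := X.finite
  set C : Subgroup (H × G) := (Subgroup.centralizer (φ.range : Set H)).prod ⊥ with hCdef
  have hcent : ∀ c : H, c ∈ Subgroup.centralizer (φ.range : Set H) ↔
      ∀ l : L, φ l = c * φ l * c⁻¹ := by
    intro c
    rw [Subgroup.mem_centralizer_iff]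
    constructor
    · intro h l
      rw [← h _ ⟨l, rfl⟩, mul_inv_cancel_right]
    · rintro h _ ⟨l, rfl⟩
      exact eq_mul_inv_iff_mul_eq.1 (h l)
  have hCcard : Nat.card C = Nat.card (Subgroup.centralizer (φ.range : Set H)) := by
    rw [hCdef]
    exact (Nat.card_congr (Subgroup.prodEquiv (Subgroup.centralizer (φ.range : Set H))
      (⊥ : Subgroup G)).toEquiv).trans (by rw [Nat.card_prod, Subgroup.card_bot, mul_one])
  set F : Set X.carrier := {x | ∀ l : L, X.ract x (L.subtype l) = X.lact (φ l) x} with hFdef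
  obtain ⟨n, hn⟩ := dvd_ncard_orbit_not_subset (p := p) (graphNormalizer L φ) C
    (by
      rintro ⟨c, u⟩ ⟨hc, hu⟩ l
      obtain rfl : u = 1 := hu
      rw [map_one]
      exact (hcent c).1 hc l)
    ((isPGroup_prod hH hG).to_subgroup _)
    (by
      rintro ⟨c, u⟩ ⟨hc, hu⟩ x e
      obtain rfl : u = 1 := hu
      rw [hat_smul_eq_iff, X.ract_one] at e
      exact Prod.ext (X.free _ _ e) rfl)
    F
    (by
      rintro ⟨s, u⟩ hγ x hx l
      have h1 := hx (MulAut.conjNormal u⁻¹ l)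
      have h2 := hγ (MulAut.conjNormal u⁻¹ l)
      rw [← MulAut.mul_apply, ← map_mul, mul_inv_cancel, map_one, MulAut.one_apply] at h2
      change φ l = s * _ * s⁻¹ at h2
      have e : u⁻¹ * L.subtype l = L.subtype (MulAut.conjNormal u⁻¹ l) * u⁻¹ := by
        simp
      change X.ract (X.ract (X.lact s x) u⁻¹) (L.subtype l) =
        X.lact (φ l) (X.ract (X.lact s x) u⁻¹)
      rw [← X.ract_mul, e, X.ract_mul, X.lact_ract, h1, ← X.mul_lact, h2, ← X.lact_ract, ← X.mul_lact,
        inv_mul_cancel_right])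
  rw [hCcard] at hn
  refine ⟨n, ?_⟩
  rw [← hn]
  unfold numIntertwined
  rw [← ncard_eq_sum_ncard {z | z ∈ F ∧ MulAction.orbit (graphNormalizer L φ) z ⊆
    MulAction.orbit C z}]
  · rw [← Set.ncard_union_eq _ (Set.toFinite _) (Set.toFinite _)]
    · congr 1
      ext z
      change z ∈ F ↔ (z ∈ F ∧ _) ∨ (z ∈ F ∧ _)
      tauto
    · rw [Set.disjoint_left]
      exact fun z h h' => h.2 h'.2
  · intro z
    constructor
    · rintro ⟨hz, ho⟩
      obtain ⟨χ, hχ⟩ := X.exists_hom z (by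
        intro u
        obtain ⟨s, hs⟩ := hφ u
        obtain ⟨⟨⟨c, v⟩, hc, hv⟩, e⟩ := ho ⟨⟨(s, u), hs⟩, rfl⟩
        obtain rfl : v = 1 := hv
        have e' : (s, u) • z = (c, (1 : G)) • z := e.symm
        rw [hat_smul_eq_iff, hat_smul, inv_one, X.ract_one, X.lact_ract] at e'
        refine ⟨c⁻¹ * s, ?_⟩
        change X.lact s z = X.lact c (X.ract z u) at e'
        rw [X.mul_lact, e', ← X.mul_lact, inv_mul_cancel, X.one_lact])
      refine ⟨⟨χ, MonoidHom.ext fun l => X.lact_injective z ?_⟩, hχ⟩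
      exact (hχ l).symm.trans (hz l)
    · rintro ⟨⟨χ, rfl⟩, hχ⟩
      refine ⟨fun l => hχ l, ?_⟩
      rintro _ ⟨⟨⟨s, u⟩, hγ⟩, rfl⟩
      refine ⟨⟨(s * χ u⁻¹, 1), (hcent _).2 fun l => ?_, rfl⟩, ?_⟩
      · have h : χ (MulAut.conjNormal u (MulAut.conjNormal u⁻¹ l) : L) =
            s * χ (MulAut.conjNormal u⁻¹ l : L) * s⁻¹ := hγ _
        rw [← MulAut.mul_apply, ← map_mul, mul_inv_cancel, map_one, MulAut.one_apply] at h
        change χ l = s * χ u⁻¹ * χ l * (s * χ u⁻¹)⁻¹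
        exact h.trans (by simp [mul_assoc])
      · change (s * χ u⁻¹, (1 : G)) • z = (s, u) • z
        rw [hat_smul, hat_smul, inv_one, X.ract_one, X.lact_ract, X.mul_lact]
        congr 1
        exact (hχ u⁻¹).symm
  · intro χ χ' z h h'
    refine Subtype.ext (MonoidHom.ext fun u => X.lact_injective z ?_)
    exact (h u).symm.trans (h' u)

/-- In a bifree biset, the elements intertwining a fixed `φ : K → H` with some homomorphism
`K → G` account for all elements, modulo `p |G|`. -/
theorem IsBifree.dvd_card_sub {p : ℕ} [Fact p.Prime] [Finite G] [Finite H]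
    (hG : IsPGroup p G) (hH : IsPGroup p H) (φ : K →* H) [Fintype (K →* G)] {X : Biset G H}
    (hX : X.IsBifree) :
    ∃ n, Nat.card X.carrier = p * Nat.card G * n + ∑ θ : K →* G, numIntertwined φ θ X := by
  have := X.finite
  set C : Subgroup (H × G) := (⊥ : Subgroup H).prod ⊤ with hCdef
  have hCcard : Nat.card C = Nat.card G := by
    rw [hCdef, Nat.card_congr (Subgroup.prodEquiv _ _).toEquiv, Nat.card_prod,
      Subgroup.card_bot, one_mul, Subgroup.card_top]
  obtain ⟨n, hn⟩ := dvd_ncard_orbit_not_subset (p := p) (φ.range.prod ⊤) C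
    (Subgroup.prod_mono bot_le le_rfl)
    ((isPGroup_prod hH hG).to_subgroup _)
    (by
      rintro ⟨c, u⟩ ⟨hc, hu⟩ x e
      obtain rfl : c = 1 := hc
      rw [hat_smul_eq_iff, X.one_lact] at e
      exact Prod.ext rfl (hX _ _ e.symm))
    (Set.univ : Set X.carrier) (fun _ _ _ _ => trivial)
  rw [hCcard] at hn
  refine ⟨n, ?_⟩
  rw [← hn]
  unfold numIntertwined
  rw [← ncard_eq_sum_ncard {z | MulAction.orbit (φ.range.prod (⊤ : Subgroup G)) z ⊆
    MulAction.orbit C z}]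
  · rw [← Set.ncard_union_eq _ (Set.toFinite _) (Set.toFinite _), ← Set.ncard_univ]
    · congr 1
      ext z
      simp [or_comm, em]
    · rw [Set.disjoint_left]
      exact fun z h h' => h.2 h'
  · intro z
    constructor
    · intro ho
      refine hX.exists_hom φ z fun k => ?_
      obtain ⟨⟨⟨c, v⟩, hc, hv⟩, e⟩ := ho ⟨⟨(φ k, 1), ⟨k, rfl⟩, trivial⟩, rfl⟩
      obtain rfl : c = 1 := hc
      have e' : ((1 : H), v) • z = (φ k, (1 : G)) • z := e
      rw [hat_smul, hat_smul, X.one_lact, inv_one, X.ract_one] at e'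
      exact ⟨_, e'⟩
    · rintro ⟨θ, hθ⟩
      rintro _ ⟨⟨⟨a, v⟩, ⟨k, hk⟩, -⟩, rfl⟩
      obtain rfl : φ k = a := hk
      refine ⟨⟨(1, v * (θ k)⁻¹), rfl, trivial⟩, ?_⟩
      change ((1 : H), v * (θ k)⁻¹) • z = (φ k, v) • z
      rw [hat_smul, hat_smul, X.one_lact, ← hθ k, ← X.ract_mul]
      simp
  · intro χ χ' z h h'
    refine MonoidHom.ext fun u => hX.ract_injective z ?_
    exact (h u).trans (h' u).symm

/-- The group `C_H(φ(K))` acts freely on the elements intertwining `φ` and `ψ`. -/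
theorem card_centralizer_dvd_numIntertwined [Finite H] (φ : K →* H) (ψ : K →* G) (X : Biset G H) :
    Nat.card (Subgroup.centralizer (φ.range : Set H)) ∣ numIntertwined φ ψ X := by
  have := X.finite
  refine dvd_ncard_of_invariant (Γ := Subgroup.centralizer (φ.range : Set H))
    (Z := X.carrier) _ ?_ _ ?_
  · rintro ⟨c, hc⟩ x hx k
    change X.ract (X.lact c x) (ψ k) = X.lact (φ k) (X.lact c x)
    rw [X.lact_ract, hx k, ← X.mul_lact, ← X.mul_lact,
      Subgroup.mem_centralizer_iff.1 hc _ ⟨k, rfl⟩]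
  · intro x _
    rw [ncard_orbit_of_free _ x fun c _ hc => X.free c x hc]

theorem card_eq_card_mul_numLeftOrbits [Finite H] (X : Biset G H) :
    Nat.card X.carrier = Nat.card H * X.numLeftOrbits := by
  have := X.finite
  have := Fintype.ofFinite (Set.range fun x : X.carrier => MulAction.orbit H x)
  rw [← Set.ncard_univ, ncard_eq_sum_ncard Set.univ
    (fun O : Set.range fun x : X.carrier => MulAction.orbit H x => O.1), numLeftOrbits,
    Finset.sum_congr rfl (g := fun _ => Nat.card H), Finset.sum_const, smul_eq_mul, mul_comm,
    Finset.card_univ, ← Nat.card_eq_fintype_card, Nat.card_coe_set_eq]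
  · rintro ⟨_, x, rfl⟩ -
    have hs : MulAction.stabilizer H x = ⊥ :=
      (Subgroup.eq_bot_iff_forall _).2 fun h => X.free h x
    rw [← MulAction.index_stabilizer, hs, Subgroup.index_bot]
  · exact fun x => ⟨fun _ => ⟨⟨_, x, rfl⟩, MulAction.mem_orbit_self x⟩, fun _ => trivial⟩
  · rintro ⟨_, x, rfl⟩ ⟨_, y, rfl⟩ z hx hy
    exact Subtype.ext ((MulAction.orbit_eq_iff.2 hx).symm.trans (MulAction.orbit_eq_iff.2 hy))

end Biset

namespace BurnsideLoc
variable {p : ℕ} [Fact p.Prime] {G H K : Type u} [Group G] [Group H] [Group K]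

/-- The congruence `Φ(φ, ψ|_L) ≡ ∑ Φ(χ, ψ)` modulo `p |C_H(φ(L))|`, the sum over all extensions `χ`
of `φ` to `K`, whenever `K` acts on its normal subgroup `L` through elements of `H`. -/
theorem dvd_marks_sub_sum_extensions [Finite G] [Finite K] [Finite H] (hK : IsPGroup p K)
    (hH : IsPGroup p H) (L : Subgroup K) [L.Normal] (φ : L →* H)
    (hφ : ∀ u : K, ∃ s, ∀ l : L, φ (MulAut.conjNormal u l) = s * φ l * s⁻¹)
    [Fintype {χ : K →* H // χ.comp L.subtype = φ}] (ψ : K →* G) (X : BurnsideLoc p G H) :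
    ((p * Nat.card (Subgroup.centralizer (φ.range : Set H)) : ℕ) : ZLoc p) ∣
      marks φ (ψ.comp L.subtype) X -
        ∑ χ : {χ : K →* H // χ.comp L.subtype = φ}, marks χ.1 ψ X := by
  have key := dvd_of_forall_cl
    (f := marks φ L.subtype - ∑ χ : {χ : K →* H // χ.comp L.subtype = φ},
      marks χ.1 (MonoidHom.id K))
    (a := ((p * Nat.card (Subgroup.centralizer (φ.range : Set H)) : ℕ) : ZLoc p)) (fun Y => by
      obtain ⟨n, hn⟩ := Biset.dvd_numIntertwined_sub hK hH L φ hφ Y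
      simp only [LinearMap.sub_apply, LinearMap.sum_apply, marks_cl]
      rw [hn]
      refine ⟨n, ?_⟩
      push_cast
      ring) (comp X (ofHom p ψ))
  simp only [LinearMap.sub_apply, LinearMap.sum_apply, marks_comp_ofHom, MonoidHom.comp_id] at key
  exact key

theorem marks_one_one [Finite H] (X : BurnsideLoc p G H) :
    marks (1 : K →* H) (1 : K →* G) X = Nat.card H * augmentation X := by
  have : marks (p := p) (1 : K →* H) (1 : K →* G) = (Nat.card H : ZLoc p) • augmentation (G := G) :=
    ext fun X => by
      rw [marks_cl, LinearMap.smul_apply, augmentation_cl, smul_eq_mul, ← Nat.cast_mul,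
        ← Biset.card_eq_card_mul_numLeftOrbits, Biset.numIntertwined, ← Set.ncard_univ]
      congr 2
      ext x
      simp [X.ract_one, X.one_lact]
  exact LinearMap.congr_fun this X

/-- The congruence `|H| ε(X) ≡ ∑ Φ(φ, θ)` modulo `p |G|` for bifree `X`, the sum over all
`θ : K → G`. -/
theorem dvd_augmentation_sub_sum_right [Finite G] [Finite H] (hG : IsPGroup p G)
    (hH : IsPGroup p H) (φ : K →* H) [Fintype (K →* G)] {X : BurnsideLoc p G H}
    (hX : X ∈ free p G H) :
    ((p * Nat.card G : ℕ) : ZLoc p) ∣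
      Nat.card H * augmentation X - ∑ θ : K →* G, marks φ θ X := by
  have key := dvd_of_forall_isBifree
    (f := (Nat.card H : ZLoc p) • augmentation - ∑ θ : K →* G, marks φ θ)
    (a := ((p * Nat.card G : ℕ) : ZLoc p)) (fun Y hY => by
      obtain ⟨n, hn⟩ := hY.dvd_card_sub hG hH φ
      simp only [LinearMap.sub_apply, LinearMap.sum_apply, LinearMap.smul_apply, marks_cl,
        augmentation_cl, smul_eq_mul]
      rw [← Nat.cast_mul, ← Biset.card_eq_card_mul_numLeftOrbits, hn]
      refine ⟨n, ?_⟩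
      push_cast
      ring) hX
  simpa only [LinearMap.sub_apply, LinearMap.sum_apply, LinearMap.smul_apply, smul_eq_mul]
    using key

/-- The congruence `|H| ε(X) ≡ ∑ Φ(χ, ψ)` modulo `p |H|`, the sum over all `χ : K → H`. -/
theorem dvd_augmentation_sub_sum_left [Finite G] [Finite H] [Finite K] (hK : IsPGroup p K)
    (hH : IsPGroup p H) (ψ : K →* G) [Fintype (K →* H)] (X : BurnsideLoc p G H) :
    ((p * Nat.card H : ℕ) : ZLoc p) ∣
      Nat.card H * augmentation X - ∑ χ : K →* H, marks χ ψ X := by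
  have hext : ∀ χ : K →* H, χ.comp (⊥ : Subgroup K).subtype = 1 := by
    intro χ
    ext ⟨k, hk⟩
    obtain rfl : k = 1 := hk
    exact map_one χ
  have := Fintype.ofFinite {χ : K →* H // χ.comp (⊥ : Subgroup K).subtype = 1}
  have key := dvd_marks_sub_sum_extensions hK hH (⊥ : Subgroup K) 1 (fun u => ⟨1, by simp⟩) ψ X
  have hψ : ψ.comp (⊥ : Subgroup K).subtype = 1 := by
    ext ⟨k, hk⟩
    obtain rfl : k = 1 := hk
    exact map_one ψ
  have hc : Subgroup.centralizer (((1 : (⊥ : Subgroup K) →* H).range : Subgroup H) : Set H) = ⊤ := by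
    rw [Subgroup.eq_top_iff']
    intro h
    rw [Subgroup.mem_centralizer_iff]
    rintro _ ⟨k, rfl⟩
    simp
  rw [hψ, marks_one_one, hc, Subgroup.card_top] at key
  rwa [Fintype.sum_equiv (Equiv.subtypeUnivEquiv hext) (fun χ => marks χ.1 ψ X)
    (fun χ => marks χ ψ X)
    (fun χ => rfl)] at key

theorem card_centralizer_dvd_marks [Finite H] (φ : K →* H) (ψ : K →* G) (X : BurnsideLoc p G H) :
    (Nat.card (Subgroup.centralizer (φ.range : Set H)) : ZLoc p) ∣ marks φ ψ X :=
  dvd_of_forall_cl (fun Y => by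
    rw [marks_cl]
    exact Nat.cast_dvd_cast (Biset.card_centralizer_dvd_numIntertwined φ ψ Y)) X

end BurnsideLoc

/-! ### The standard basis and the table of marks -/

namespace Biset
variable {G H : Type u} [Group G] [Group H]

/-- The sub-biset on a subset which is stable under both actions. -/
def sub (X : Biset G H) (U : Set X.carrier) (hl : ∀ h, ∀ x ∈ U, X.lact h x ∈ U)
    (hr : ∀ g, ∀ x ∈ U, X.ract x g ∈ U) : Biset G H where
  carrier := U
  finite := by have := X.finite; infer_instance
  lact h x := ⟨X.lact h x, hl h x x.2⟩
  ract x g := ⟨X.ract x g, hr g x x.2⟩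
  one_lact x := Subtype.ext (X.one_lact _)
  mul_lact _ _ _ := Subtype.ext (X.mul_lact _ _ _)
  ract_one _ := Subtype.ext (X.ract_one _)
  ract_mul _ _ _ := Subtype.ext (X.ract_mul _ _ _)
  lact_ract _ _ _ := Subtype.ext (X.lact_ract _ _ _)
  free h x e := X.free h x (congrArg Subtype.val e)

/-- A biset is the disjoint union of a stable subset and its complement. -/
noncomputable def sumSub (X : Biset G H) (U V : Set X.carrier)
    (hUV : ∀ x, x ∈ U ↔ x ∉ V) (hl : ∀ h, ∀ x ∈ U, X.lact h x ∈ U)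
    (hr : ∀ g, ∀ x ∈ U, X.ract x g ∈ U) (hl' : ∀ h, ∀ x ∈ V, X.lact h x ∈ V)
    (hr' : ∀ g, ∀ x ∈ V, X.ract x g ∈ V) : Iso (sum (X.sub U hl hr) (X.sub V hl' hr')) X :=
  Iso.ofBijective (X := sum (X.sub U hl hr) (X.sub V hl' hr'))
    (Sum.elim (fun x : U => x.1) (fun x : V => x.1))
    (by
      constructor
      · rintro (⟨x, hx⟩ | ⟨x, hx⟩) (⟨y, hy⟩ | ⟨y, hy⟩) e
        · exact congrArg Sum.inl (Subtype.ext e)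
        · obtain rfl : x = y := e
          exact ((hUV _).1 hx hy).elim
        · obtain rfl : x = y := e
          exact ((hUV _).1 hy hx).elim
        · exact congrArg Sum.inr (Subtype.ext e)
      · intro x
        by_cases hx : x ∈ V
        · exact ⟨Sum.inr ⟨x, hx⟩, rfl⟩
        · exact ⟨Sum.inl ⟨x, (hUV x).2 hx⟩, rfl⟩)
    (by rintro h (x | x) <;> rfl)
    (by rintro (x | x) g <;> rfl)

theorem IsBifree.numOrbitsOfType_eq_zero {X : Biset G H} (hX : X.IsBifree) {K : Subgroup G}
    {φ : K →* H} (hφ : ¬ Function.Injective φ) : numOrbitsOfType K φ X = 0 := by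
  unfold numOrbitsOfType
  refine (congrArg Set.ncard (Set.eq_empty_iff_forall_notMem.2 ?_)).trans (Set.ncard_empty _)
  rintro _ ⟨x, hx, -⟩
  refine hφ ((injective_iff_map_eq_one φ).2 fun k hk => Subtype.ext ?_)
  have : (φ k, (k : G)) ∈ MulAction.stabilizer (H × G) x := by
    rw [hx]
    exact ⟨k, rfl⟩
  rw [MulAction.mem_stabilizer_iff, hat_smul_eq_iff, hk, X.one_lact] at this
  exact hX _ _ this.symm

/-- The class of `(h, g)` in `H ×_{(K,φ)} G`. -/
def stdMk [Finite G] [Finite H] (K : Subgroup G) (φ : K →* H) (h : H) (g : G) :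
    (std K φ).carrier :=
  Quotient.mk (stdSetoid K φ) (h, g)

variable [Finite G] [Finite H]

theorem std_ind {K : Subgroup G} {φ : K →* H} {P : (std K φ).carrier → Prop}
    (h : ∀ a g, P (stdMk K φ a g)) (z : (std K φ).carrier) : P z :=
  Quotient.inductionOn z fun a => h a.1 a.2

theorem ract_stdMk_eq_iff {K : Subgroup G} {φ : K →* H} (h : H) (g : G) (a : H) (b : G) :
    (std K φ).ract (stdMk K φ h g) b = (std K φ).lact a (stdMk K φ h g) ↔
      ∃ k : K, g * b = k * g ∧ a * h = h * φ k :=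
  Quotient.eq (r := stdSetoid K φ) (x := (h, g * b)) (y := (a * h, g))

theorem std_transitive {K : Subgroup G} {φ : K →* H} (x y : (std K φ).carrier) :
    ∃ a b, y = (std K φ).ract ((std K φ).lact a x) b := by
  induction x using std_ind with | h h g => ?_
  induction y using std_ind with | h h' g' => ?_
  refine ⟨h' * h⁻¹, g⁻¹ * g', ?_⟩
  change stdMk K φ h' g' = stdMk K φ (h' * h⁻¹ * h) (g * (g⁻¹ * g'))
  simp

/-- A transitive biset is isomorphic to `[K, φ]` as soon as it contains a point with stabilizer
`Δ(K, φ)`. -/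
theorem std_iso_of_point (X : Biset G H) (x : X.carrier)
    (htr : ∀ y, ∃ a b, y = X.ract (X.lact a x) b) (K : Subgroup G) (φ : K →* H)
    (h₁ : ∀ k : K, X.ract x k = X.lact (φ k) x)
    (h₂ : ∀ g a, X.ract x g = X.lact a x → g ∈ K) : Nonempty (Iso (std K φ) X) := by
  refine ⟨Iso.ofBijective (X := std K φ)
    (Quotient.lift (s := stdSetoid K φ) (fun a : H × G => X.ract (X.lact a.1 x) a.2) ?_)
    ⟨?_, ?_⟩ ?_ ?_⟩
  · rintro ⟨a, b⟩ ⟨a', b'⟩ ⟨k, e1, e2⟩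
    obtain rfl : b = k * b' := e1
    obtain rfl : a' = a * φ k := e2
    change X.ract (X.lact a x) (k * b') = X.ract (X.lact (a * φ k) x) b'
    rw [X.ract_mul, X.lact_ract, h₁, X.mul_lact]
  · refine std_ind fun a b => std_ind fun a' b' e => ?_
    change X.ract (X.lact a x) b = X.ract (X.lact a' x) b' at e
    have e' : X.ract x (b * b'⁻¹) = X.lact (a⁻¹ * a') x := by
      have := congrArg (fun y => X.ract (X.lact a⁻¹ y) b'⁻¹) e
      simpa only [← X.lact_ract, ← X.mul_lact, ← X.ract_mul, inv_mul_cancel, X.one_lact,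
        mul_inv_cancel, X.ract_one] using this
    have hk := h₂ _ _ e'
    refine Quotient.sound (s := stdSetoid K φ) ⟨⟨_, hk⟩, ?_, ?_⟩
    · simp
    · rw [X.lact_injective x ((h₁ ⟨_, hk⟩).symm.trans e')]
      simp
  · intro y
    obtain ⟨a, b, rfl⟩ := htr y
    exact ⟨stdMk K φ a b, rfl⟩
  · intro a z
    induction z using std_ind with | h h g => ?_
    change X.ract (X.lact (a * h) x) g = X.lact a (X.ract (X.lact h x) g)
    rw [X.mul_lact, X.lact_ract]
  · intro z b
    induction z using std_ind with | h h g => ?_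
    change X.ract (X.lact h x) (g * b) = X.ract (X.ract (X.lact h x) g) b
    rw [X.ract_mul]

/-- Every transitive biset is isomorphic to a standard one. -/
theorem exists_std_iso (X : Biset G H) (x : X.carrier)
    (htr : ∀ y, ∃ a b, y = X.ract (X.lact a x) b) :
    ∃ (K : Subgroup G) (φ : K →* H), Nonempty (Iso (std K φ) X) := by
  let K : Subgroup G :=
    { carrier := {g | ∃ a, X.ract x g = X.lact a x}
      one_mem' := ⟨1, by rw [X.ract_one, X.one_lact]⟩
      mul_mem' := by
        rintro g g' ⟨a, ha⟩ ⟨a', ha'⟩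
        exact ⟨a * a', by rw [X.ract_mul, ha, X.lact_ract, ha', X.mul_lact]⟩
      inv_mem' := by
        rintro g ⟨a, ha⟩
        refine ⟨a⁻¹, ?_⟩
        have := congrArg (fun y => X.lact a⁻¹ (X.ract y g⁻¹)) ha
        simpa only [← X.ract_mul, mul_inv_cancel, X.ract_one, X.lact_ract, ← X.mul_lact,
          inv_mul_cancel, X.one_lact] using this.symm }
  obtain ⟨φ, hφ⟩ := (X.restrict K.subtype).exists_hom x fun k => k.2
  exact ⟨K, φ, std_iso_of_point X x htr K φ hφ fun g a h => ⟨a, h⟩⟩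

/-- If a point of `[L, χ]` is fixed by `Δ(T, ψ)`, then `ψ` is, up to conjugation, a restriction of
`χ`. -/
theorem exists_conj_of_fixed {T L : Subgroup G} {ψ : T →* H} {χ : L →* H}
    (x : (std L χ).carrier) (hx : ∀ k : T, (std L χ).ract x k = (std L χ).lact (ψ k) x) :
    ∃ (h : H) (g : G), ∀ k : T, ∃ t : L, (t : G) = g * k * g⁻¹ ∧ ψ k = h * χ t * h⁻¹ := by
  induction x using std_ind with | h h g => ?_
  refine ⟨h, g, fun k => ?_⟩
  obtain ⟨t, e1, e2⟩ := (ract_stdMk_eq_iff _ _ _ _).1 (hx k)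
  exact ⟨t, by rw [e1]; group, by rw [← e2]; group⟩

/-- If moreover `|L| ≤ |T|`, then `[T, ψ]` and `[L, χ]` are isomorphic. -/
theorem iso_of_fixed {T L : Subgroup G} {ψ : T →* H} {χ : L →* H}
    (x : (std L χ).carrier) (hx : ∀ k : T, (std L χ).ract x k = (std L χ).lact (ψ k) x)
    (hc : Nat.card L ≤ Nat.card T) : Nonempty (Iso (std T ψ) (std L χ)) := by
  refine std_iso_of_point _ x (std_transitive x) T ψ hx ?_
  induction x using std_ind with | h h g => ?_
  intro b a e
  obtain ⟨t, e1, -⟩ := (ract_stdMk_eq_iff _ _ _ _).1 e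
  have hle : T ≤ L.map (MulAut.conj g⁻¹).toMonoidHom := by
    intro k hk
    obtain ⟨t, e1, -⟩ := (ract_stdMk_eq_iff _ _ _ _).1 (hx ⟨k, hk⟩)
    refine ⟨t, t.2, ?_⟩
    change g⁻¹ * t * g⁻¹⁻¹ = k
    rw [inv_inv, mul_assoc, ← e1]
    simp
  have heq : T = L.map (MulAut.conj g⁻¹).toMonoidHom :=
    Subgroup.eq_of_le_of_card_ge hle (by
      rw [← Nat.card_congr (L.equivMapOfInjective _ (MulAut.conj g⁻¹).injective).toEquiv]
      exact hc)
  rw [heq]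
  refine ⟨t, t.2, ?_⟩
  change g⁻¹ * t * g⁻¹⁻¹ = b
  rw [inv_inv, mul_assoc, ← e1]
  simp

theorem numOrbitsOfType_std_self (K : Subgroup G) (φ : K →* H) :
    numOrbitsOfType K φ (std K φ) = 1 := by
  unfold numOrbitsOfType
  rw [Set.ncard_eq_one]
  refine ⟨Set.univ, Set.eq_singleton_iff_unique_mem.2 ⟨⟨stdMk K φ 1 1, ?_, ?_⟩, ?_⟩⟩
  · ext ⟨a, b⟩
    rw [MulAction.mem_stabilizer_iff, hat_smul_eq_iff, eq_comm, ract_stdMk_eq_iff, graph]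
    constructor
    · rintro ⟨k, e1, e2⟩
      refine ⟨k, Prod.ext ?_ ?_⟩
      · simpa using e2.symm
      · simpa using e1.symm
    · rintro ⟨k, e⟩
      obtain ⟨rfl, rfl⟩ := Prod.ext_iff.1 e
      exact ⟨k, by simp, by simp⟩
  · refine (Set.eq_univ_of_forall fun y => ?_).symm
    obtain ⟨a, b, rfl⟩ := std_transitive (stdMk K φ 1 1) y
    exact ⟨(a, b⁻¹), by rw [hat_smul_eq_iff, ← (std K φ).ract_mul, mul_inv_cancel, (std K φ).ract_one]⟩
  · rintro _ ⟨x, -, rfl⟩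
    refine Set.eq_univ_of_forall fun y => ?_
    obtain ⟨a, b, rfl⟩ := std_transitive x y
    exact ⟨(a, b⁻¹), by rw [hat_smul_eq_iff, ← (std K φ).ract_mul, mul_inv_cancel, (std K φ).ract_one]⟩

theorem numOrbitsOfType_std_of_not_iso {K L : Subgroup G} {φ : K →* H} {χ : L →* H}
    (h : ¬ Nonempty (Iso (std K φ) (std L χ))) : numOrbitsOfType K φ (std L χ) = 0 := by
  unfold numOrbitsOfType
  refine (congrArg Set.ncard (Set.eq_empty_iff_forall_notMem.2 ?_)).trans (Set.ncard_empty _)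
  rintro _ ⟨x, hx, -⟩
  have key : ∀ a b, (std L χ).lact a x = (std L χ).ract x b ↔ (a, b) ∈ graph K φ := by
    intro a b
    rw [← hx, MulAction.mem_stabilizer_iff, hat_smul_eq_iff]
  refine h (std_iso_of_point _ x (std_transitive x) K φ (fun k => ?_) fun g a e => ?_)
  · exact ((key _ _).2 ⟨k, rfl⟩).symm
  · obtain ⟨k, hk⟩ := (key _ _).1 e.symm
    obtain rfl : (k : G) = g := congrArg Prod.snd hk
    exact k.2

end Biset

namespace BurnsideLoc
variable {p : ℕ} [Fact p.Prime] {G H : Type u} [Group G] [Group H]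

theorem cl_eq_zero_of_isEmpty (X : Biset G H) [IsEmpty X.carrier] : cl p X = 0 := by
  have e : Biset.Iso (X.sum X) X :=
    { toEquiv := Equiv.equivOfIsEmpty (X.carrier ⊕ X.carrier) X.carrier
      map_lact := by rintro h (x | x) <;> exact isEmptyElim x
      map_ract := by rintro (x | x) <;> exact isEmptyElim x }
  have := cl_congr (p := p) e
  rw [cl_sum] at this
  exact left_eq_add.1 this.symm

theorem coeff_eq_zero_of_not_injective {K : Subgroup G} {φ : K →* H}
    (hφ : ¬ Function.Injective φ) {X : BurnsideLoc p G H} (hX : X ∈ free p G H) :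
    coeff K φ X = 0 := by
  refine zero_dvd_iff.1 (dvd_of_forall_isBifree (f := coeff K φ) (fun X hX => ?_) hX)
  rw [coeff_cl, hX.numOrbitsOfType_eq_zero hφ, Nat.cast_zero]

variable [Finite G] [Finite H]

/-- Bisets decompose into their orbits. -/
theorem cl_mem_span_std (X : Biset G H) : cl p X ∈ Submodule.span (ZLoc p)
    {x | ∃ (K : Subgroup G) (φ : K →* H), x = cl p (Biset.std K φ)} := by
  induction hn : Nat.card X.carrier using Nat.strong_induction_on generalizing X with
  | _ n ih =>
  have := X.finite
  rcases isEmpty_or_nonempty X.carrier with hX | ⟨⟨x⟩⟩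
  · rw [cl_eq_zero_of_isEmpty]
    exact zero_mem _
  let U : Set X.carrier := {y | ∃ a b, y = X.ract (X.lact a x) b}
  have hl : ∀ h, ∀ y ∈ U, X.lact h y ∈ U := by
    rintro h _ ⟨a, b, rfl⟩
    exact ⟨h * a, b, by rw [← X.lact_ract, X.mul_lact]⟩
  have hr : ∀ g, ∀ y ∈ U, X.ract y g ∈ U := by
    rintro g _ ⟨a, b, rfl⟩
    exact ⟨a, b * g, by rw [X.ract_mul]⟩
  have hl' : ∀ h, ∀ y ∈ Uᶜ, X.lact h y ∈ Uᶜ := by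
    intro h y hy hy'
    have := hl h⁻¹ _ hy'
    rw [← X.mul_lact, inv_mul_cancel, X.one_lact] at this
    exact hy this
  have hr' : ∀ g, ∀ y ∈ Uᶜ, X.ract y g ∈ Uᶜ := by
    intro g y hy hy'
    have := hr g⁻¹ _ hy'
    rw [← X.ract_mul, mul_inv_cancel, X.ract_one] at this
    exact hy this
  have hxU : x ∈ U := ⟨1, 1, by rw [X.one_lact, X.ract_one]⟩
  rw [← cl_congr (X.sumSub U Uᶜ (fun y => by simp) hl hr hl' hr'), cl_sum]
  refine add_mem ?_ (ih _ ?_ _ rfl)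
  · obtain ⟨K, φ, ⟨e⟩⟩ := (X.sub U hl hr).exists_std_iso ⟨x, hxU⟩ (by
      rintro ⟨_, a, b, rfl⟩
      exact ⟨a, b, rfl⟩)
    exact Submodule.subset_span ⟨K, φ, (cl_congr e).symm⟩
  · rw [← hn]
    change Nat.card (Uᶜ : Set X.carrier) < _
    rw [Nat.card_coe_set_eq, ← Set.ncard_univ]
    exact Set.ncard_lt_ncard (Set.ssubset_univ_iff.2 fun h => by
      have : x ∈ Uᶜ := h ▸ Set.mem_univ x
      exact this hxU) (Set.toFinite _)

variable (G H) in
/-- The relation of isomorphism of the standard bisets `[K, φ]`, on `(G,H)`-pairs. -/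
def pairSetoid : Setoid (Σ K : Subgroup G, K →* H) where
  r a b := Nonempty (Biset.Iso (Biset.std a.1 a.2) (Biset.std b.1 b.2))
  iseqv := ⟨fun _ => ⟨Biset.Iso.refl _⟩, fun ⟨e⟩ => ⟨e.symm⟩, fun ⟨e⟩ ⟨f⟩ => ⟨e.trans f⟩⟩

variable (G H) in
/-- The index set of the standard basis: isomorphism classes of standard bisets `[K, φ]`. -/
abbrev PairClass : Type u := Quotient (pairSetoid G H)

variable (G H) in
theorem finite_pairClass : Finite (PairClass G H) := by
  have : ∀ K : Subgroup G, Finite (K →* H) := fun K => finite_monoidHom _ _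
  exact Quotient.finite _

/-- The standard basis element of an isomorphism class of standard bisets. -/
noncomputable def pairElt (p : ℕ) [Fact p.Prime] (b : PairClass G H) : BurnsideLoc p G H :=
  cl p (Biset.std b.out.1 b.out.2)

theorem pairElt_mk (K : Subgroup G) (φ : K →* H) :
    pairElt p (Quotient.mk (pairSetoid G H) ⟨K, φ⟩) = cl p (Biset.std K φ) := by
  obtain ⟨e⟩ := Quotient.mk_out (s := pairSetoid G H) ⟨K, φ⟩
  exact cl_congr e

theorem coeff_pairElt (K : Subgroup G) (φ : K →* H) (b : PairClass G H) [Decidable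
    (Quotient.mk (pairSetoid G H) ⟨K, φ⟩ = b)] :
    coeff K φ (pairElt p b) = if Quotient.mk (pairSetoid G H) ⟨K, φ⟩ = b then 1 else 0 := by
  split_ifs with h
  · rw [← h, pairElt_mk, coeff_cl, Biset.numOrbitsOfType_std_self, Nat.cast_one]
  · rw [pairElt, coeff_cl, Biset.numOrbitsOfType_std_of_not_iso, Nat.cast_zero]
    intro e
    apply h
    rw [← Quotient.out_eq b]
    exact Quotient.sound e

/-- Every element is the combination of the standard basis with coefficients `c_{⟨K,φ⟩}`. -/
theorem eq_sum_coeff [Fintype (PairClass G H)] (X : BurnsideLoc p G H) :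
    X = ∑ b : PairClass G H, coeff b.out.1 b.out.2 X • pairElt p b := by
  classical
  have hX : X ∈ Submodule.span (ZLoc p) (Set.range (pairElt p (G := G) (H := H))) := by
    have : Submodule.span (ZLoc p) (Set.range (cl p (G := G) (H := H))) ≤
        Submodule.span (ZLoc p) (Set.range (pairElt p (G := G) (H := H))) := by
      rw [Submodule.span_le]
      rintro _ ⟨Y, rfl⟩
      refine Submodule.span_mono ?_ (cl_mem_span_std Y)
      rintro _ ⟨K, φ, rfl⟩
      exact ⟨_, pairElt_mk K φ⟩
    rw [span_range_cl] at this
    exact this Submodule.mem_top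
  obtain ⟨a, rfl⟩ := (Submodule.mem_span_range_iff_exists_fun _).1 hX
  refine Finset.sum_congr rfl fun b _ => ?_
  congr 1
  simp only [map_sum, map_smul, coeff_pairElt, smul_eq_mul]
  simp [Quotient.out_eq]

theorem coeff_out (K : Subgroup G) (φ : K →* H) (X : BurnsideLoc p G H) :
    coeff (Quotient.mk (pairSetoid G H) ⟨K, φ⟩).out.1 (Quotient.mk (pairSetoid G H) ⟨K, φ⟩).out.2 X =
      coeff K φ X := by
  classical
  have := finite_pairClass G H
  have := Fintype.ofFinite (PairClass G H)
  conv_rhs => rw [eq_sum_coeff X]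
  simp only [map_sum, map_smul, coeff_pairElt, smul_eq_mul]
  simp

theorem exists_fixed_of_fixedPoints_ne_zero {T L : Subgroup G} {ψ : T →* H} {χ : L →* H}
    (h : fixedPoints T ψ (cl p (Biset.std L χ)) ≠ 0) : ∃ x : (Biset.std L χ).carrier,
      ∀ k : T, (Biset.std L χ).ract x k = (Biset.std L χ).lact (ψ k) x := by
  by_contra hn
  refine h ?_
  rw [fixedPoints_cl, Nat.cast_eq_zero]
  exact (congrArg Set.ncard (Set.eq_empty_iff_forall_notMem.2 fun x hx => hn ⟨x, hx⟩)).trans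
    (Set.ncard_empty _)

theorem fixedPoints_std_self_ne_zero (T : Subgroup G) (ψ : T →* H) :
    fixedPoints T ψ (cl p (Biset.std T ψ)) ≠ 0 := by
  have := (Biset.std T ψ).finite
  rw [fixedPoints_cl, Nat.cast_ne_zero]
  refine (Set.ncard_pos (Set.toFinite _)).2 ⟨Biset.stdMk T ψ 1 1, fun k => ?_⟩ |>.ne'
  exact (Biset.ract_stdMk_eq_iff _ _ _ _).2 ⟨k, by simp, by simp⟩

/-- If `X` has fixed points of type `(T, ψ)`, then so has one of the basis elements which occur
in `X`. -/
theorem exists_coeff_of_fixedPoints_ne_zero {T : Subgroup G} {ψ : T →* H} {X : BurnsideLoc p G H}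
    (h : fixedPoints T ψ X ≠ 0) : ∃ (L : Subgroup G) (χ : L →* H), coeff L χ X ≠ 0 ∧
      fixedPoints T ψ (cl p (Biset.std L χ)) ≠ 0 := by
  have := finite_pairClass G H
  have := Fintype.ofFinite (PairClass G H)
  rw [eq_sum_coeff X, map_sum] at h
  obtain ⟨b, -, hb⟩ := Finset.exists_ne_zero_of_sum_ne_zero h
  rw [map_smul, smul_eq_mul] at hb
  exact ⟨b.out.1, b.out.2, left_ne_zero_of_mul hb, right_ne_zero_of_mul hb⟩

/-- The table of marks is triangular: if `[T, ψ]` occurs in `X`, and no larger basis element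
occurring in `X` has fixed points of type `(T, ψ)`, then `X` has fixed points of this type. -/
theorem fixedPoints_ne_zero_of_coeff {T : Subgroup G} {ψ : T →* H} {X : BurnsideLoc p G H}
    (h : coeff T ψ X ≠ 0) (hmax : ∀ (L : Subgroup G) (χ : L →* H), Nat.card T < Nat.card L →
      coeff L χ X ≠ 0 → fixedPoints T ψ (cl p (Biset.std L χ)) = 0) :
    fixedPoints T ψ X ≠ 0 := by
  have := finite_pairClass G H
  have := Fintype.ofFinite (PairClass G H)
  rw [eq_sum_coeff X, map_sum, Finset.sum_eq_single (Quotient.mk (pairSetoid G H) ⟨T, ψ⟩)]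
  · rw [map_smul, coeff_out, pairElt_mk, smul_eq_mul]
    exact mul_ne_zero h (fixedPoints_std_self_ne_zero T ψ)
  · intro b _ hb
    rw [map_smul, smul_eq_mul]
    by_contra hne
    have h1 := left_ne_zero_of_mul hne
    have h2 : fixedPoints T ψ (cl p (Biset.std b.out.1 b.out.2)) ≠ 0 := right_ne_zero_of_mul hne
    have hle : Nat.card b.out.1 ≤ Nat.card T := by
      by_contra hlt
      exact h2 (hmax _ _ (not_le.1 hlt) h1)
    obtain ⟨x, hx⟩ := exists_fixed_of_fixedPoints_ne_zero h2
    apply hb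
    rw [← Quotient.out_eq b]
    exact Quotient.sound ((Biset.iso_of_fixed x hx hle).map Biset.Iso.symm)
  · exact fun h => (h (Finset.mem_univ _)).elim

/-- An element of `A(G,H)_(p)` is determined by its numbers of fixed points. -/
theorem eq_of_fixedPoints_eq {X Y : BurnsideLoc p G H}
    (h : ∀ (T : Subgroup G) (ψ : T →* H), fixedPoints T ψ X = fixedPoints T ψ Y) : X = Y := by
  rw [← sub_eq_zero]
  by_contra hne
  have : ∃ n, ∃ (T : Subgroup G) (ψ : T →* H), coeff T ψ (X - Y) ≠ 0 ∧
      Nat.card G - Nat.card T = n := by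
    by_contra hn
    push Not at hn
    have := finite_pairClass G H
    have := Fintype.ofFinite (PairClass G H)
    refine hne ((eq_sum_coeff _).trans (Finset.sum_eq_zero fun b _ => ?_))
    by_cases hb : coeff b.out.1 b.out.2 (X - Y) = 0
    · rw [hb, zero_smul]
    · exact (hn _ _ _ hb rfl).elim
  classical
  obtain ⟨T, ψ, hT, hn⟩ := Nat.find_spec this
  refine fixedPoints_ne_zero_of_coeff hT (fun L χ hL hc => ?_) (by rw [map_sub, h, sub_self])
  have h1 := Nat.find_min' this ⟨L, χ, hc, rfl⟩
  have h2 := Subgroup.card_le_card_group L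
  omega

end BurnsideLoc

/-! ### Automorphisms induced by conjugation -/

section
variable {K S : Type u} [Group K] [Group S]

/-- The group `S × Aut(K)` acts on `Hom(K, S)` by `(s, α) θ = c_s ∘ θ ∘ α⁻¹`. -/
instance homAction : MulAction (S × MulAut K) (K →* S) where
  smul a θ := (MulAut.conj a.1).toMonoidHom.comp (θ.comp (a.2⁻¹ : MulAut K).toMonoidHom)
  one_smul θ := MonoidHom.ext fun k => by
    change 1 * θ ((1 : MulAut K)⁻¹ k) * 1⁻¹ = θ k
    simp
  mul_smul a b θ := MonoidHom.ext fun k => by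
    change a.1 * b.1 * θ ((a.2 * b.2)⁻¹ k) * (a.1 * b.1)⁻¹ =
      a.1 * (b.1 * θ (b.2⁻¹ (a.2⁻¹ k)) * b.1⁻¹) * a.1⁻¹
    rw [mul_inv_rev, mul_inv_rev, MulAut.mul_apply]
    group

theorem homAction_apply (a : S × MulAut K) (θ : K →* S) (k : K) :
    (a • θ) k = a.1 * θ (a.2⁻¹ k) * a.1⁻¹ := rfl

theorem mem_stabilizer_hom {a : S × MulAut K} {θ : K →* S} :
    a ∈ MulAction.stabilizer (S × MulAut K) θ ↔ ∀ k, θ (a.2 k) = a.1 * θ k * a.1⁻¹ := by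
  rw [MulAction.mem_stabilizer_iff, DFunLike.ext_iff, ← a.2.forall_congr_right]
  refine forall_congr' fun k => ?_
  rw [homAction_apply, eq_comm]
  change θ (a.2 k) = a.1 * θ (a.2⁻¹ (a.2 k)) * a.1⁻¹ ↔ _
  rw [MulAut.inv_apply_self]

/-- For injective `θ : K → S`, the group `Aut_S(θ(K))`, transported to `K`: the automorphisms `α`
of `K` such that `θ ∘ α` and `θ` are `S`-conjugate. -/
def conjAut (θ : K →* S) : Subgroup (MulAut K) :=
  (MulAction.stabilizer (S × MulAut K) θ).map (MonoidHom.snd S (MulAut K))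

theorem mem_conjAut {θ : K →* S} {α : MulAut K} :
    α ∈ conjAut θ ↔ ∃ s, ∀ k, θ (α k) = s * θ k * s⁻¹ := by
  constructor
  · rintro ⟨a, ha, rfl⟩
    exact ⟨a.1, mem_stabilizer_hom.1 ha⟩
  · rintro ⟨s, hs⟩
    exact ⟨(s, α), mem_stabilizer_hom.2 hs, rfl⟩

theorem card_eq_card_map_snd_mul {A B : Type*} [Group A] [Group B] (T : Subgroup (A × B)) :
    Nat.card T = Nat.card (T.comap (MonoidHom.inl A B)) * Nat.card (T.map (MonoidHom.snd A B)) := by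
  have h := ((MonoidHom.snd A B).comp T.subtype).ker.card_mul_index
  rw [Subgroup.index_ker, MonoidHom.range_comp, Subgroup.range_subtype] at h
  rw [← h]
  congr 1
  refine Nat.card_congr ⟨fun a => ⟨a.1.1.1, ?_⟩, fun a => ⟨⟨(a.1, 1), a.2⟩, rfl⟩, ?_, ?_⟩
  · obtain ⟨⟨⟨a, b⟩, h⟩, hb⟩ := a
    obtain rfl : b = 1 := hb
    exact h
  · rintro ⟨⟨⟨a, b⟩, h⟩, hb⟩
    obtain rfl : b = 1 := hb
    rfl
  · intro a
    rfl

theorem card_stabilizer_hom (θ : K →* S) :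
    Nat.card (MulAction.stabilizer (S × MulAut K) θ) =
      Nat.card (Subgroup.centralizer (θ.range : Set S)) * Nat.card (conjAut θ) := by
  rw [card_eq_card_map_snd_mul]
  congr 2
  have : (MulAction.stabilizer (S × MulAut K) θ).comap (MonoidHom.inl S (MulAut K)) =
      Subgroup.centralizer (θ.range : Set S) := by
    ext s
    rw [Subgroup.mem_comap, mem_stabilizer_hom, Subgroup.mem_centralizer_iff]
    change (∀ k, θ k = s * θ k * s⁻¹) ↔ _
    constructor
    · rintro h _ ⟨k, rfl⟩
      exact eq_mul_inv_iff_mul_eq.1 (h k)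
    · exact fun h k => eq_mul_inv_iff_mul_eq.2 (h _ ⟨k, rfl⟩)
  rw [this]

/-- For injective `θ`, restriction to the first factor identifies the stabilizer of `θ` in
`S × Aut(K)` with `N_S(θ(K))`. -/
theorem card_stabilizer_hom_of_injective [Finite S] {θ : K →* S} (hθ : Function.Injective θ) :
    Nat.card (MulAction.stabilizer (S × MulAut K) θ) =
      Nat.card (Subgroup.normalizer (θ.range : Set S)) := by
  have : Finite K := Finite.of_injective θ hθ
  refine Nat.card_congr (Equiv.ofBijective (fun a => ⟨a.1.1, ?_⟩) ⟨?_, ?_⟩)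
  · obtain ⟨⟨s, α⟩, ha⟩ := a
    rw [mem_stabilizer_hom] at ha
    change s ∈ _
    rw [Subgroup.mem_normalizer_iff]
    intro x
    constructor
    · rintro ⟨k, rfl⟩
      exact ⟨α k, ha k⟩
    · rintro ⟨k, hk⟩
      refine ⟨α⁻¹ k, ?_⟩
      have := ha (α⁻¹ k)
      change θ (α (α⁻¹ k)) = s * θ (α⁻¹ k) * s⁻¹ at this
      rw [MulAut.apply_inv_self, hk] at this
      simpa using this.symm
  · rintro ⟨⟨s, α⟩, ha⟩ ⟨⟨t, β⟩, hb⟩ e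
    obtain rfl : s = t := congrArg Subtype.val e
    rw [mem_stabilizer_hom] at ha hb
    refine Subtype.ext (Prod.ext rfl (MulEquiv.ext fun k => hθ ?_))
    exact (ha k).trans (hb k).symm
  · rintro ⟨s, hs⟩
    have hc : ∀ k, ∃ k', θ k' = s * θ k * s⁻¹ := fun k =>
      (Subgroup.mem_normalizer_iff.1 hs (θ k)).1 ⟨k, rfl⟩
    choose f hf using hc
    have hi : Function.Injective f := fun a b e => by
      have := hf a
      rw [e, hf b] at this
      exact hθ (by simpa using this.symm)
    let α : K →* K := MonoidHom.mk' f fun a b => hθ (by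
      rw [hf, map_mul, map_mul, hf, hf]
      group)
    exact ⟨⟨(s, MulEquiv.ofBijective α ⟨hi, Finite.surjective_of_injective hi⟩),
      mem_stabilizer_hom.2 hf⟩, rfl⟩

/-- `|N_S(θ(K))| = |C_S(θ(K))| |Aut_S(θ(K))|`. -/
theorem card_normalizer_range [Finite S] {θ : K →* S} (hθ : Function.Injective θ) :
    Nat.card (Subgroup.normalizer (θ.range : Set S)) =
      Nat.card (Subgroup.centralizer (θ.range : Set S)) * Nat.card (conjAut θ) := by
  rw [← card_stabilizer_hom_of_injective hθ, card_stabilizer_hom]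

end

/-! ### The equivalence relation defined by Frobenius reciprocity -/

namespace BurnsideLoc

/-- A bifree element whose augmentation is prime to `p` and which satisfies Frobenius reciprocity,
over a finite `p`-group. -/
structure IsReciprocal {p : ℕ} [Fact p.Prime] {S : Type u} [Group S] [Finite S]
    (X : BurnsideLoc p S S) : Prop where
  isPGroup : IsPGroup p S
  bifree : X ∈ free p S S
  augmentation : ¬ (p : ZLoc p) ∣ augmentation X
  frobenius : FrobeniusReciprocity X

/-- Two homomorphisms `K → S` are related by `X` if the number of elements of `X` intertwining
them is non-zero. -/
def Related {p : ℕ} [Fact p.Prime] {S K : Type u} [Group S] [Group K] (X : BurnsideLoc p S S)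
    (φ ψ : K →* S) : Prop := marks φ ψ X ≠ 0

theorem related_comp_iff {p : ℕ} [Fact p.Prime] {S K L : Type u} [Group S] [Group K] [Group L]
    {X : BurnsideLoc p S S} {φ ψ : K →* S} (e : L →* K) (he : Function.Surjective e) :
    Related X (φ.comp e) (ψ.comp e) ↔ Related X φ ψ := by
  unfold Related
  rw [marks_comp_of_surjective φ ψ e he]

namespace IsReciprocal
variable {p : ℕ} [Fact p.Prime] {S : Type u} [Group S] [Finite S] {X : BurnsideLoc p S S}
  (hX : IsReciprocal X) {K : Type u} [Group K]
include hX

/-- The second argument of the marks may be replaced by a related one. -/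
theorem marks_right {φ' ψ : K →* S} (h : Related X φ' ψ) (φ : K →* S) :
    marks φ ψ X = marks φ φ' X :=
  mul_right_cancel₀ h (hX.frobenius.marks_mul φ φ' ψ)

theorem not_dvd_card_mul_augmentation :
    ¬ ((p * Nat.card S : ℕ) : ZLoc p) ∣ Nat.card S * BurnsideLoc.augmentation X := by
  rw [Nat.cast_mul, mul_comm, mul_dvd_mul_iff_left (Nat.cast_ne_zero.2 Nat.card_pos.ne')]
  exact hX.augmentation

theorem related_trans {φ χ ψ : K →* S} (h : Related X φ χ) (h' : Related X χ ψ) :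
    Related X φ ψ := by
  unfold Related
  rw [hX.marks_right h' φ]
  exact h

theorem marks_of_related {φ ψ : K →* S} (h : Related X φ ψ) : marks φ ψ X = marks φ φ X :=
  hX.marks_right h φ

variable [Finite K]

theorem related_self (φ : K →* S) : Related X φ φ := by
  have := finite_monoidHom K S
  have := Fintype.ofFinite (K →* S)
  have h := dvd_augmentation_sub_sum_right hX.isPGroup hX.isPGroup φ hX.bifree
  by_contra h0
  have h0 : marks φ φ X = 0 := not_not.1 h0
  rw [Finset.sum_eq_zero, sub_zero] at h
  · exact hX.not_dvd_card_mul_augmentation h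
  · intro θ _
    have := hX.frobenius.marks_mul φ φ θ
    rw [h0, zero_mul] at this
    exact mul_self_eq_zero.1 this

theorem related_symm {φ ψ : K →* S} (h : Related X φ ψ) : Related X ψ φ := by
  unfold Related
  rw [← hX.marks_right h ψ]
  exact hX.related_self ψ

theorem related_conj {φ φ' : K →* S} (s : S) (h : ∀ k, φ' k = s * φ k * s⁻¹) :
    Related X φ' φ := by
  unfold Related
  rw [marks_conj_left φ φ' φ s h]
  exact hX.related_self φ

/-- The number `Φ(φ, φ)` of fixed points, up to units, only depends on the class of `φ`: its product
with the size of the class is a unit multiple of `|S|`. -/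
theorem associated_marks {φ ψ : K →* S} (h : Related X φ ψ) :
    Associated (marks φ φ X) (marks ψ ψ X) := by
  have := finite_monoidHom K S
  have := Fintype.ofFinite (K →* S)
  classical
  have key : ∀ φ : K →* S, Associated (Nat.card S : ZLoc p)
      (((Finset.univ.filter fun θ => Related X φ θ).card : ZLoc p) * marks φ φ X) := by
    intro φ
    obtain ⟨c, hc⟩ := dvd_augmentation_sub_sum_right hX.isPGroup hX.isPGroup φ hX.bifree
    have hsum : ∑ θ : K →* S, marks φ θ X =
        ((Finset.univ.filter fun θ => Related X φ θ).card : ZLoc p) * marks φ φ X := by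
      rw [← nsmul_eq_mul, ← Finset.sum_const, Finset.sum_filter]
      refine Finset.sum_congr rfl fun θ _ => ?_
      split_ifs with hθ
      · exact hX.marks_of_related hθ
      · exact not_not.1 hθ
    rw [hsum] at hc
    have hu : IsUnit (BurnsideLoc.augmentation X - p * c) := ZLoc.isUnit_iff.2 fun h =>
      hX.augmentation (by simpa using dvd_add h (dvd_mul_right (p : ZLoc p) c))
    refine ⟨hu.unit, ?_⟩
    rw [IsUnit.unit_spec, mul_sub, sub_eq_iff_eq_add, ← sub_eq_iff_eq_add', hc]
    push_cast
    ring
  have hcls : (Finset.univ.filter fun θ => Related X φ θ) =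
      Finset.univ.filter fun θ => Related X ψ θ := by
    ext θ
    simp only [Finset.mem_filter, Finset.mem_univ, true_and]
    exact ⟨hX.related_trans (hX.related_symm h), hX.related_trans h⟩
  have h1 := (key φ).symm.trans (key ψ)
  rw [hcls] at h1
  refine Associated.of_mul_left h1 (Associated.refl _) ?_
  refine Nat.cast_ne_zero.2 (Finset.card_pos.2 ⟨ψ, ?_⟩).ne'
  exact Finset.mem_filter.2 ⟨Finset.mem_univ _, hX.related_self ψ⟩

/-- The automorphisms `α` of `K` such that `φ ∘ α` is related to `φ`. -/
def relatedAut (φ : K →* S) : Subgroup (MulAut K) where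
  carrier := {α | Related X φ (φ.comp α.toMonoidHom)}
  one_mem' := hX.related_self φ
  mul_mem' {α β} ha hb := by
    have h : Related X (φ.comp β.toMonoidHom) ((φ.comp α.toMonoidHom).comp β.toMonoidHom) :=
      (related_comp_iff _ β.surjective).2 ha
    have e : φ.comp (α * β : MulAut K).toMonoidHom = (φ.comp α.toMonoidHom).comp β.toMonoidHom :=
      MonoidHom.ext fun k => congrArg φ (MulAut.mul_apply K α β k)
    change Related X φ (φ.comp (α * β : MulAut K).toMonoidHom)
    rw [e]
    exact hX.related_trans hb h
  inv_mem' {α} ha := by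
    have h : Related X (φ.comp α.symm.toMonoidHom)
        ((φ.comp α.toMonoidHom).comp α.symm.toMonoidHom) :=
      (related_comp_iff _ α.symm.surjective).2 ha
    have e : (φ.comp α.toMonoidHom).comp α.symm.toMonoidHom = φ :=
      MonoidHom.ext fun k => congrArg φ (MulEquiv.apply_symm_apply α k)
    rw [e] at h
    exact hX.related_symm h

theorem conjAut_le {φ χ : K →* S} (h : Related X φ χ) : conjAut χ ≤ hX.relatedAut φ := by
  intro α hα
  obtain ⟨s, hs⟩ := mem_conjAut.1 hα
  have h1 : Related X (χ.comp α.toMonoidHom) χ := hX.related_conj s hs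
  exact hX.related_trans h (hX.related_trans (hX.related_symm h1)
    ((related_comp_iff α.toMonoidHom α.surjective).2 (hX.related_symm h)))

/-- Every class contains a `χ` such that `Φ(χ, χ) / |C_S(χ(K))|` is a unit and `Aut_S(χ(K))` has
index prime to `p` in the automorphism group of the class.  Otherwise every orbit of
`S × Aut(class)` on the class would contribute a multiple of `p |S|` to `∑ Φ(χ, φ)`, a sum which is
congruent to `|S| ε(X)`. -/
theorem exists_optimal (hK : IsPGroup p K) (φ : K →* S) : ∃ χ, Related X φ χ ∧
    ¬ ((p * Nat.card (Subgroup.centralizer (χ.range : Set S)) : ℕ) : ZLoc p) ∣ marks χ χ X ∧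
    ¬ p * Nat.card (conjAut χ) ∣ Nat.card (hX.relatedAut φ) := by
  have := finite_monoidHom K S
  have := Fintype.ofFinite (K →* S)
  have : Finite (MulAut K) := DFunLike.finite _
  by_contra! hcon
  set Γ : Subgroup (S × MulAut K) := (⊤ : Subgroup S).prod (hX.relatedAut φ) with hΓdef
  have hΓcard : Nat.card Γ = Nat.card S * Nat.card (hX.relatedAut φ) := by
    rw [hΓdef]
    exact (Nat.card_congr (Subgroup.prodEquiv (⊤ : Subgroup S) (hX.relatedAut φ)).toEquiv).trans
      (by rw [Nat.card_prod, Subgroup.card_top])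
  have hdvd : ((p * Nat.card S : ℕ) : ZLoc p) ∣ ∑ θ : K →* S, marks θ φ X := by
    refine dvd_sum_of_invariant (Γ := Γ) _ ?_ _ ?_
    · rintro ⟨⟨s, α⟩, -, hα⟩ θ
      have h1 : marks ((s, α) • θ) φ X = marks (θ.comp (α⁻¹ : MulAut K).toMonoidHom) φ X := by
        rw [marks_conj_left (θ.comp (α⁻¹ : MulAut K).toMonoidHom) ((s, α) • θ) φ s fun k => rfl]
      have h2 : Related X φ (φ.comp (α⁻¹ : MulAut K).toMonoidHom) :=
        (hX.relatedAut φ).inv_mem hα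
      change marks ((s, α) • θ) φ X = marks θ φ X
      rw [h1, ← hX.marks_right h2, marks_comp_of_surjective _ _ _ (α⁻¹ : MulAut K).surjective]
    · intro χ
      by_cases hχ : Related X φ χ
      swap
      · rw [show marks χ φ X = 0 from not_not.1 fun h => hχ (hX.related_symm h), mul_zero]
        exact dvd_zero _
      rw [hX.marks_of_related (hX.related_symm hχ)]
      have hT : Nat.card (MulAction.stabilizer Γ χ) =
          Nat.card (MulAction.stabilizer (S × MulAut K) χ) := by
        have hle : MulAction.stabilizer (S × MulAut K) χ ≤ Γ := fun a ha =>
          ⟨trivial, hX.conjAut_le hχ ⟨a, ha, rfl⟩⟩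
        exact Nat.card_congr (Subgroup.subgroupOfEquivOfLe hle).toEquiv
      have horb := (MulAction.stabilizer Γ χ).card_mul_index
      rw [MulAction.index_stabilizer, hT, card_stabilizer_hom, hΓcard] at horb
      have hC0 : (Nat.card (Subgroup.centralizer (χ.range : Set S)) : ZLoc p) ≠ 0 :=
        Nat.cast_ne_zero.2 Nat.card_pos.ne'
      have hA0 : (Nat.card (conjAut χ) : ZLoc p) ≠ 0 := Nat.cast_ne_zero.2 Nat.card_pos.ne'
      have horb' : (Nat.card (Subgroup.centralizer (χ.range : Set S)) : ZLoc p) *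
          Nat.card (conjAut χ) * (MulAction.orbit Γ χ).ncard =
          Nat.card S * Nat.card (hX.relatedAut φ) := by exact_mod_cast horb
      rw [← mul_dvd_mul_iff_left (mul_ne_zero hC0 hA0), ← mul_assoc, horb']
      have hC := card_centralizer_dvd_marks χ χ X
      have hA : (Nat.card (conjAut χ) : ZLoc p) ∣ Nat.card (hX.relatedAut φ) :=
        Nat.cast_dvd_cast (Subgroup.card_dvd_of_le (hX.conjAut_le hχ))
      push_cast
      by_cases h : ((p * Nat.card (Subgroup.centralizer (χ.range : Set S)) : ℕ) : ZLoc p) ∣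
          marks χ χ X
      · rw [Nat.cast_mul] at h
        convert mul_dvd_mul (mul_dvd_mul_left (Nat.card S : ZLoc p) hA) h using 1
        ring
      · have h' : ((p * Nat.card (conjAut χ) : ℕ) : ZLoc p) ∣ Nat.card (hX.relatedAut φ) :=
          Nat.cast_dvd_cast (hcon χ hχ h)
        rw [Nat.cast_mul] at h'
        convert mul_dvd_mul (mul_dvd_mul_left (Nat.card S : ZLoc p) h') hC using 1
        ring
  have h := dvd_augmentation_sub_sum_left hK hX.isPGroup φ X
  exact hX.not_dvd_card_mul_augmentation ((dvd_sub_left hdvd).1 h)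


/-- Among the homomorphisms related to `φ`, those of `exists_optimal` have the largest centralizer
and the largest group of `S`-automorphisms. -/
theorem card_le_of_optimal {φ χ θ : K →* S} (hχ : Related X φ χ)
    (hC : ¬ ((p * Nat.card (Subgroup.centralizer (χ.range : Set S)) : ℕ) : ZLoc p) ∣ marks χ χ X)
    (hA : ¬ p * Nat.card (conjAut χ) ∣ Nat.card (hX.relatedAut φ)) (hθ : Related X φ θ)
    (hi : Function.Injective θ) :
    Nat.card (Subgroup.centralizer (θ.range : Set S)) ≤
        Nat.card (Subgroup.centralizer (χ.range : Set S)) ∧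
      Nat.card (conjAut θ) ≤ Nat.card (conjAut χ) := by
  have : Finite (MulAut K) := DFunLike.finite _
  have hp : p.Prime := Fact.out
  have hpow : ∀ T : Subgroup S, ∃ n, Nat.card T = p ^ n := fun T =>
    IsPGroup.iff_card.1 (hX.isPGroup.to_subgroup T)
  constructor
  · by_contra! hlt
    apply hC
    have h1 : (Nat.card (Subgroup.centralizer (θ.range : Set S)) : ZLoc p) ∣ marks χ χ X :=
      (card_centralizer_dvd_marks θ θ X).trans
        (hX.associated_marks (hX.related_trans (hX.related_symm hθ) hχ)).dvd
    refine (Nat.cast_dvd_cast ?_).trans h1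
    obtain ⟨m, hm⟩ := hpow (Subgroup.centralizer (χ.range : Set S))
    obtain ⟨n, hn⟩ := hpow (Subgroup.centralizer (θ.range : Set S))
    rw [hm, hn] at hlt ⊢
    rw [← pow_succ']
    exact pow_dvd_pow p ((Nat.pow_lt_pow_iff_right hp.one_lt).1 hlt)
  · obtain ⟨b, hb⟩ := Subgroup.card_dvd_of_le (hX.conjAut_le hχ)
    have hpb : ¬ p ∣ b := fun h => hA (by
      rw [hb, mul_comm]
      exact mul_dvd_mul_left _ h)
    have h2 : Nat.card (conjAut θ) ∣ Nat.card S := by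
      refine dvd_trans ?_ (Subgroup.card_subgroup_dvd_card
        (Subgroup.normalizer (θ.range : Set S)))
      rw [card_normalizer_range hi]
      exact dvd_mul_left _ _
    obtain ⟨k, hk⟩ := IsPGroup.iff_card.1 hX.isPGroup
    obtain ⟨n, -, hn⟩ := (Nat.dvd_prime_pow hp).1 (hk ▸ h2)
    have h1 := Subgroup.card_dvd_of_le (hX.conjAut_le hθ)
    rw [hn, hb] at h1
    rw [hn]
    exact Nat.le_of_dvd Nat.card_pos
      ((Nat.Coprime.pow_left n ((Nat.Prime.coprime_iff_not_dvd hp).2 hpb)).dvd_of_dvd_mul_right h1)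

/-- If `K` acts on a normal subgroup `L` through elements of `S`, along `β : L → S`, and
`Φ(β, β) / |C_S(β(L))|` is a unit, then `β` extends to a homomorphism on `K` related to `ψ`
whenever `β` is related to `ψ|_L`. -/
theorem exists_extension (hK : IsPGroup p K) (L : Subgroup K) [L.Normal] (β : L →* S)
    (hβ : ∀ u : K, ∃ s, ∀ l : L, β (MulAut.conjNormal u l) = s * β l * s⁻¹)
    (hC : ¬ ((p * Nat.card (Subgroup.centralizer (β.range : Set S)) : ℕ) : ZLoc p) ∣ marks β β X)
    (ψ : K →* S) (h : Related X β (ψ.comp L.subtype)) :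
    ∃ χ : K →* S, χ.comp L.subtype = β ∧ Related X χ ψ := by
  have := finite_monoidHom K S
  have := Fintype.ofFinite {χ : K →* S // χ.comp L.subtype = β}
  have h1 := dvd_marks_sub_sum_extensions hK hX.isPGroup L β hβ ψ X
  by_contra! hcon
  have h0 : ∀ χ : {χ : K →* S // χ.comp L.subtype = β}, marks χ.1 ψ X = 0 := fun χ =>
    not_not.1 (hcon χ.1 χ.2)
  rw [Finset.sum_eq_zero fun χ _ => h0 χ, sub_zero, hX.marks_of_related h] at h1
  exact hC h1

/-- Related homomorphisms have related restrictions to a normal subgroup `L`.  Choose `χ` optimal in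
the class of `φ|_L`; as `Aut_S(χ(L))` has index prime to `p`, an automorphism of the class moves `χ`
to some `β` along which `K` acts on `L` through elements of `S`.  Then `Φ(β, φ|_L)` and `Φ(β, ψ|_L)`
are congruent to the same sum over the extensions of `β`, and the first of them does not vanish. -/
theorem related_restrict_normal (hK : IsPGroup p K) {φ ψ : K →* S} (h : Related X φ ψ)
    (L : Subgroup K) [L.Normal] : Related X (φ.comp L.subtype) (ψ.comp L.subtype) := by
  have := finite_monoidHom K S
  have : Finite (MulAut L) := DFunLike.finite _
  obtain ⟨χ, hχ, hC, hA⟩ := hX.exists_optimal (hK.to_subgroup L) (φ.comp L.subtype)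
  set A := hX.relatedAut (φ.comp L.subtype) with hAdef
  have hconj : ∀ u : K, MulAut.conjNormal u ∈ A := fun u =>
    hX.related_symm (hX.related_conj (φ u) fun l => by
      change φ (MulAut.conjNormal u l : L) = φ u * φ l * (φ u)⁻¹
      simp)
  let f : K →* A := (MulAut.conjNormal (H := L)).codRestrict A hconj
  obtain ⟨a, ha⟩ : ∃ a : A, ∀ u : K, a⁻¹ * f u * a ∈ (conjAut χ).subgroupOf A := by
    let := MulAction.compHom (A ⧸ (conjAut χ).subgroupOf A) f
    obtain ⟨q, hq⟩ := hK.nonempty_fixed_point_of_prime_not_dvd_card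
      (A ⧸ (conjAut χ).subgroupOf A) (fun hdvd => hA (by
        rw [Subgroup.card_eq_card_quotient_mul_card_subgroup ((conjAut χ).subgroupOf A),
          Nat.card_congr (Subgroup.subgroupOfEquivOfLe (hX.conjAut_le hχ)).toEquiv]
        exact mul_dvd_mul_right hdvd _))
    induction q using QuotientGroup.induction_on with | H a => ?_
    refine ⟨a, fun u => ?_⟩
    have h1 : ((f u * a : A) : A ⧸ (conjAut χ).subgroupOf A) = (a : A) := hq u
    rw [mul_assoc]
    exact QuotientGroup.eq.1 h1.symm
  set β : L →* S := χ.comp (a⁻¹ : MulAut L).toMonoidHom with hβdef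
  have hβχ : marks β β X = marks χ χ X := by
    rw [hβdef, marks_comp_of_surjective _ _ _ (a⁻¹ : MulAut L).surjective]
  have hrange : β.range = χ.range := by
    rw [hβdef, MonoidHom.range_comp, MonoidHom.range_eq_top.2 (a⁻¹ : MulAut L).surjective,
      ← MonoidHom.range_eq_map]
  have hβφ : Related X β (φ.comp L.subtype) := by
    have h1 : Related X β ((φ.comp L.subtype).comp (a⁻¹ : MulAut L).toMonoidHom) :=
      (related_comp_iff _ (a⁻¹ : MulAut L).surjective).2 (hX.related_symm hχ)
    exact hX.related_trans h1 (hX.related_symm (A.inv_mem a.2))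
  have hβ : ∀ u : K, ∃ s, ∀ l : L, β (MulAut.conjNormal u l) = s * β l * s⁻¹ := by
    intro u
    obtain ⟨s, hs⟩ := mem_conjAut.1 (Subgroup.mem_subgroupOf.1 (ha u))
    refine ⟨s, fun l => ?_⟩
    have := hs ((a⁻¹ : MulAut L) l)
    change χ ((a⁻¹ : MulAut L) (MulAut.conjNormal u l)) = _
    refine Eq.trans ?_ this
    change _ = χ ((a⁻¹ : MulAut L) (MulAut.conjNormal u ((a : MulAut L) ((a⁻¹ : MulAut L) l))))
    rw [MulAut.apply_inv_self]
  rw [← hrange, ← hβχ] at hC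
  have := Fintype.ofFinite {χ : K →* S // χ.comp L.subtype = β}
  have h1 := dvd_marks_sub_sum_extensions hK hX.isPGroup L β hβ φ X
  have h2 := dvd_marks_sub_sum_extensions hK hX.isPGroup L β hβ ψ X
  rw [Finset.sum_congr rfl fun (χ : {χ : K →* S // χ.comp L.subtype = β}) _ =>
    hX.marks_right h χ.1] at h2
  rw [hX.marks_of_related hβφ] at h1
  refine hX.related_trans (hX.related_symm hβφ) fun h0 => hC ?_
  rw [h0] at h2
  have := dvd_sub h1 h2
  simpa using this

/-- Related homomorphisms have related restrictions. -/
theorem related_comp (hK : IsPGroup p K) {φ ψ : K →* S} (h : Related X φ ψ) {L : Type u} [Group L]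
    (i : L →* K) : Related X (φ.comp i) (ψ.comp i) := by
  induction hn : Nat.card K using Nat.strong_induction_on generalizing K with
  | _ n ih =>
  rcases eq_top_or_exists_le_coatom i.range with hi | ⟨M, hM, hiM⟩
  · exact (related_comp_iff i (MonoidHom.range_eq_top.1 hi)).2 h
  · have := hK.isNilpotent
    have hN : M.Normal :=
      Subgroup.NormalizerCondition.normal_of_coatom M Group.normalizerCondition_of_isNilpotent hM
    have h1 := ih (Nat.card M) (hn ▸ lt_of_le_of_ne (Subgroup.card_le_card_group M)
      fun e => hM.1 (Subgroup.eq_top_of_card_eq M e)) (hK.to_subgroup M)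
      (hX.related_restrict_normal hK h M) (i.codRestrict M fun l => hiM ⟨l, rfl⟩) rfl
    exact h1

end IsReciprocal
end BurnsideLoc

/-! ### Fusion systems -/

theorem PreFusionSystem.mem_of_eq {S : Type u} [Group S] (F : PreFusionSystem S)
    {P Q R : Subgroup S} {φ : P →* Q} {ψ : P →* R} (hφ : φ ∈ F.Hom P Q)
    (h : ∀ x, (ψ x : S) = φ x) : ψ ∈ F.Hom P R := by
  have := F.codRestrict hφ (R := R) fun x => by
    change (φ x : S) ∈ R
    rw [← h]
    exact (ψ x).2
  convert this
  ext x
  exact h x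

/-- A fusion system contains all restrictions of its morphisms, up to conjugation in `S`. -/
theorem FusionSystem.mem_of_conj_restrict {S : Type u} [Group S] (F : FusionSystem S)
    {L R T Q : Subgroup S} {χ : L →* R} (hχ : χ ∈ F.Hom L R) {ψ : T →* Q} (h g : S)
    (hψ : ∀ k : T, ∃ t : L, (t : S) = g * k * g⁻¹ ∧ (ψ k : S) = h * χ t * h⁻¹) :
    ψ ∈ F.Hom T Q := by
  have hg : ∀ k : T, (MulAut.conj g) k ∈ L := fun k => by
    obtain ⟨t, ht, -⟩ := hψ k
    change g * k * g⁻¹ ∈ L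
    rw [← ht]
    exact t.2
  let c : T →* L := ((MulAut.conj g).toMonoidHom.comp T.subtype).codRestrict L hg
  have hc : c ∈ F.Hom T L := F.conj_mem c g fun _ => rfl
  let d : R →* (⊤ : Subgroup S) :=
    ((MulAut.conj h).toMonoidHom.comp R.subtype).codRestrict ⊤ fun _ => trivial
  have hd : d ∈ F.Hom R ⊤ := F.conj_mem d h fun _ => rfl
  refine F.mem_of_eq (F.comp_mem (F.comp_mem hc hχ) hd) fun k => ?_
  obtain ⟨t, ht, hk⟩ := hψ k
  have : c k = t := Subtype.ext ht.symm
  rw [hk, ← this]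
  rfl

theorem FusionSystem.IsConj.symm_trans {S : Type u} [Group S] {F : FusionSystem S} {P Q R : Subgroup S} (h : F.IsConj P Q)
    (h' : F.IsConj P R) : F.IsConj Q R := by
  obtain ⟨e, he⟩ := h
  obtain ⟨f, hf⟩ := h'
  exact ⟨e.symm.trans f, F.comp_mem (F.symm_mem e he) hf⟩

theorem conjAut_subtype {S : Type u} [Group S] (P : Subgroup S) : conjAut P.subtype = FusionSystem.autInner P := by
  ext α
  rw [mem_conjAut]
  constructor
  · rintro ⟨s, hs⟩
    have hs' : s ∈ Subgroup.normalizer (P : Set S) := by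
      rw [Subgroup.mem_normalizer_iff]
      intro x
      constructor
      · intro hx
        have := hs ⟨x, hx⟩
        change _ = s * x * s⁻¹ at this
        rw [← this]
        exact (α ⟨x, hx⟩).2
      · intro hx
        have := hs (α⁻¹ ⟨_, hx⟩)
        rw [MulAut.apply_inv_self] at this
        change s * x * s⁻¹ = s * _ * s⁻¹ at this
        rw [mul_left_inj, mul_right_inj] at this
        rw [this]
        exact (α⁻¹ ⟨_, hx⟩).2
    exact ⟨⟨s, hs'⟩, MulEquiv.ext fun k => Subtype.ext (hs k).symm⟩
  · rintro ⟨s, rfl⟩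
    exact ⟨s, fun k => rfl⟩

namespace BurnsideLoc
variable {p : ℕ} [Fact p.Prime] {S : Type u} [Group S] {X : BurnsideLoc p S S}

theorem injective_of_related_subtype (hX : X ∈ free p S S) {P : Subgroup S} {φ : P →* S}
    (h : Related X φ P.subtype) : Function.Injective φ := by
  refine (injective_iff_map_eq_one φ).2 fun k hk => ?_
  by_contra hne
  exact h (marks_eq_zero_of_left φ P.subtype k hk (fun h => hne (Subtype.ext h)) hX)

variable [Finite S]

namespace IsReciprocal
variable (hX : IsReciprocal X)
include hX

/-- The right stabilizer system consists of the homomorphisms related to the inclusion. -/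
theorem mem_rStab_iff {P Q : Subgroup S} {φ : P →* Q} :
    φ ∈ (rStab X).Hom P Q ↔
      Function.Injective φ ∧ Related X (Q.subtype.comp φ) P.subtype := by
  refine and_congr_right fun hi => ?_
  constructor
  · intro h
    have h1 := congrArg (marks (Q.subtype.comp φ) (MonoidHom.id P)) h
    rw [marks_comp_ofHom, marks_comp_ofHom, MonoidHom.comp_id, MonoidHom.comp_id] at h1
    unfold Related
    rw [← h1]
    exact hX.related_self _
  · intro h
    refine eq_of_fixedPoints_eq fun L ρ => ?_
    rw [fixedPoints_eq_marks, marks_comp_ofHom, marks_comp_ofHom]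
    exact (hX.marks_right (hX.related_comp (hX.isPGroup.to_subgroup P) h L.subtype) ρ).symm

theorem preFix_eq_rStab : preFix X = (rStab X).toPreFusionSystem := by
  refine PreFusionSystem.ext (funext fun P => funext fun Q => Set.ext fun φ => ?_)
  rw [hX.mem_rStab_iff]
  change _ ∧ fixedPoints P (Q.subtype.comp φ) X ≠ 0 ↔ _
  rw [fixedPoints_eq_marks]
  rfl

theorem fixFusion_eq_rStab : fixFusion X = rStab X := by
  refine FusionSystem.ext (funext fun P => funext fun Q => Set.Subset.antisymm ?_ ?_)
  · refine PreFusionSystem.closure_le _ (rStab X) ?_ P Q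
    rw [hX.preFix_eq_rStab]
    exact fun _ _ => subset_rfl
  · rw [← hX.preFix_eq_rStab]
    exact PreFusionSystem.le_closure (preFix X) P Q

/-- If `[L, χ]` occurs in a bifree `X`, then `χ` is injective, so it lies in `PreOrb(X)`. -/
theorem codRestrict_mem_preOrb_of_coeff {L : Subgroup S} {χ : L →* S} (h : coeff L χ X ≠ 0) :
    χ.codRestrict (⊤ : Subgroup S) (fun _ => trivial) ∈ (preOrb X).Hom L ⊤ := by
  refine ⟨fun a b e => ?_, h⟩
  have hi : Function.Injective χ := by
    by_contra hi
    exact h (coeff_eq_zero_of_not_injective hi hX.bifree)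
  exact hi (congrArg Subtype.val e)

/-- If `[L, χ]` occurs in `X`, then `χ` is related to the inclusion.  This holds by descending
induction on `L`, as otherwise `X` would have fixed points of type `(L, χ)` by triangularity of the
table of marks. -/
theorem codRestrict_mem_rStab_of_coeff {L : Subgroup S} {χ : L →* S} (h : coeff L χ X ≠ 0) :
    χ.codRestrict (⊤ : Subgroup S) (fun _ => trivial) ∈ (rStab X).Hom L ⊤ := by
  induction hn : Nat.card S - Nat.card L using Nat.strong_induction_on generalizing L with
  | _ n ih =>
  by_contra hnot
  refine hnot ?_
  rw [← hX.preFix_eq_rStab]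
  refine ⟨(hX.codRestrict_mem_preOrb_of_coeff h).1, ?_⟩
  change fixedPoints L χ X ≠ 0
  refine fixedPoints_ne_zero_of_coeff h fun M ρ hM hρ => ?_
  by_contra hne
  refine hnot ?_
  obtain ⟨x, hx⟩ := exists_fixed_of_fixedPoints_ne_zero hne
  obtain ⟨s, g, hs⟩ := Biset.exists_conj_of_fixed x hx
  have hcard := Subgroup.card_le_card_group M
  exact (rStab X).mem_of_conj_restrict (ih _ (by omega) hρ rfl) s g hs

theorem orbFusion_eq_rStab : orbFusion X = rStab X := by
  refine FusionSystem.ext (funext fun P => funext fun Q => Set.Subset.antisymm ?_ ?_)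
  · refine PreFusionSystem.closure_le _ (rStab X) (fun P Q φ hφ => ?_) P Q
    exact (rStab X).mem_of_eq (hX.codRestrict_mem_rStab_of_coeff hφ.2) fun x => rfl
  · intro φ hφ
    rw [← hX.preFix_eq_rStab] at hφ
    obtain ⟨L, χ, hχ, hne⟩ := exists_coeff_of_fixedPoints_ne_zero hφ.2
    obtain ⟨x, hx⟩ := exists_fixed_of_fixedPoints_ne_zero hne
    obtain ⟨s, g, hs⟩ := Biset.exists_conj_of_fixed x hx
    exact (orbFusion X).mem_of_conj_restrict
      (PreFusionSystem.le_closure (preOrb X) _ _ (hX.codRestrict_mem_preOrb_of_coeff hχ)) s g hs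

theorem isRightCharacteristic : IsRightCharacteristic (rStab X) X where
  generated := by
    have := finite_pairClass S S
    have := Fintype.ofFinite (PairClass S S)
    unfold IsGenerated
    rw [eq_sum_coeff X]
    refine Submodule.sum_mem _ fun b _ => ?_
    by_cases hb : coeff b.out.1 b.out.2 X = 0
    · rw [hb, zero_smul]
      exact zero_mem _
    · rw [← eq_sum_coeff X]
      exact Submodule.smul_mem _ _ (Submodule.subset_span
        ⟨_, _, hX.codRestrict_mem_rStab_of_coeff hb, rfl⟩)
  stable _ _ hφ := hφ.2
  augmentation := hX.augmentation

theorem relatedAut_subtype (P : Subgroup S) : hX.relatedAut P.subtype = (rStab X).aut P := by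
  ext α
  change Related X P.subtype (P.subtype.comp α.toMonoidHom) ↔ α.toMonoidHom ∈ (rStab X).Hom P P
  rw [hX.mem_rStab_iff]
  exact ⟨fun h => ⟨α.injective, hX.related_symm h⟩, fun h => hX.related_symm h.2⟩

/-- The `rStab X`-conjugates of `P` are the images of the homomorphisms related to the inclusion. -/
theorem isConj_iff {P Q : Subgroup S} :
    (rStab X).IsConj P Q ↔ ∃ θ : P →* S, Related X P.subtype θ ∧ Q = θ.range := by
  constructor
  · rintro ⟨e, he⟩
    refine ⟨Q.subtype.comp e.toMonoidHom, hX.related_symm (hX.mem_rStab_iff.1 he).2, ?_⟩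
    rw [MonoidHom.range_comp, MonoidHom.range_eq_top.2 e.surjective, ← MonoidHom.range_eq_map,
      Subgroup.range_subtype]
  · rintro ⟨θ, hθ, rfl⟩
    have hi := injective_of_related_subtype hX.bifree (hX.related_symm hθ)
    refine ⟨θ.ofInjective hi, hX.mem_rStab_iff.2 ⟨(θ.ofInjective hi).injective, ?_⟩⟩
    exact hX.related_symm hθ

/-- A fully normalized `P` attains the maximal orders of both the centralizer and the group of
`S`-automorphisms, as `|N_S(P)|` is their product and some conjugate attains both maxima. -/
theorem sylow_of_fullyNormalized {P : Subgroup S} (hP : (rStab X).FullyNormalized P) :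
    (rStab X).FullyCentralized P ∧ ∃ T : Sylow p ((rStab X).aut P),
      (T : Subgroup ((rStab X).aut P)).map ((rStab X).aut P).subtype =
        FusionSystem.autInner P := by
  have hPp := hX.isPGroup.to_subgroup P
  obtain ⟨χ, hχ, hC, hA⟩ := hX.exists_optimal hPp P.subtype
  have hχi := injective_of_related_subtype hX.bifree (hX.related_symm hχ)
  have hPrange : P.subtype.range = P := P.range_subtype
  have hle := hX.card_le_of_optimal hχ hC hA (hX.related_self _) P.subtype_injective
  have hN := hP _ (hX.isConj_iff.2 ⟨χ, hχ, rfl⟩)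
  rw [card_normalizer_range hχi] at hN
  have hN' := card_normalizer_range P.subtype_injective
  rw [hPrange] at hN' hle
  rw [hN'] at hN
  have hCpos : 0 < Nat.card (Subgroup.centralizer (χ.range : Set S)) := Nat.card_pos
  have hfinA : Finite (MulAut P) := DFunLike.finite _
  have hApos : 0 < Nat.card (conjAut χ) := Nat.card_pos
  have hCeq : Nat.card (Subgroup.centralizer (P : Set S)) =
      Nat.card (Subgroup.centralizer (χ.range : Set S)) := by
    refine le_antisymm hle.1 ?_
    by_contra hlt
    exact absurd hN (not_le.2 (Nat.mul_lt_mul_of_lt_of_le (not_le.1 hlt) hle.2 hApos))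
  have hAeq : Nat.card (conjAut P.subtype) = Nat.card (conjAut χ) := by
    refine le_antisymm hle.2 ?_
    by_contra hlt
    exact absurd hN (not_le.2 (Nat.mul_lt_mul_of_le_of_lt hle.1 (not_le.1 hlt) hCpos))
  refine ⟨fun Q hQ => ?_, ?_⟩
  · obtain ⟨θ, hθ, rfl⟩ := hX.isConj_iff.1 hQ
    rw [hCeq]
    exact (hX.card_le_of_optimal hχ hC hA hθ
      (injective_of_related_subtype hX.bifree (hX.related_symm hθ))).1
  · rw [← hAeq, relatedAut_subtype, conjAut_subtype] at hA
    have hsub : FusionSystem.autInner P ≤ (rStab X).aut P := by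
      rw [← conjAut_subtype, ← hX.relatedAut_subtype]
      exact hX.conjAut_le (hX.related_self _)
    have hpg : IsPGroup p ((FusionSystem.autInner P).subgroupOf ((rStab X).aut P)) := by
      have h1 : IsPGroup p (FusionSystem.autInner P) :=
        (hX.isPGroup.to_subgroup _).of_surjective (P.normalizerMonoidHom.rangeRestrict)
          P.normalizerMonoidHom.rangeRestrict_surjective
      exact h1.of_equiv (Subgroup.subgroupOfEquivOfLe hsub).symm
    refine ⟨hpg.toSylow fun hdvd => hA ?_, ?_⟩
    · rw [← ((FusionSystem.autInner P).subgroupOf ((rStab X).aut P)).card_mul_index,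
        Nat.card_congr (Subgroup.subgroupOfEquivOfLe hsub).toEquiv, mul_comm p]
      exact mul_dvd_mul_left _ hdvd
    · rw [IsPGroup.toSylow_coe, Subgroup.subgroupOf_map_subtype]
      exact inf_eq_left.2 hsub
/-- If `P` is normal in `N`, and the conjugation action of `N` on `P` corresponds along a related
`φ` to conjugations in `S`, then `φ` extends to a related homomorphism on `N`, provided that `φ(P)`
is fully centralized. -/
theorem exists_extension_of_le {P N : Subgroup S} (hPN : P ≤ N)
    (hN : N ≤ Subgroup.normalizer (P : Set S)) (φ : P →* S) (hrel : Related X φ P.subtype)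
    (hfc : (rStab X).FullyCentralized φ.range)
    (hφ : ∀ u ∈ N, ∃ y, ∀ a b : P, (b : S) = u * a * u⁻¹ → φ b = y * φ a * y⁻¹) :
    ∃ ψ : N →* S, Related X ψ N.subtype ∧ ∀ (u : P) (v : N), (v : S) = u → ψ v = φ u := by
  have hPp := hX.isPGroup.to_subgroup P
  -- As `φ(P)` is fully centralized, its centralizer is as large as that of an optimal conjugate.
  obtain ⟨χ, hχ, hC, hA⟩ := hX.exists_optimal hPp P.subtype
  have hconj : (rStab X).IsConj φ.range χ.range :=
    (hX.isConj_iff.2 ⟨φ, hX.related_symm hrel, rfl⟩).symm_trans (hX.isConj_iff.2 ⟨χ, hχ, rfl⟩)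
  have hφi : Function.Injective φ := injective_of_related_subtype hX.bifree hrel
  have hCeq := le_antisymm (hfc _ hconj)
    (hX.card_le_of_optimal hχ hC hA (hX.related_symm hrel) hφi).1
  rw [hCeq, ((hX.associated_marks
    (hX.related_trans (hX.related_symm hχ) (hX.related_symm hrel))).dvd_iff_dvd_right)] at hC
  have hnormal : (P.subgroupOf N).Normal := Subgroup.normal_subgroupOf_of_le_normalizer hN
  obtain ⟨i, hi⟩ : ∃ i : P.subgroupOf N ≃* P, ∀ l, (i l : S) = l :=
    ⟨Subgroup.subgroupOfEquivOfLe hPN, fun _ => rfl⟩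
  have hsubtype : P.subtype.comp i.toMonoidHom = N.subtype.comp (P.subgroupOf N).subtype :=
    MonoidHom.ext hi
  have hrange : (φ.comp i.toMonoidHom).range = φ.range := by
    rw [MonoidHom.range_comp, MonoidHom.range_eq_top.2 i.surjective, ← MonoidHom.range_eq_map]
  obtain ⟨ψ, hψ, hψr⟩ := hX.exists_extension (hX.isPGroup.to_subgroup N) (P.subgroupOf N)
    (φ.comp i.toMonoidHom)
    (fun u => by
      obtain ⟨y, hy⟩ := hφ u u.2
      refine ⟨y, fun l => hy (i l) (i (MulAut.conjNormal u l)) ?_⟩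
      rw [hi, hi, MulAut.conjNormal_apply]
      rfl)
    (by
      rw [marks_comp_of_surjective φ φ i.toMonoidHom i.surjective, hrange]
      exact hC)
    N.subtype (by
      rw [← hsubtype]
      exact (related_comp_iff i.toMonoidHom i.surjective).2 hrel)
  refine ⟨ψ, hψr, fun u v huv => ?_⟩
  have hv : v ∈ P.subgroupOf N := by
    rw [Subgroup.mem_subgroupOf, huv]
    exact u.2
  have h1 : ψ v = φ (i ⟨v, hv⟩) := DFunLike.congr_fun hψ ⟨v, hv⟩
  rw [h1, show i ⟨v, hv⟩ = u from Subtype.ext ((hi _).trans huv)]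

/-- The right stabilizer system is saturated. -/
theorem isSaturated : (rStab X).IsSaturated p where
  sylow _ hP := hX.sylow_of_fullyNormalized hP
  extension P φ hφ hfc := by
    obtain ⟨ψ, hψr, hψ⟩ := hX.exists_extension_of_le
      (N := FusionSystem.extender ((⊤ : Subgroup S).subtype.comp φ))
      (fun u hu => ⟨Subgroup.le_normalizer hu, φ ⟨u, hu⟩, Subgroup.le_normalizer ⟨_, rfl⟩,
        fun a b hab => by
          rw [show b = ⟨u, hu⟩ * a * ⟨u, hu⟩⁻¹ from Subtype.ext hab, map_mul, map_mul, map_inv]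
          rfl⟩)
      (fun u hu => hu.1) _ (hX.mem_rStab_iff.1 hφ).2 hfc
      (fun u ⟨_, y, _, h⟩ => ⟨y, fun a b => h a b⟩)
    refine ⟨ψ.codRestrict ⊤ fun _ => trivial, hX.mem_rStab_iff.2 ⟨fun a b e => ?_, hψr⟩, ?_⟩
    · exact injective_of_related_subtype hX.bifree hψr (congrArg Subtype.val e)
    · exact fun u v huv => Subtype.ext (hψ u v huv)

end IsReciprocal

/-- A generated element has fixed points of type `(P, φ)` only if `φ` belongs to the fusion
system. -/
theorem mem_of_isGenerated {F : FusionSystem S} (hX : IsGenerated F X) {P Q : Subgroup S}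
    {φ : P →* Q} (h : fixedPoints P (Q.subtype.comp φ) X ≠ 0) : φ ∈ F.Hom P Q := by
  by_contra hφ
  refine h ?_
  have : Submodule.span (ZLoc p) {x | ∃ (T : Subgroup S) (φ : T →* (⊤ : Subgroup S)),
      φ ∈ F.Hom T ⊤ ∧ x = basisElt p T ((⊤ : Subgroup S).subtype.comp φ)} ≤
      LinearMap.ker (fixedPoints P (Q.subtype.comp φ)) := by
    rw [Submodule.span_le]
    rintro _ ⟨T, χ, hχ, rfl⟩
    change fixedPoints P (Q.subtype.comp φ) (cl p (Biset.std T _)) = 0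
    by_contra hne
    obtain ⟨x, hx⟩ := exists_fixed_of_fixedPoints_ne_zero hne
    obtain ⟨s, g, hs⟩ := Biset.exists_conj_of_fixed x hx
    exact hφ (F.mem_of_conj_restrict hχ s g hs)
  exact this hX

theorem frobeniusReciprocity_of_isRightCharacteristic {F : FusionSystem S} (hX : X ∈ free p S S)
    (hF : IsRightCharacteristic F X) : FrobeniusReciprocity X := by
  refine eq_of_fixedPoints_eq fun P ρ => ?_
  obtain ⟨φ, φ', rfl⟩ : ∃ φ φ' : P →* S, ρ = φ.prod φ' :=
    ⟨(MonoidHom.fst S S).comp ρ, (MonoidHom.snd S S).comp ρ, MonoidHom.ext fun _ => rfl⟩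
  rw [fixedPoints_eq_marks, marks_prod_diag_comp, marks_comp_ofHom]
  change marks (φ.prod φ') (P.subtype.prod P.subtype) (prod X X) = _
  rw [marks_prod]
  by_cases h : Related X φ' P.subtype
  · have hi := injective_of_related_subtype hX h
    have hmem : φ'.codRestrict (⊤ : Subgroup S) (fun _ => trivial) ∈ F.Hom P ⊤ :=
      mem_of_isGenerated hF.generated (by rw [fixedPoints_eq_marks]; exact h)
    have h1 := congrArg (marks φ (MonoidHom.id P)) (hF.stable P _ hmem)
    rw [marks_comp_ofHom, marks_comp_ofHom, MonoidHom.comp_id, MonoidHom.comp_id] at h1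
    rw [← h1]
    rfl
  · rw [show marks φ' P.subtype X = 0 from not_not.1 h, mul_zero, mul_zero]

end BurnsideLoc

end BurnsideFusion

open BurnsideFusion
theorem theoremB (p : ℕ) [Fact p.Prime] {S : Type*} [Group S] [Finite S] (hS : IsPGroup p S)
    (X : BurnsideLoc p S S) (hX : X ∈ BurnsideLoc.free p S S)
    (hε : ¬ (p : ZLoc p) ∣ BurnsideLoc.augmentation X) :
    ((∃ F : FusionSystem S, F.IsSaturated p ∧ IsRightCharacteristic F X) ↔
      BurnsideLoc.FrobeniusReciprocity X) ∧
    (BurnsideLoc.FrobeniusReciprocity X →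
      preFix X = (fixFusion X).toPreFusionSystem ∧
      fixFusion X = orbFusion X ∧
      orbFusion X = rStab X ∧
      (rStab X).IsSaturated p ∧
      IsRightCharacteristic (rStab X) X) := by
  have key : BurnsideLoc.FrobeniusReciprocity X → BurnsideLoc.IsReciprocal X :=
    fun h => ⟨hS, hX, hε, h⟩
  refine ⟨⟨fun ⟨F, _, hF⟩ => BurnsideLoc.frobeniusReciprocity_of_isRightCharacteristic hX hF,
    fun h => ⟨rStab X, (key h).isSaturated, (key h).isRightCharacteristic⟩⟩, fun h => ?_⟩
  have h := key h
  refine ⟨?_, ?_, h.orbFusion_eq_rStab, h.isSaturated, h.isRightCharacteristic⟩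
  · rw [h.fixFusion_eq_rStab, h.preFix_eq_rStab]
  · rw [h.fixFusion_eq_rStab, h.orbFusion_eq_rStab]
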